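/- Let $d\ge 1$. For $\delta>0$, a $\delta$-tube in $\mathbf R^d$ is the image $R=U([0,1]\times B(0,\delta))$ of $[0,1]\times B(0,\delta)\subset\mathbf R\times\mathbf R^{d-1}$ by an affine isometry $U$ of $\mathbf R^d$, where $B(0,\delta)$ is the open Euclidean ball, and $\overline R=U([2,3]\times B(0,\delta))$ is the corresponding shifted tube. Let $f_d(\delta)$ be the infimum of the real numbers $\varepsilon>0$ for which there is a nonempty finite family $(R_j)$ of $\delta$-tubes such that the $\overline R_j$ are pairwise disjoint and $$\frac{\big|\bigcup_j R_j\big|}{\sum_j|R_j|}\le\varepsilon .$$ Let $1\le p\le\infty$ (with $1/\infty=0$). For a symbol $m:\mathbf R^d\to\mathbf C$ such that $m\widehat f$ is integrable for every Schwartz function $f$ (for instance, $m$ bounded and measurable), let $T_mf$ be the inverse Fourier transform of $m\widehat f$, where $\widehat f(\xi)=\int f(x)e^{-2i\pi\langle x,\xi\rangle}dx$, and let $\|T_m\|_p\in[0,\infty]$ be the least $A$ such that $\|T_mf\|_p\le A\|f\|_p$ for all Schwartz functions $f$. The multiplier is called $L_p$-bounded if $\|T_m\|_p<\infty$. (1)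 There is a constant $C_d$, depending only on $d$, such that for every $p\in[1,\infty]$ and every measurable $\varphi:\mathbf R\to\mathbf C$ for which the multiplier with symbol $m(\xi)=\varphi(\log|\xi|)$ is $L_p$-bounded on $\mathbf R^d$, one has for almost every $(s,t)\in\mathbf R^2$ $$|\varphi(s)-\varphi(t)|\le C_d\,\|T_m\|_p\left(\int_0^{\min(1,|s-t|^{1/4})}\frac{f_d(\delta)^{|\frac1p-\frac12|}}{\delta}\,d\delta+|s-t|^{1/4}\right),$$ where the integral may be $+\infty$ (and $0\cdot\infty=0$). (2) Let $p\in[1,\infty]$, and assume that there is a measurable $m:(0,\infty)\to\mathbf C$ that does not coincide almost everywhere with a continuous function on $(0,\infty)$, such that the radial multiplier with symbol $\xi\mapsto m(|\xi|)$ is $L_p$-bounded on $\mathbf R^d$. Then $$\int_0^1\frac{f_d(\delta)^{|\frac1p-\frac12|}}{\delta}\,d\delta=\infty .$$ -/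

import Mathlib

open MeasureTheory Set FourierTransform SchwartzMap
open scoped NNReal ENNReal

/-- The cylinder `[a, b] × B(0, δ)` in `ℝ × ℝ^(d-1) = ℝ^d` (the first coordinate is the axis,
and `B(0, δ)` is the open Euclidean ball of the other `d - 1` coordinates). -/
def modelTube (d : ℕ) [NeZero d] (a b δ : ℝ) : Set (EuclideanSpace ℝ (Fin d)) :=
  {x | x 0 ∈ Icc a b ∧ √(∑ i ∈ Finset.univ.erase 0, (x i) ^ 2) < δ}

/-- The `δ`-tube `R` given by an affine isometry `U` of `ℝ^d`: the image of `[0, 1] × B(0, δ)`. -/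
def tube {d : ℕ} [NeZero d] (δ : ℝ)
    (U : EuclideanSpace ℝ (Fin d) ≃ᵃⁱ[ℝ] EuclideanSpace ℝ (Fin d)) :
    Set (EuclideanSpace ℝ (Fin d)) :=
  U '' modelTube d 0 1 δ

/-- The shifted tube given by an affine isometry `U` of `ℝ^d`: the image of `[2, 3] × B(0, δ)`. -/
def shiftedTube {d : ℕ} [NeZero d] (δ : ℝ)
    (U : EuclideanSpace ℝ (Fin d) ≃ᵃⁱ[ℝ] EuclideanSpace ℝ (Fin d)) :
    Set (EuclideanSpace ℝ (Fin d)) :=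
  U '' modelTube d 2 3 δ

/-- The Kakeya compression function `f_d`: the infimum of the `ε > 0` for which there is a
nonempty finite family of `δ`-tubes whose shifts are pairwise disjoint and such that
`|⋃ R_j| / ∑ |R_j| ≤ ε`. -/
noncomputable def kakeyaFun (d : ℕ) [NeZero d] (δ : ℝ) : ℝ :=
  sInf {ε : ℝ | 0 < ε ∧ ∃ (N : ℕ) (_ : 0 < N)
    (U : Fin N → (EuclideanSpace ℝ (Fin d) ≃ᵃⁱ[ℝ] EuclideanSpace ℝ (Fin d))),
    Pairwise (fun i j => Disjoint (shiftedTube δ (U i)) (shiftedTube δ (U j))) ∧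
    volume.real (⋃ j, tube δ (U j)) / ∑ j, volume.real (tube δ (U j)) ≤ ε}

/-- The integrand `f_d(δ)^|1/p - 1/2| / δ` (with `1/∞ = 0`). -/
noncomputable def kakeyaDensity (d : ℕ) [NeZero d] (p : ℝ≥0∞) (δ : ℝ) : ℝ :=
  kakeyaFun d δ ^ |(p⁻¹).toReal - 1 / 2| / δ

/-- The Fourier multiplier with symbol `m` on Schwartz functions: the inverse Fourier transform
of `m * 𝓕 f`, where `𝓕 f ξ = ∫ f x * exp (-2πi⟪x, ξ⟫)`. -/
noncomputable def fourierMultiplier {d : ℕ} (m : EuclideanSpace ℝ (Fin d) → ℂ)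
    (f : 𝓢(EuclideanSpace ℝ (Fin d), ℂ)) : EuclideanSpace ℝ (Fin d) → ℂ :=
  𝓕⁻ (fun ξ => m ξ * 𝓕 (f : EuclideanSpace ℝ (Fin d) → ℂ) ξ)

/-- The norm on `L_p(ℝ^d)` of the Fourier multiplier with symbol `m`: the best constant `A` with
`‖T f‖_p ≤ A ‖f‖_p` for all Schwartz functions `f` (`∞` if there is none). -/
noncomputable def multiplierNorm {d : ℕ} (p : ℝ≥0∞) (m : EuclideanSpace ℝ (Fin d) → ℂ) : ℝ≥0∞ :=
  sInf {A : ℝ≥0∞ | ∀ f : 𝓢(EuclideanSpace ℝ (Fin d), ℂ),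
    eLpNorm (fourierMultiplier m f) p volume ≤
      A * eLpNorm (f : EuclideanSpace ℝ (Fin d) → ℂ) p volume}

/-- The Fourier multiplier with symbol `m` is `L_p`-bounded: it is well defined on Schwartz
functions (each `m * 𝓕 f` is integrable, which is automatic for bounded measurable `m`) and its
norm on `L_p` is finite. -/
def IsLpBoundedMultiplier {d : ℕ} (p : ℝ≥0∞) (m : EuclideanSpace ℝ (Fin d) → ℂ) : Prop :=
  (∀ f : 𝓢(EuclideanSpace ℝ (Fin d), ℂ),
    Integrable (fun ξ => m ξ * 𝓕 (f : EuclideanSpace ℝ (Fin d) → ℂ) ξ) volume) ∧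
  multiplierNorm p m < ∞

/-! Testing the multiplier on wave packets turns a compression of tubes into smallness of averages
of its symbol, and summing this smallness over scales gives a modulus of continuity.

By duality the operator becomes the form `∫ m 𝓕f 𝓕⁻g`, bounded on `L_p × L_q`. For radial `m` it
does not change when `f` and `g` are moved by a common isometry. Place copies of one `f` in the
tubes `R_j` and copies of one `g` in the shifted tubes, and take random signs. The diagonal
survives, so `N` times the single coefficient `α` is averaged. For `p ≤ 2`, Hölder on the union and
orthogonality of signs bound `‖∑ ±f_j‖_p` on average, and disjointness bounds `‖∑ ±g_j‖_q`. The
result is `|α| ≤ A |R| f_d(δ)^|1/p-1/2|` (`norm_pairing_le_kakeyaFun`); for `p ≥ 2`, exchange `f`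
and `g`.

Next, `α` is computed for packets of length 1, width `δ` and frequency `1/h` along the axis. After a
dilation, `|ξ|²` becomes `(1 + h x)² + h²|y|²` with `|y|` of order `1/δ`. Dropping the curvature
term `h²|y|²` costs `O(h/δ²)` (`norm_integral_curved_sub_le`). So the averages of `φ(log(e^s |1 + h
x|))` against certain kernels `Ξ` are `O(A f_d(δ)^|1/p-1/2| + b h/δ²)`, where `b` bounds `φ`
(`KakeyaControlled`).

These `Ξ` arise from two separated supports and cannot recover `φ(s)` directly. However, there is a
`Φ` with `∫ Φ ≠ 0` such that `(xΦ)' = Ξ` is of this type (`exists_averaging_kernel`), and `(xΦ)'`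
governs how the average against `Φ` varies with its scale. With scale `h = δ³`, integrating in
`dδ/δ` down to `0` compares `φ(s) ∫ Φ` with an average at scale `δ³`, up to `∫ f_d^|1/p-1/2| dδ/δ +
δ`. Averages at two points at distance `r` differ by `O(r/δ³)`, which equals `O(δ)` when `δ =
r^(1/4)`.

Symbols that are only measurable are treated by mollification in `log |ξ|` and passage to the limit
at Lebesgue points. If the integral converges, the modulus tends to `0` and `φ` has a continuous
version, which gives the second assertion. -/

/-! ### The bilinear form of a multiplier and its symmetries. -/

section Pairing

open Filter Topology

variable {V : Type*} [NormedAddCommGroup V] [InnerProductSpace ℝ V] [FiniteDimensional ℝ V]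
  [MeasurableSpace V] [BorelSpace V]

/-- The bilinear form associated with the Fourier multiplier of symbol `m` is bounded by `A` on
`L_p × L_q`. -/
def PairingBound (p q A : ℝ≥0∞) (m : V → ℂ) : Prop :=
  ∀ f g : 𝓢(V, ℂ), ‖∫ ξ, m ξ * ((𝓕 f) ξ * (𝓕⁻ g) ξ)‖ₑ ≤
    A * (eLpNorm f p volume * eLpNorm g q volume)

theorem fourier_comp_smul {c : ℝ} (hc : c ≠ 0) (f : V → ℂ) (ξ : V) :
    𝓕 (fun x => f (c • x)) ξ = |(c ^ Module.finrank ℝ V)⁻¹| • 𝓕 f (c⁻¹ • ξ) := by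
  rw [Real.fourier_eq, Real.fourier_eq,
    ← Measure.integral_comp_smul (μ := (volume : Measure V))
      (fun v => (Real.fourierChar (-(inner ℝ v (c⁻¹ • ξ)))) • f v) c]
  refine integral_congr_ae (Eventually.of_forall fun v => ?_)
  simp [inner_smul_left, inner_smul_right, hc]

theorem fourierInv_comp_smul {c : ℝ} (hc : c ≠ 0) (f : V → ℂ) (ξ : V) :
    𝓕⁻ (fun x => f (c • x)) ξ = |(c ^ Module.finrank ℝ V)⁻¹| • 𝓕⁻ f (c⁻¹ • ξ) := by
  rw [Real.fourierInv_eq_fourier_neg, fourier_comp_smul hc, Real.fourierInv_eq_fourier_neg,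
    smul_neg]

theorem eLpNorm_comp_smul {c : ℝ} (hc : c ≠ 0) {f : V → ℂ} (hf : Continuous f) (p : ℝ≥0∞) :
    eLpNorm (fun x => f (c • x)) p volume =
      ENNReal.ofReal |(c ^ Module.finrank ℝ V)⁻¹| ^ (p⁻¹).toReal * eLpNorm f p volume := by
  have h := eLpNorm_map_measure (p := p) (μ := (volume : Measure V)) (g := f)
    (f := fun x : V => c • x) hf.aestronglyMeasurable (by fun_prop)
  rw [Measure.map_addHaar_smul _ hc, eLpNorm_smul_measure_of_ne_zero] at h
  · rw [show (fun x => f (c • x)) = f ∘ fun x => c • x from rfl, ← h]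
    simp
  · simp [hc]

/-- Dilating `f` and `g` multiplies their norms by `r^(1/p)` and `r^(1/q)`. Since `1/p + 1/q = 1`,
the product is exactly the Jacobian left by the two Fourier transforms and the change of variables.
-/
theorem PairingBound.comp_smul {p q A : ℝ≥0∞} [hpq : p.HolderConjugate q] {m : V → ℂ}
    (h : PairingBound p q A m) {c : ℝ} (hc : c ≠ 0) :
    PairingBound p q A (fun ξ => m (c • ξ)) := by
  intro f g
  let L : V ≃L[ℝ] V := ContinuousLinearEquiv.smulLeft (Units.mk0 c hc)
  have hL : ∀ x, L x = c • x := fun x => rfl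
  set fc := compCLMOfContinuousLinearEquiv ℂ L f with hfc
  set gc := compCLMOfContinuousLinearEquiv ℂ L g with hgc
  have hfc' : (fc : V → ℂ) = fun x => f (c • x) := by ext x; simp [hfc, hL]
  have hgc' : (gc : V → ℂ) = fun x => g (c • x) := by ext x; simp [hgc, hL]
  set r : ℝ := |(c ^ Module.finrank ℝ V)⁻¹| with hr
  have hr0 : 0 < r := by positivity
  have key : ∫ ξ, m (c • ξ) * ((𝓕 f) ξ * (𝓕⁻ g) ξ) =
      (r⁻¹ : ℝ) • ∫ ξ, m ξ * ((𝓕 fc) ξ * (𝓕⁻ gc) ξ) := by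
    have e1 : ∀ ξ, (𝓕 f) ξ * (𝓕⁻ g) ξ = (r⁻¹ : ℝ) • ((r⁻¹ : ℝ) •
        ((𝓕 fc) (c • ξ) * (𝓕⁻ gc) (c • ξ))) := by
      intro ξ
      have h1 : (𝓕 fc) (c • ξ) = r • (𝓕 f) ξ := by
        rw [fourier_coe, hfc', fourier_comp_smul hc, fourier_coe]
        simp [hc, hr]
      have h2 : (𝓕⁻ gc) (c • ξ) = r • (𝓕⁻ g) ξ := by
        rw [fourierInv_coe, hgc', fourierInv_comp_smul hc, fourierInv_coe]
        simp [hc, hr]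
      rw [h1, h2, smul_mul_smul_comm, smul_smul, smul_smul]
      field_simp
      simp
    have e2 := Measure.integral_comp_smul (μ := (volume : Measure V))
      (fun ξ => m ξ * ((𝓕 fc) ξ * (𝓕⁻ gc) ξ)) c
    calc _ = ∫ ξ, (r⁻¹ : ℝ) • ((r⁻¹ : ℝ) •
          (m (c • ξ) * ((𝓕 fc) (c • ξ) * (𝓕⁻ gc) (c • ξ)))) := by
          refine integral_congr_ae (Eventually.of_forall fun ξ => ?_)
          simp only [e1, mul_smul_comm]
      _ = _ := by
          rw [integral_smul, integral_smul, e2, ← hr, smul_smul r⁻¹ r, inv_mul_cancel₀ hr0.ne',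
            one_smul]
  have e3 := h fc gc
  rw [hfc', hgc', eLpNorm_comp_smul hc f.continuous, eLpNorm_comp_smul hc g.continuous, ← hr] at e3
  rw [key, enorm_smul]
  have e4 : ENNReal.ofReal r ^ (p⁻¹).toReal * ENNReal.ofReal r ^ (q⁻¹).toReal =
      ENNReal.ofReal r := by
    rw [← ENNReal.rpow_add_of_nonneg _ _ ENNReal.toReal_nonneg ENNReal.toReal_nonneg,
      ← ENNReal.toReal_add, ENNReal.HolderConjugate.inv_add_inv_eq_one p q]
    · simp
    · simpa using ENNReal.HolderConjugate.ne_zero p q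
    · simpa using ENNReal.HolderConjugate.ne_zero q p
  calc _ ≤ ‖(r⁻¹ : ℝ)‖ₑ * (A * (ENNReal.ofReal r ^ (p⁻¹).toReal * eLpNorm f p volume *
        (ENNReal.ofReal r ^ (q⁻¹).toReal * eLpNorm g q volume))) := by gcongr
    _ = ‖(r⁻¹ : ℝ)‖ₑ * (ENNReal.ofReal r ^ (p⁻¹).toReal * ENNReal.ofReal r ^ (q⁻¹).toReal) *
        (A * (eLpNorm f p volume * eLpNorm g q volume)) := by ring
    _ = _ := by
        rw [e4, Real.enorm_of_nonneg (by positivity), ← ENNReal.ofReal_mul (by positivity),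
          inv_mul_cancel₀ hr0.ne', ENNReal.ofReal_one, one_mul]

theorem fourier_comp_sub (f : V → ℂ) (a ξ : V) :
    𝓕 (fun x => f (x - a)) ξ = Real.fourierChar (-inner ℝ a ξ) • 𝓕 f ξ := by
  have := congrFun (VectorFourier.fourierIntegral_comp_add_right Real.fourierChar
    (volume : Measure V) (innerₗ V) f (-a)) ξ
  simpa [Function.comp_def, sub_eq_add_neg] using! this

theorem norm_fourier_comp_sub (f : V → ℂ) (a ξ : V) :
    ‖𝓕 (fun x => f (x - a)) ξ‖ = ‖𝓕 f ξ‖ := by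
  rw [fourier_comp_sub, Circle.norm_smul]

theorem norm_fourierInv_comp_sub (f : V → ℂ) (a x : V) :
    ‖𝓕⁻ (fun ξ => f (ξ - a)) x‖ = ‖𝓕⁻ f x‖ := by
  rw [Real.fourierInv_eq_fourier_neg, norm_fourier_comp_sub, Real.fourierInv_eq_fourier_neg]

/-- Translating the symbol amounts to modulating `f` and `g`, which leaves `|f|` and `|g|`
unchanged. -/
theorem PairingBound.comp_add {p q A : ℝ≥0∞} {m : V → ℂ}
    (h : PairingBound p q A m) (a : V) :
    PairingBound p q A (fun ξ => m (ξ + a)) := by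
  intro f g
  set F : 𝓢(V, ℂ) := compSubConstCLM ℂ a (𝓕 f) with hF
  set G : 𝓢(V, ℂ) := compSubConstCLM ℂ a (𝓕⁻ g) with hG
  have e := h (𝓕⁻ F) (𝓕 G)
  rw [fourier_fourierInv_eq, fourierInv_fourier_eq] at e
  have e1 : eLpNorm (𝓕⁻ F : 𝓢(V, ℂ)) p volume = eLpNorm f p volume := by
    refine eLpNorm_congr_norm_ae (Eventually.of_forall fun x => ?_)
    have : (F : V → ℂ) = fun x => (𝓕 f) (x - a) := by ext x; simp [hF]
    rw [fourierInv_coe, this, norm_fourierInv_comp_sub, ← fourierInv_coe, fourierInv_fourier_eq]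
  have e2 : eLpNorm (𝓕 G : 𝓢(V, ℂ)) q volume = eLpNorm g q volume := by
    refine eLpNorm_congr_norm_ae (Eventually.of_forall fun x => ?_)
    have : (G : V → ℂ) = fun x => (𝓕⁻ g) (x - a) := by ext x; simp [hG]
    rw [fourier_coe, this, norm_fourier_comp_sub, ← fourier_coe, fourier_fourierInv_eq]
  rw [e1, e2] at e
  convert e using 2
  rw [← integral_sub_right_eq_self _ a]
  simp [hF, hG]

/-- The adjoint relation between a Fourier multiplier and the pairing of its symbol. -/
theorem integral_fourierInv_mul_schwartz {F : V → ℂ} (hF : Integrable F) (g : 𝓢(V, ℂ)) :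
    ∫ x, 𝓕⁻ F x * g x = ∫ ξ, F ξ * (𝓕⁻ g) ξ := by
  have h := VectorFourier.integral_fourierIntegral_smul_eq_flip (μ := (volume : Measure V))
    (ν := (volume : Measure V)) (L := -innerₗ V) (f := F) (g := g) Real.continuous_fourierChar
    (by simp only [LinearMap.neg_apply, innerₗ_apply_apply]; fun_prop) hF g.integrable
  have e : (-innerₗ V).flip = -innerₗ V := by
    ext x y
    simp [real_inner_comm]
  rw [e] at h
  simp only [smul_eq_mul] at h
  rw [fourierInv_coe]
  exact h

theorem eLpNorm_schwartz_lt_top (f : 𝓢(V, ℂ)) (p : ℝ≥0∞) : eLpNorm f p volume < ∞ :=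
  (f.memLp p volume).2

end Pairing

/-- The infimum defining the norm is itself an admissible constant. -/
theorem eLpNorm_fourierMultiplier_le {d : ℕ} {p : ℝ≥0∞} {m : EuclideanSpace ℝ (Fin d) → ℂ}
    (hm : multiplierNorm p m < ∞) (f : 𝓢(EuclideanSpace ℝ (Fin d), ℂ)) :
    eLpNorm (fourierMultiplier m f) p volume ≤ multiplierNorm p m * eLpNorm f p volume := by
  have hf : eLpNorm (f : EuclideanSpace ℝ (Fin d) → ℂ) p volume < ∞ :=
    eLpNorm_schwartz_lt_top f p
  refine ENNReal.le_mul_of_forall_lt (Or.inr hf.ne) (Or.inl hm.ne) ?_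
  intro a ha b hb
  obtain ⟨a', ha', h⟩ := sInf_lt_iff.1 ha
  calc _ ≤ a' * eLpNorm f p volume := ha' f
    _ ≤ a * b := by gcongr

/-- Hölder after moving the inverse Fourier transform onto `g`. From here on the operator is
replaced by a form in which `f` and `g` play similar roles. -/
theorem pairingBound_multiplierNorm {d : ℕ} {p q : ℝ≥0∞} [p.HolderConjugate q]
    {m : EuclideanSpace ℝ (Fin d) → ℂ} (hm : IsLpBoundedMultiplier p m) :
    PairingBound p q (multiplierNorm p m) m := by
  intro f g
  have hint := hm.1 f
  have e := integral_fourierInv_mul_schwartz hint g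
  have e' : ∫ ξ, m ξ * ((𝓕 f) ξ * (𝓕⁻ g) ξ) = ∫ x, fourierMultiplier m f x * g x := by
    rw [fourierMultiplier, e]
    refine integral_congr_ae (Filter.Eventually.of_forall fun ξ => ?_)
    simp only [fourier_coe]
    ring
  have hc : Continuous (fourierMultiplier m f) := by
    exact VectorFourier.fourierIntegral_continuous Real.continuous_fourierChar
      (by simp only [LinearMap.neg_apply, innerₗ_apply_apply]; fun_prop) hint
  rw [e']
  calc _ ≤ ∫⁻ x, ‖fourierMultiplier m f x * g x‖ₑ := enorm_integral_le_lintegral_enorm _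
    _ = eLpNorm (fun x => fourierMultiplier m f x * g x) 1 volume :=
      eLpNorm_one_eq_lintegral_enorm.symm
    _ ≤ eLpNorm (fourierMultiplier m f) p volume * eLpNorm g q volume := by
      simpa using! eLpNorm_smul_le_mul_eLpNorm (p := p) (q := q) (r := 1)
        (f := g) (φ := fourierMultiplier m f) (μ := volume)
        g.continuous.aestronglyMeasurable hc.aestronglyMeasurable
    _ ≤ multiplierNorm p m * eLpNorm f p volume * eLpNorm g q volume := by
      gcongr
      exact eLpNorm_fourierMultiplier_le hm.2 f
    _ = _ := by ring

/-! ### An `L_p`-bounded multiplier has a bounded symbol. -/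

section SupBound

open Filter Topology

/-- The standard bump function with radii `ε` and `2ε`. -/
noncomputable def scaledBump (V : Type*) [NormedAddCommGroup V] (ε : ℝ) (hε : 0 < ε) :
    ContDiffBump (0 : V) where
  rIn := ε
  rOut := 2 * ε
  rIn_pos := hε
  rIn_lt_rOut := by linarith

theorem scaledBump_apply {V : Type*} [NormedAddCommGroup V] [InnerProductSpace ℝ V]
    [FiniteDimensional ℝ V] {ε : ℝ} (hε : 0 < ε) (x : V) :
    scaledBump V ε hε (ε • x) = scaledBump V 1 one_pos x := by
  rw [ContDiffBump.apply, ContDiffBump.apply]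
  simp only [scaledBump]
  congr 1
  · field_simp
  · simp [smul_smul, hε.ne']

variable {V : Type*} [NormedAddCommGroup V] [InnerProductSpace ℝ V] [FiniteDimensional ℝ V]
  [MeasurableSpace V] [BorelSpace V]

/-- Interpolation through `|f|^p ≤ M^(p-1) |f|`. The bound does not involve `p`, so that the final
constants depend on `d` only. -/
theorem eLpNorm_le_of_norm_le_of_lintegral_le {f : V → ℂ} {M : ℝ≥0}
    (hf : ∀ x, ‖f x‖ₑ ≤ M) (hf' : ∫⁻ x, ‖f x‖ₑ ≤ M) {p : ℝ≥0∞} (hp : 1 ≤ p) :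
    eLpNorm f p volume ≤ M := by
  have hp0 : p ≠ 0 := (zero_lt_one.trans_le hp).ne'
  by_cases hpt : p = ∞
  · subst hpt
    rw [eLpNorm_exponent_top]
    exact eLpNormEssSup_le_of_ae_enorm_bound (Eventually.of_forall hf)
  · have hp1 : 1 ≤ p.toReal := by
      rw [← ENNReal.toReal_one]
      exact ENNReal.toReal_mono hpt hp
    rw [eLpNorm_eq_lintegral_rpow_enorm_toReal hp0 hpt]
    have h1 : ∫⁻ x, ‖f x‖ₑ ^ p.toReal ≤ (M : ℝ≥0∞) ^ p.toReal := by
      calc _ ≤ ∫⁻ x, (M : ℝ≥0∞) ^ (p.toReal - 1) * ‖f x‖ₑ := by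
            refine lintegral_mono fun x => ?_
            have : ‖f x‖ₑ ^ p.toReal = ‖f x‖ₑ ^ (p.toReal - 1) * ‖f x‖ₑ := by
              conv_rhs => rw [← ENNReal.rpow_one ‖f x‖ₑ]
              rw [← ENNReal.rpow_mul, one_mul, ← ENNReal.rpow_add_of_nonneg _ _ (by linarith)
                zero_le_one]
              congr 1
              ring
            rw [this]
            gcongr
            exact hf x
        _ ≤ (M : ℝ≥0∞) ^ (p.toReal - 1) * M := by
            rw [lintegral_const_mul' _ _ (by
              exact ENNReal.rpow_ne_top_of_nonneg (by linarith) ENNReal.coe_ne_top)]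
            gcongr
        _ = (M : ℝ≥0∞) ^ p.toReal := by
            conv_lhs => rw [← ENNReal.rpow_one (M : ℝ≥0∞)]
            rw [← ENNReal.rpow_mul, one_mul, ← ENNReal.rpow_add_of_nonneg _ _ (by linarith)
              zero_le_one]
            congr 1
            ring
    calc _ ≤ ((M : ℝ≥0∞) ^ p.toReal) ^ (1 / p.toReal) := by gcongr
      _ = M := by
        rw [← ENNReal.rpow_mul, mul_one_div_cancel (by linarith), ENNReal.rpow_one]

theorem exists_forall_eLpNorm_le (f : 𝓢(V, ℂ)) :
    ∃ M : ℝ≥0, ∀ p : ℝ≥0∞, 1 ≤ p → eLpNorm f p volume ≤ M := by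
  have h1 := f.integrable (μ := (volume : Measure V))
  refine ⟨max (SchwartzMap.seminorm ℝ 0 0 f).toNNReal (∫⁻ x, ‖f x‖ₑ).toNNReal,
    fun p hp => eLpNorm_le_of_norm_le_of_lintegral_le (fun x => ?_) ?_ hp⟩
  · have := f.norm_le_seminorm ℝ x
    rw [enorm_le_coe]
    refine le_trans ?_ (le_max_left _ _)
    rw [← NNReal.coe_le_coe, Real.coe_toNNReal _ (apply_nonneg _ _)]
    exact this
  · rw [← ENNReal.coe_toNNReal h1.2.ne]
    exact_mod_cast le_max_right _ _

theorem scaledBump_normed_apply {ε : ℝ} (hε : 0 < ε) (x : V) :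
    ε ^ Module.finrank ℝ V * (scaledBump V ε hε).normed volume (ε • x) =
      (scaledBump V 1 one_pos).normed volume x := by
  have h := Measure.integral_comp_smul (μ := (volume : Measure V)) (scaledBump V ε hε) ε
  simp only [scaledBump_apply hε] at h
  rw [ContDiffBump.normed_def, ContDiffBump.normed_def, scaledBump_apply, h,
    abs_of_pos (by positivity), smul_eq_mul]
  have := (scaledBump V ε hε).integral_pos (μ := volume)
  field_simp

/-- The symbol of an `L_p`-bounded Fourier multiplier is bounded. -/
theorem exists_ae_enorm_le_of_pairingBound (V : Type*) [NormedAddCommGroup V]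
    [InnerProductSpace ℝ V] [FiniteDimensional ℝ V] [MeasurableSpace V] [BorelSpace V] :
    ∃ C : ℝ≥0, ∀ (p q A : ℝ≥0∞), p.HolderConjugate q → ∀ m : V → ℂ, LocallyIntegrable m →
      PairingBound p q A m → ∀ᵐ ξ, ‖m ξ‖ₑ ≤ C * A := by
  let b0 : ContDiffBump (0 : V) := scaledBump V 1 one_pos
  let b1 : ContDiffBump (0 : V) := scaledBump V 2 two_pos
  have c0 : HasCompactSupport (fun x => ((b0.normed volume x : ℝ) : ℂ)) :=
    b0.hasCompactSupport_normed.comp_left (g := Complex.ofReal) rfl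
  have d0 : ContDiff ℝ ((⊤ : ℕ∞) : WithTop ℕ∞) (fun x => ((b0.normed volume x : ℝ) : ℂ)) :=
    Complex.ofRealCLM.contDiff.comp b0.contDiff_normed
  have c1 : HasCompactSupport (fun x => ((b1 x : ℝ) : ℂ)) :=
    b1.hasCompactSupport.comp_left (g := Complex.ofReal) rfl
  have d1 : ContDiff ℝ ((⊤ : ℕ∞) : WithTop ℕ∞) (fun x => ((b1 x : ℝ) : ℂ)) :=
    Complex.ofRealCLM.contDiff.comp b1.contDiff
  let G : 𝓢(V, ℂ) := c0.toSchwartzMap d0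
  let F : 𝓢(V, ℂ) := c1.toSchwartzMap d1
  have hG : ∀ x, G x = (b0.normed volume x : ℝ) := fun x => rfl
  have hF : ∀ x, F x = (b1 x : ℝ) := fun x => rfl
  -- The bump `b1` equals `1` on the ball of radius 2, which contains the support of `b0`.
  have hFG : ∀ x, F x * G x = (b0.normed volume x : ℝ) := by
    intro x
    rw [hF, hG]
    by_cases hx : x ∈ Metric.ball (0 : V) 2
    · rw [b1.one_of_mem_closedBall (Metric.ball_subset_closedBall hx)]
      simp
    · have : b0.normed volume x = 0 := by
        by_contra hne
        have : x ∈ Function.support (b0.normed volume) := hne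
        rw [b0.support_normed_eq] at this
        simp [b0, scaledBump] at this hx
        linarith
      simp [this]
  obtain ⟨M, hM⟩ := exists_forall_eLpNorm_le (𝓕⁻ F : 𝓢(V, ℂ))
  obtain ⟨N, hN⟩ := exists_forall_eLpNorm_le (𝓕 G : 𝓢(V, ℂ))
  refine ⟨M * N, fun p q A hpq m hm h => ?_⟩
  have bound : ∀ ε (hε : 0 < ε) (a : V),
      ‖(convolution ((scaledBump V ε hε).normed volume) m (ContinuousLinearMap.lsmul ℝ ℝ)
        volume) a‖ₑ ≤ (M * N : ℝ≥0) * A := by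
    -- Translation and dilation invariance turn the pairing with the fixed pair `𝓕⁻ F`, `𝓕 G` into
    -- the mollification of `m` at `a` at scale `ε`, with a bound independent of `ε` and `a`.
    -- Lebesgue differentiation then concludes.
    intro ε hε a
    have h2 := ((h.comp_add a).comp_smul (neg_ne_zero.2 hε.ne')) (𝓕⁻ F) (𝓕 G)
    rw [fourier_fourierInv_eq, fourierInv_fourier_eq] at h2
    have e : ∫ ξ, m (-ε • ξ + a) * (F ξ * G ξ) =
        (convolution ((scaledBump V ε hε).normed volume) m (ContinuousLinearMap.lsmul ℝ ℝ)
        volume) a := by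
      have h3 := Measure.integral_comp_smul (μ := (volume : Measure V))
        (fun t => (scaledBump V ε hε).normed volume t • m (a - t)) ε
      rw [abs_of_pos (by positivity)] at h3
      have h4 : (convolution ((scaledBump V ε hε).normed volume) m
          (ContinuousLinearMap.lsmul ℝ ℝ) volume) a = ε ^ Module.finrank ℝ V •
          ∫ x, (scaledBump V ε hε).normed volume (ε • x) • m (a - ε • x) := by
        rw [h3, smul_smul, mul_inv_cancel₀ (by positivity), one_smul]
        rfl
      rw [h4, ← integral_smul]
      refine integral_congr_ae (Eventually.of_forall fun x => ?_)
      simp only [hFG]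
      rw [smul_smul, scaledBump_normed_apply hε, Complex.real_smul, mul_comm]
      congr 2
      simp [sub_eq_neg_add]
    rw [e] at h2
    refine h2.trans ?_
    have h5 := hM p (ENNReal.HolderConjugate.one_le p q)
    have h6 := hN q (ENNReal.HolderConjugate.one_le q p)
    calc _ ≤ A * (M * N) := by gcongr
      _ = _ := by push_cast; ring
  have hlim := ContDiffBump.ae_convolution_tendsto_right_of_locallyIntegrable
    (φ := fun n : ℕ => scaledBump V (1 / ((n : ℝ) + 1)) (by positivity)) (l := atTop) (K := 2)
    (by simpa [scaledBump] using
      (tendsto_one_div_add_atTop_nhds_zero_nat (𝕜 := ℝ)).const_mul 2)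
    (Eventually.of_forall fun n => le_rfl) hm
  filter_upwards [hlim] with ξ hξ
  exact le_of_tendsto ((continuous_enorm.tendsto _).comp hξ)
    (Eventually.of_forall fun n => bound _ _ _)

end SupBound

/-! ### Orthogonality of random signs. -/

section Signs

variable {N : ℕ}

/-- The sign attached to a boolean. -/
def boolSign (b : Bool) : ℂ := if b then 1 else -1

theorem boolSign_mul_self (b : Bool) : boolSign b * boolSign b = 1 := by
  cases b <;> simp [boolSign]

theorem boolSign_not (b : Bool) : boolSign (!b) = -boolSign b := by
  cases b <;> simp [boolSign]

theorem star_boolSign (b : Bool) : (starRingEnd ℂ) (boolSign b) = boolSign b := by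
  cases b <;> simp [boolSign]

theorem norm_boolSign (b : Bool) : ‖boolSign b‖ = 1 := by
  cases b <;> simp [boolSign]

/-- For `i ≠ j`, flipping the sign of index `i` pairs the terms into opposite ones. -/
theorem sum_boolSign_mul (i j : Fin N) :
    ∑ s : Fin N → Bool, boolSign (s i) * boolSign (s j) = if i = j then 2 ^ N else 0 := by
  split_ifs with h
  · subst h
    simp [boolSign_mul_self]
  · refine Finset.sum_involution (fun s _ => Function.update s i (!(s i))) ?_ ?_ ?_ ?_
    · intro s _
      rw [Function.update_self, Function.update_of_ne (Ne.symm h), boolSign_not]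
      ring
    · intro s _ _ hs
      have := congrFun hs i
      simp at this
    · simp
    · intro s _
      simp

theorem sum_sum_boolSign_mul (b : Fin N → Fin N → ℂ) :
    ∑ s : Fin N → Bool, ∑ i, ∑ j, boolSign (s i) * boolSign (s j) * b i j =
      2 ^ N * ∑ i, b i i := by
  rw [Finset.sum_comm, Finset.mul_sum]
  refine Finset.sum_congr rfl fun i _ => ?_
  rw [Finset.sum_comm]
  simp_rw [← Finset.sum_mul, sum_boolSign_mul]
  simp

theorem sum_norm_sq_boolSign (a : Fin N → ℂ) :
    ∑ s : Fin N → Bool, ‖∑ i, boolSign (s i) * a i‖ ^ 2 = 2 ^ N * ∑ i, ‖a i‖ ^ 2 := by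
  have h := sum_sum_boolSign_mul (fun i j => a i * (starRingEnd ℂ) (a j))
  apply Complex.ofReal_injective
  push_cast
  simp_rw [← Complex.mul_conj']
  rw [← h]
  refine Finset.sum_congr rfl fun s _ => ?_
  rw [map_sum, Finset.sum_mul_sum]
  refine Finset.sum_congr rfl fun i _ => Finset.sum_congr rfl fun j _ => ?_
  rw [map_mul, star_boolSign]
  ring

end Signs

/-! ### Randomized test functions on overlapping and on disjoint sets. -/

section Randomization

open Filter Topology

variable {V : Type*} [NormedAddCommGroup V] [InnerProductSpace ℝ V] [FiniteDimensional ℝ V]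
  [MeasurableSpace V] [BorelSpace V]

/-- Orthogonality of signs is applied at each point `x`, so the sets `R j` may overlap freely. -/
theorem sum_eLpNorm_two_sq_le {N : ℕ} (f : Fin N → 𝓢(V, ℂ)) (R : Fin N → Set V) {v : ℝ≥0∞}
    (hf1 : ∀ j x, ‖f j x‖ ≤ 1) (hf : ∀ j, Function.support (f j) ⊆ R j)
    (hR : ∀ j, MeasurableSet (R j)) (hv : ∀ j, volume (R j) ≤ v) :
    ∑ s : Fin N → Bool, eLpNorm (∑ j, boolSign (s j) • f j : 𝓢(V, ℂ)) 2 volume ^ 2 ≤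
      2 ^ N * (N * v) := by
  have e : ∀ s : Fin N → Bool,
      eLpNorm (∑ j, boolSign (s j) • f j : 𝓢(V, ℂ)) 2 volume ^ 2 =
        ∫⁻ x, ENNReal.ofReal (‖∑ j, boolSign (s j) * f j x‖ ^ 2) := by
    intro s
    rw [eLpNorm_eq_lintegral_rpow_enorm_toReal (by simp) (by simp), ← ENNReal.rpow_natCast,
      ← ENNReal.rpow_mul]
    simp only [ENNReal.toReal_ofNat, Nat.cast_ofNat, one_div, ne_eq, OfNat.ofNat_ne_zero,
      not_false_eq_true, inv_mul_cancel₀, ENNReal.rpow_one, ENNReal.rpow_ofNat]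
    refine lintegral_congr fun x => ?_
    rw [sum_apply, ENNReal.ofReal_pow (norm_nonneg _), ofReal_norm]
    simp
  simp_rw [e]
  rw [← lintegral_finsetSum]
  · have e2 : ∀ x, ∑ s : Fin N → Bool, ENNReal.ofReal (‖∑ j, boolSign (s j) * f j x‖ ^ 2) ≤
        2 ^ N * ∑ j, (R j).indicator 1 x := by
      intro x
      rw [← ENNReal.ofReal_sum_of_nonneg (fun _ _ => by positivity),
        sum_norm_sq_boolSign (fun j => f j x), ENNReal.ofReal_mul (by positivity),
        ENNReal.ofReal_sum_of_nonneg (fun _ _ => by positivity)]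
      gcongr with j
      · rw [ENNReal.ofReal_pow (by simp)]
        simp
      · by_cases hx : x ∈ R j
        · simp only [hx, indicator_of_mem, Pi.one_apply]
          rw [← ENNReal.ofReal_one]
          exact ENNReal.ofReal_le_ofReal (pow_le_one₀ (norm_nonneg _) (hf1 j x))
        · have : f j x = 0 := by
            by_contra h0
            exact hx (hf j h0)
          simp [this]
    calc _ ≤ ∫⁻ x, 2 ^ N * ∑ j, (R j).indicator 1 x := lintegral_mono e2
      _ = 2 ^ N * ∑ j, volume (R j) := by
        rw [lintegral_const_mul' _ _ (by simp), lintegral_finsetSum]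
        · simp [hR]
        · intro j _
          exact measurable_one.indicator (hR j)
      _ ≤ 2 ^ N * ∑ j : Fin N, v := by
        gcongr with j
        exact hv j
      _ = _ := by simp
  · intro s _
    have : Continuous fun x => ∑ j, boolSign (s j) * f j x :=
      continuous_finsetSum _ fun j _ => continuous_const.mul (f j).continuous
    exact (this.norm.pow 2).measurable.ennreal_ofReal

/-- At each point at most one summand is nonzero, so the sum has modulus at most `1` for every
choice of signs. When `q = ∞` the exponent is `0⁻¹ = 0`, as it should be. -/
theorem eLpNorm_sum_disjoint_le {N : ℕ} (g : Fin N → 𝓢(V, ℂ)) (R : Fin N → Set V) {v : ℝ≥0∞}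
    (hg1 : ∀ j x, ‖g j x‖ ≤ 1) (hg : ∀ j, Function.support (g j) ⊆ R j)
    (hd : Pairwise fun i j => Disjoint (R i) (R j)) (hv : ∀ j, volume (R j) ≤ v)
    (s : Fin N → Bool) (q : ℝ≥0∞) :
    eLpNorm (∑ j, boolSign (s j) • g j : 𝓢(V, ℂ)) q volume ≤ (N * v) ^ q.toReal⁻¹ := by
  have happ : ∀ x, (∑ j, boolSign (s j) • g j : 𝓢(V, ℂ)) x = ∑ j, boolSign (s j) * g j x := by
    intro x
    rw [sum_apply]
    simp
  have hz : ∀ j x, x ∉ R j → g j x = 0 := fun j x hx => by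
    by_contra h0
    exact hx (hg j h0)
  rw [← eLpNorm_restrict_eq_of_support_subset (s := ⋃ j, R j)]
  · refine (eLpNorm_le_of_ae_bound (C := 1) (Eventually.of_forall fun x => ?_)).trans ?_
    · rw [happ]
      by_cases hx : ∃ i, x ∈ R i
      · obtain ⟨i, hi⟩ := hx
        rw [Finset.sum_eq_single i]
        · rw [norm_mul, norm_boolSign, one_mul]
          exact hg1 i x
        · intro j _ hj
          rw [hz j x (fun h => (hd hj).le_bot ⟨h, hi⟩), mul_zero]
        · simp
      · push Not at hx
        rw [Finset.sum_eq_zero]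
        · simp
        · intro j _
          rw [hz j x (hx j), mul_zero]
    · rw [ENNReal.ofReal_one, mul_one, Measure.restrict_apply_univ]
      refine ENNReal.rpow_le_rpow ?_ (by positivity)
      calc _ ≤ ∑ j, volume (R j) := measure_iUnion_fintype_le _ _
        _ ≤ ∑ j : Fin N, v := by
          gcongr with j
          exact hv j
        _ = _ := by simp
  · intro x hx
    by_contra hn
    rw [mem_iUnion] at hn
    push Not at hn
    apply hx
    rw [happ]
    exact Finset.sum_eq_zero fun j _ => by rw [hz j x (hn j), mul_zero]

/-- A bilinear form which is bounded on `L_p × L_q` with `p ≤ 2` has a small diagonal on families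
`f`, `g` adapted to a family of sets with small union, respectively disjoint. -/
theorem enorm_diagonal_le {N : ℕ} {p q A : ℝ≥0∞} (hp2 : p ≤ 2)
    (B : 𝓢(V, ℂ) →ₗ[ℂ] 𝓢(V, ℂ) →ₗ[ℂ] ℂ)
    (hB : ∀ f g, ‖B f g‖ₑ ≤ A * (eLpNorm f p volume * eLpNorm g q volume))
    (f g : Fin N → 𝓢(V, ℂ)) (R R' : Fin N → Set V) {v : ℝ≥0∞}
    (hf1 : ∀ j x, ‖f j x‖ ≤ 1) (hf : ∀ j, Function.support (f j) ⊆ R j)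
    (hg1 : ∀ j x, ‖g j x‖ ≤ 1) (hg : ∀ j, Function.support (g j) ⊆ R' j)
    (hd : Pairwise fun i j => Disjoint (R' i) (R' j)) (hR : ∀ j, MeasurableSet (R j))
    (hv : ∀ j, volume (R j) ≤ v) (hv' : ∀ j, volume (R' j) ≤ v) (α : ℂ)
    (hα : ∀ j, B (f j) (g j) = α) :
    N * ‖α‖ₑ ≤ A * (volume (⋃ j, R j) ^ (1 / p.toReal - 1 / 2) * (N * v) ^ (1 / 2 : ℝ) *
      (N * v) ^ q.toReal⁻¹) := by
  set F : (Fin N → Bool) → 𝓢(V, ℂ) := fun s => ∑ j, boolSign (s j) • f j with hF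
  set G : (Fin N → Bool) → 𝓢(V, ℂ) := fun s => ∑ j, boolSign (s j) • g j with hG
  -- Summing over all signs kills the off-diagonal terms.
  have h1 : ∑ s, B (F s) (G s) = 2 ^ N * (N * α) := by
    have := sum_sum_boolSign_mul (fun i j => B (f i) (g j))
    simp only [hα, Finset.sum_const, Finset.card_univ, Fintype.card_fin, nsmul_eq_mul] at this
    rw [← this]
    refine Finset.sum_congr rfl fun s _ => ?_
    simp only [hF, hG, map_sum, LinearMap.sum_apply, map_smul, LinearMap.smul_apply, smul_eq_mul,
      Finset.mul_sum]
    rw [Finset.sum_comm]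
    refine Finset.sum_congr rfl fun i _ => Finset.sum_congr rfl fun j _ => ?_
    ring
  -- Hölder from `L_2` to `L_p` on the union of the `R j`: here the small measure of the union is
  -- used.
  have h2 : ∀ s, eLpNorm (F s) p volume ≤
      eLpNorm (F s) 2 volume * volume (⋃ j, R j) ^ (1 / p.toReal - 1 / 2) := by
    intro s
    have hsupp : Function.support (F s) ⊆ ⋃ j, R j := by
      intro x hx
      by_contra hn
      rw [mem_iUnion] at hn
      push Not at hn
      apply hx
      simp only [hF]
      rw [sum_apply]
      refine Finset.sum_eq_zero fun j _ => ?_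
      have : f j x = 0 := by
        by_contra h0
        exact hn j (hf j h0)
      simp [this]
    have := eLpNorm_le_eLpNorm_mul_rpow_measure_univ (μ := volume.restrict (⋃ j, R j)) hp2
      (F s).continuous.aestronglyMeasurable
    rw [eLpNorm_restrict_eq_of_support_subset hsupp,
      eLpNorm_restrict_eq_of_support_subset hsupp] at this
    simpa using this
  -- Cauchy–Schwarz over the `2 ^ N` choices of signs.
  have h3 : ∑ s, eLpNorm (F s) 2 volume ≤ 2 ^ N * (N * v) ^ (1 / 2 : ℝ) := by
    have := ENNReal.rpow_sum_le_const_mul_sum_rpow (Finset.univ : Finset (Fin N → Bool))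
      (fun s => eLpNorm (F s) 2 volume) (p := 2) (by norm_num)
    have h4 := sum_eLpNorm_two_sq_le f R hf1 hf hR hv
    have h5 : (∑ s, eLpNorm (F s) 2 volume) ^ (2 : ℝ) ≤ 2 ^ N * (2 ^ N * (N * v)) := by
      refine this.trans ?_
      norm_num
      gcongr
    calc _ = ((∑ s, eLpNorm (F s) 2 volume) ^ (2 : ℝ)) ^ (1 / 2 : ℝ) := by
          rw [← ENNReal.rpow_mul]; norm_num
      _ ≤ (2 ^ N * (2 ^ N * (N * v))) ^ (1 / 2 : ℝ) := by gcongr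
      _ = _ := by
          rw [← mul_assoc, ENNReal.mul_rpow_of_nonneg _ _ (by norm_num), ← pow_two,
            ← ENNReal.rpow_natCast _ 2, ← ENNReal.rpow_mul]
          norm_num
  have h6 : (2 : ℝ≥0∞) ^ N * (N * ‖α‖ₑ) ≤ 2 ^ N * (A * (volume (⋃ j, R j) ^
      (1 / p.toReal - 1 / 2) * (N * v) ^ (1 / 2 : ℝ) * (N * v) ^ q.toReal⁻¹)) := by
    calc (2 : ℝ≥0∞) ^ N * (N * ‖α‖ₑ) = ‖∑ s, B (F s) (G s)‖ₑ := by
          rw [h1, enorm_mul, enorm_mul, enorm_pow]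
          congr 1
          · congr 1
            rw [← ofReal_norm]
            simp
          · congr 1
            rw [← ofReal_norm]
            simp
      _ ≤ ∑ s, ‖B (F s) (G s)‖ₑ := enorm_sum_le _ _
      _ ≤ ∑ s, A * (eLpNorm (F s) 2 volume * volume (⋃ j, R j) ^ (1 / p.toReal - 1 / 2) *
            (N * v) ^ q.toReal⁻¹) := by
          refine Finset.sum_le_sum fun s _ => (hB _ _).trans ?_
          gcongr
          · exact h2 s
          · exact eLpNorm_sum_disjoint_le g R' hg1 hg hd hv' s q
      _ = A * ((∑ s, eLpNorm (F s) 2 volume) * (volume (⋃ j, R j) ^ (1 / p.toReal - 1 / 2) *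
            (N * v) ^ q.toReal⁻¹)) := by
          rw [← Finset.mul_sum, Finset.sum_mul]
          simp only [mul_assoc]
      _ ≤ A * ((2 ^ N * (N * v) ^ (1 / 2 : ℝ)) * (volume (⋃ j, R j) ^ (1 / p.toReal - 1 / 2) *
            (N * v) ^ q.toReal⁻¹)) := by gcongr
      _ = _ := by ring
  exact (ENNReal.mul_le_mul_iff_right (by simp) (by simp)).1 h6

end Randomization

/-! ### Invariance of the form of a radial symbol under isometries. -/

section RadialPairing

open Filter Topology

variable {V : Type*} [NormedAddCommGroup V] [InnerProductSpace ℝ V]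

/-- The transport of a Schwartz function by an affine isometry. -/
noncomputable def transport (U : V ≃ᵃⁱ[ℝ] V) (f : 𝓢(V, ℂ)) : 𝓢(V, ℂ) :=
  compSubConstCLM ℂ (U 0)
    (compCLMOfContinuousLinearEquiv ℂ U.linearIsometryEquiv.symm.toContinuousLinearEquiv f)

theorem affineIsometryEquiv_apply (U : V ≃ᵃⁱ[ℝ] V) (x : V) :
    U x = U.linearIsometryEquiv x + U 0 := by
  have := U.map_vadd 0 x
  simpa using this

theorem transport_apply (U : V ≃ᵃⁱ[ℝ] V) (f : 𝓢(V, ℂ)) (x : V) :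
    transport U f x = f (U.linearIsometryEquiv.symm (x - U 0)) := by
  simp [transport]

theorem transport_apply_apply (U : V ≃ᵃⁱ[ℝ] V) (f : 𝓢(V, ℂ)) (x : V) :
    transport U f (U x) = f x := by
  rw [transport_apply, affineIsometryEquiv_apply U x]
  simp

variable [FiniteDimensional ℝ V] [MeasurableSpace V] [BorelSpace V]

theorem integrable_schwartz_mul (F G : 𝓢(V, ℂ)) : Integrable (fun ξ => F ξ * G ξ) := by
  have := (pairing (ContinuousLinearMap.mul ℂ ℂ) F G).integrable (μ := (volume : Measure V))
  simpa using! this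

theorem integrable_symbol_mul {m : V → ℂ} (hm : AEStronglyMeasurable m volume) {B : ℝ}
    (hB : ∀ ξ, ‖m ξ‖ ≤ B) (F G : 𝓢(V, ℂ)) : Integrable (fun ξ => m ξ * (F ξ * G ξ)) :=
  (integrable_schwartz_mul F G).bdd_mul hm (Eventually.of_forall hB)

/-- The bilinear form on Schwartz functions associated with a bounded symbol. -/
noncomputable def pairingForm (m : V → ℂ) (hm : AEStronglyMeasurable m volume) {B : ℝ}
    (hB : ∀ ξ, ‖m ξ‖ ≤ B) : 𝓢(V, ℂ) →ₗ[ℂ] 𝓢(V, ℂ) →ₗ[ℂ] ℂ :=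
  LinearMap.mk₂ ℂ (fun f g => ∫ ξ, m ξ * ((𝓕 f) ξ * (𝓕⁻ g) ξ))
    (fun f f' g => by
      rw [← integral_add (integrable_symbol_mul hm hB _ _) (integrable_symbol_mul hm hB _ _)]
      refine integral_congr_ae (Eventually.of_forall fun ξ => ?_)
      simp only [FourierTransform.fourier_add, add_apply]
      ring)
    (fun c f g => by
      rw [← integral_smul]
      refine integral_congr_ae (Eventually.of_forall fun ξ => ?_)
      simp only [FourierTransform.fourier_smul, smul_apply, smul_eq_mul]
      ring)
    (fun f g g' => by
      rw [← integral_add (integrable_symbol_mul hm hB _ _) (integrable_symbol_mul hm hB _ _)]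
      refine integral_congr_ae (Eventually.of_forall fun ξ => ?_)
      simp only [FourierTransform.fourierInv_add, add_apply]
      ring)
    (fun c f g => by
      rw [← integral_smul]
      refine integral_congr_ae (Eventually.of_forall fun ξ => ?_)
      simp only [FourierTransform.fourierInv_smul, smul_apply, smul_eq_mul]
      ring)

/-- This symmetry lets `f` and `g` exchange roles, which covers `p ≥ 2` and both orders of the
supports. -/
theorem integral_even_symbol {m : V → ℂ} (hm : ∀ ξ, m (-ξ) = m ξ) (f g : V → ℂ) :
    ∫ ξ, m ξ * (𝓕 f ξ * 𝓕⁻ g ξ) = ∫ ξ, m ξ * (𝓕 g ξ * 𝓕⁻ f ξ) := by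
  rw [← integral_neg_eq_self]
  refine integral_congr_ae (Eventually.of_forall fun ξ => ?_)
  simp only [hm, Real.fourierInv_eq_fourier_neg, neg_neg]
  ring

theorem fourier_transport (U : V ≃ᵃⁱ[ℝ] V) (f : 𝓢(V, ℂ)) (ξ : V) :
    𝓕 (transport U f : V → ℂ) ξ =
      Real.fourierChar (-inner ℝ (U 0) ξ) • 𝓕 (f : V → ℂ) (U.linearIsometryEquiv.symm ξ) := by
  rw [show (transport U f : V → ℂ) = fun x => (f ∘ U.linearIsometryEquiv.symm) (x - U 0) from
    funext fun x => transport_apply U f x, fourier_comp_sub, Real.fourier_comp_linearIsometry]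

/-- The translation parts give opposite phases in `𝓕` and `𝓕⁻`, which cancel; the linear part is
absorbed by the invariance of `m` and of Lebesgue measure. -/
theorem integral_transport {m : V → ℂ} (hm : ∀ (L : V ≃ₗᵢ[ℝ] V) ξ, m (L ξ) = m ξ)
    (U : V ≃ᵃⁱ[ℝ] V) (f g : 𝓢(V, ℂ)) :
    ∫ ξ, m ξ * ((𝓕 (transport U f)) ξ * (𝓕⁻ (transport U g)) ξ) =
      ∫ ξ, m ξ * ((𝓕 f) ξ * (𝓕⁻ g) ξ) := by
  have hL := U.linearIsometryEquiv.measurePreserving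
  rw [← hL.integral_comp U.linearIsometryEquiv.toHomeomorph.measurableEmbedding]
  refine integral_congr_ae (Eventually.of_forall fun ξ => ?_)
  simp only [hm, fourier_coe, fourierInv_coe, Real.fourierInv_eq_fourier_neg, fourier_transport]
  congr 1
  rw [smul_mul_smul_comm, ← AddChar.map_add_eq_mul]
  simp [inner_neg_right]

end RadialPairing

/-! ### Tubes and the bound by the Kakeya compression function. -/

section Tubes

open Filter Topology

variable {d : ℕ} [NeZero d]

theorem measurableSet_modelTube (a b δ : ℝ) : MeasurableSet (modelTube d a b δ) := by
  have h1 : IsClosed {x : EuclideanSpace ℝ (Fin d) | x 0 ∈ Icc a b} :=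
    isClosed_Icc.preimage (by fun_prop : Continuous fun x : EuclideanSpace ℝ (Fin d) => x 0)
  have h2 : IsOpen {x : EuclideanSpace ℝ (Fin d) |
      √(∑ i ∈ Finset.univ.erase 0, (x i) ^ 2) < δ} :=
    isOpen_lt (by fun_prop) continuous_const
  exact h1.measurableSet.inter h2.measurableSet

theorem volume_affineIsometryEquiv_image {V : Type*} [NormedAddCommGroup V]
    [InnerProductSpace ℝ V] [FiniteDimensional ℝ V] [MeasurableSpace V] [BorelSpace V]
    (U : V ≃ᵃⁱ[ℝ] V) (s : Set V) : volume (U '' s) = volume s := by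
  have e : (U : V → V) = (fun x => x + U 0) ∘ U.linearIsometryEquiv :=
    funext fun x => affineIsometryEquiv_apply U x
  rw [e, image_comp, image_add_right, measure_preimage_add_right,
    U.linearIsometryEquiv.image_eq_preimage_symm,
    U.linearIsometryEquiv.symm.measurePreserving.measure_preimage_emb
      U.linearIsometryEquiv.symm.toHomeomorph.measurableEmbedding]

theorem measurableSet_tube (δ : ℝ)
    (U : EuclideanSpace ℝ (Fin d) ≃ᵃⁱ[ℝ] EuclideanSpace ℝ (Fin d)) :
    MeasurableSet (tube δ U) :=
  U.toHomeomorph.measurableEmbedding.measurableSet_image.2 (measurableSet_modelTube 0 1 δ)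

theorem volume_modelTube_shift (δ : ℝ) :
    volume (modelTube d 2 3 δ) = volume (modelTube d 0 1 δ) := by
  have : modelTube d 0 1 δ = (fun x => x + EuclideanSpace.single 0 2) ⁻¹' modelTube d 2 3 δ := by
    ext x
    simp only [modelTube, mem_ofPred_eq, mem_preimage, PiLp.add_apply, PiLp.single_apply,
      mem_Icc, if_true]
    have : ∑ i ∈ Finset.univ.erase (0 : Fin d), (x i + if i = 0 then 2 else 0) ^ 2 =
        ∑ i ∈ Finset.univ.erase (0 : Fin d), (x i) ^ 2 :=
      Finset.sum_congr rfl fun i hi => by rw [if_neg (Finset.ne_of_mem_erase hi), add_zero]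
    rw [this]
    refine and_congr_left fun _ => ⟨fun h => ⟨?_, ?_⟩, fun h => ⟨?_, ?_⟩⟩ <;> linarith [h.1, h.2]
  rw [this, measure_preimage_add_right]

theorem volume_modelTube_le {δ : ℝ} (hδ : 0 ≤ δ) :
    volume (modelTube d 0 1 δ) ≤ ENNReal.ofReal ((2 * δ) ^ (d - 1)) := by
  let J : Fin d → Set ℝ := fun i => if i = 0 then Icc 0 1 else Icc (-δ) δ
  have hsub : modelTube d 0 1 δ ⊆ (MeasurableEquiv.toLp 2 (Fin d → ℝ)).symm ⁻¹' (univ.pi J) := by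
    intro x hx
    rw [mem_preimage, mem_univ_pi]
    intro i
    by_cases hi : i = 0
    · subst hi
      simpa [J] using hx.1
    · simp only [J, if_neg hi, mem_Icc, ← abs_le]
      have h1 : x i ^ 2 ≤ ∑ i ∈ Finset.univ.erase 0, (x i) ^ 2 :=
        Finset.single_le_sum (f := fun i => x i ^ 2) (fun _ _ => sq_nonneg _)
          (Finset.mem_erase.2 ⟨hi, Finset.mem_univ i⟩)
      calc _ = √(x i ^ 2) := (Real.sqrt_sq_eq_abs _).symm
        _ ≤ √(∑ i ∈ Finset.univ.erase 0, (x i) ^ 2) := Real.sqrt_le_sqrt h1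
        _ ≤ δ := hx.2.le
  refine (measure_mono hsub).trans ?_
  rw [(EuclideanSpace.volume_preserving_symm_measurableEquiv_toLp (Fin d)).measure_preimage_equiv,
    volume_pi_pi]
  have : ∀ i, volume (J i) = if i = 0 then 1 else ENNReal.ofReal (2 * δ) := by
    intro i
    simp only [J]
    split_ifs
    · simp
    · rw [Real.volume_Icc]
      congr 1
      ring
  simp_rw [this]
  rw [Finset.prod_ite, Finset.prod_const_one, one_mul, Finset.prod_const, Finset.filter_ne',
    Finset.card_erase_of_mem (Finset.mem_univ _), ENNReal.ofReal_pow (by positivity)]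
  simp

theorem volume_modelTube_pos {δ : ℝ} (hδ : 0 < δ) : 0 < volume (modelTube d 0 1 δ) := by
  have h1 : IsOpen {x : EuclideanSpace ℝ (Fin d) | x 0 ∈ Ioo 0 1} :=
    isOpen_Ioo.preimage (by fun_prop : Continuous fun x : EuclideanSpace ℝ (Fin d) => x 0)
  have h2 : IsOpen {x : EuclideanSpace ℝ (Fin d) |
      √(∑ i ∈ Finset.univ.erase 0, (x i) ^ 2) < δ} :=
    isOpen_lt (by fun_prop) continuous_const
  refine ((h1.inter h2).measure_pos volume ⟨EuclideanSpace.single 0 (1 / 2), ?_, ?_⟩).trans_le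
    (measure_mono fun x hx => ⟨Ioo_subset_Icc_self hx.1, hx.2⟩)
  · simp only [mem_ofPred_eq, PiLp.single_apply, if_true]
    norm_num
  · have : ∑ i ∈ Finset.univ.erase (0 : Fin d),
        ((EuclideanSpace.single 0 (1 / 2 : ℝ) : EuclideanSpace ℝ (Fin d)) i) ^ 2 = 0 :=
      Finset.sum_eq_zero fun i hi => by
        simp [Finset.ne_of_mem_erase hi]
    simp only [mem_ofPred_eq, this, Real.sqrt_zero, hδ]

/-- The upper bound for the diagonal coefficient of a bilinear form in terms of the
compression ratio of one family of tubes. -/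
theorem norm_diagonal_le_ratio {N : ℕ} (hN : 0 < N) {p q : ℝ≥0∞} [hpq : p.HolderConjugate q]
    {A : ℝ≥0} (hp2 : p ≤ 2)
    (B : 𝓢(EuclideanSpace ℝ (Fin d), ℂ) →ₗ[ℂ] 𝓢(EuclideanSpace ℝ (Fin d), ℂ) →ₗ[ℂ] ℂ)
    (hB : ∀ f g, ‖B f g‖ₑ ≤ A * (eLpNorm f p volume * eLpNorm g q volume))
    {δ : ℝ} (hδ : 0 < δ)
    (U : Fin N → (EuclideanSpace ℝ (Fin d) ≃ᵃⁱ[ℝ] EuclideanSpace ℝ (Fin d)))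
    (hU : Pairwise (fun i j => Disjoint (shiftedTube δ (U i)) (shiftedTube δ (U j))))
    (f g : 𝓢(EuclideanSpace ℝ (Fin d), ℂ)) (hf1 : ∀ x, ‖f x‖ ≤ 1) (hg1 : ∀ x, ‖g x‖ ≤ 1)
    (hf : Function.support f ⊆ modelTube d 0 1 δ) (hg : Function.support g ⊆ modelTube d 2 3 δ)
    (α : ℂ) (hα : ∀ j, B (transport (U j) f) (transport (U j) g) = α) :
    ‖α‖ ≤ A * volume.real (modelTube d 0 1 δ) *
      (volume.real (⋃ j, tube δ (U j)) / ∑ j, volume.real (tube δ (U j))) ^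
        ((p⁻¹).toReal - 1 / 2) := by
  have supp : ∀ (h : 𝓢(EuclideanSpace ℝ (Fin d), ℂ)) (s : Set (EuclideanSpace ℝ (Fin d)))
      (W : EuclideanSpace ℝ (Fin d) ≃ᵃⁱ[ℝ] EuclideanSpace ℝ (Fin d)),
      Function.support h ⊆ s → Function.support (transport W h) ⊆ W '' s := by
    intro h s W hs x hx
    refine ⟨W.symm x, hs ?_, W.apply_symm_apply x⟩
    rw [Function.mem_support] at hx ⊢
    rwa [← transport_apply_apply W h, W.apply_symm_apply]
  set v := volume (modelTube d 0 1 δ) with hv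
  have hvt : v ≠ ∞ := ((volume_modelTube_le hδ.le).trans_lt ENNReal.ofReal_lt_top).ne
  have hvol : ∀ j, volume (tube δ (U j)) = v := fun j => volume_affineIsometryEquiv_image _ _
  have key := enorm_diagonal_le hp2 B hB (fun j => transport (U j) f) (fun j => transport (U j) g)
    (fun j => tube δ (U j)) (fun j => shiftedTube δ (U j)) (v := v)
    (fun j x => by rw [transport_apply]; exact hf1 _) (fun j => supp _ _ _ hf)
    (fun j x => by rw [transport_apply]; exact hg1 _) (fun j => supp _ _ _ hg) hU
    (fun j => measurableSet_tube _ _) (fun j => (hvol j).le)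
    (fun j => by
      rw [shiftedTube, volume_affineIsometryEquiv_image, volume_modelTube_shift]) α hα
  set u := volume (⋃ j, tube δ (U j)) with hu
  have hut : u ≠ ∞ := by
    refine ((measure_iUnion_fintype_le _ _).trans_lt ?_).ne
    simp only [hvol, Finset.sum_const, Finset.card_univ, Fintype.card_fin, nsmul_eq_mul]
    exact ENNReal.mul_lt_top (by simp) hvt.lt_top
  have hp1 : 1 ≤ p := ENNReal.HolderConjugate.one_le p q
  have hp0 : p ≠ 0 := (zero_lt_one.trans_le hp1).ne'
  have hpt : p ≠ ∞ := (hp2.trans_lt (by simp)).ne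
  have hθ : 0 ≤ 1 / p.toReal - 1 / 2 := by
    have h1 : 0 < p.toReal := ENNReal.toReal_pos hp0 hpt
    have h2 : p.toReal ≤ 2 := by
      simpa using ENNReal.toReal_mono (by simp) hp2
    rw [sub_nonneg]
    exact one_div_le_one_div_of_le h1 h2
  have hqr : q.toReal⁻¹ = 1 - 1 / p.toReal := by
    have h1 := ENNReal.HolderConjugate.inv_add_inv_eq_one p q
    have h2 := congrArg ENNReal.toReal h1
    rw [ENNReal.toReal_add (by simpa using hp0)
      (by simpa using ENNReal.HolderConjugate.ne_zero q p), ENNReal.toReal_inv,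
      ENNReal.toReal_inv, ENNReal.toReal_one] at h2
    rw [one_div]
    linarith
  have hv0 : 0 < v.toReal := ENNReal.toReal_pos (volume_modelTube_pos hδ).ne' hvt
  have hN' : (0 : ℝ) < N := by exact_mod_cast hN
  have hq0 : 0 ≤ q.toReal⁻¹ := by positivity
  have key' : (N : ℝ) * ‖α‖ ≤ A * (u.toReal ^ (1 / p.toReal - 1 / 2) *
      (N * v.toReal) ^ (1 / 2 : ℝ) * (N * v.toReal) ^ q.toReal⁻¹) := by
    have hNv : (N : ℝ≥0∞) * v ≠ ∞ := ENNReal.mul_ne_top (by simp) hvt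
    have := ENNReal.toReal_mono (by
      refine ENNReal.mul_ne_top (by simp) (ENNReal.mul_ne_top (ENNReal.mul_ne_top ?_ ?_) ?_)
      · exact ENNReal.rpow_ne_top_of_nonneg hθ hut
      · exact ENNReal.rpow_ne_top_of_nonneg (by norm_num) hNv
      · exact ENNReal.rpow_ne_top_of_nonneg hq0 hNv) key
    simpa [ENNReal.toReal_mul, ← ENNReal.toReal_rpow] using this
  have hsum : ∑ j, volume.real (tube δ (U j)) = N * v.toReal := by
    simp [Measure.real, hvol]
  have hW : 0 < N * v.toReal := by positivity
  rw [hsum, ENNReal.toReal_inv, ← one_div, Measure.real, Measure.real, ← hu, ← hv,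
    Real.div_rpow ENNReal.toReal_nonneg hW.le]
  -- With `1/q = 1 - 1/p`, the exponents `1/2 + 1/q` and `1/p - 1/2` add up to `1`: one power of the
  -- total volume comes out and the rest forms the compression ratio.
  have e : (N * v.toReal) ^ (1 / 2 : ℝ) * (N * v.toReal) ^ q.toReal⁻¹ =
      (N * v.toReal) / (N * v.toReal) ^ (1 / p.toReal - 1 / 2) := by
    rw [← Real.rpow_add hW, eq_div_iff (Real.rpow_pos_of_pos hW _).ne', ← Real.rpow_add hW, hqr,
      show 1 / 2 + (1 - 1 / p.toReal) + (1 / p.toReal - 1 / 2) = 1 by ring, Real.rpow_one]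
  rw [mul_assoc (u.toReal ^ _), e] at key'
  refine le_of_mul_le_mul_left (key'.trans_eq ?_) hN'
  ring

/-- For `p ≥ 2` the flipped form is bounded on `L_q × L_p` with `q ≤ 2`, and evenness of the symbol
identifies its diagonal coefficient with the original one. The infimum over families of tubes is
then taken. -/
theorem norm_pairing_le_kakeyaFun {p q : ℝ≥0∞} [hpq : p.HolderConjugate q] {A : ℝ≥0}
    {m : EuclideanSpace ℝ (Fin d) → ℂ} (hm : AEStronglyMeasurable m volume) {b : ℝ}
    (hb : ∀ ξ, ‖m ξ‖ ≤ b) (hrad : ∀ ξ η, ‖ξ‖ = ‖η‖ → m ξ = m η) (h : PairingBound p q A m)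
    {δ : ℝ} (hδ : 0 < δ)
    (f g : 𝓢(EuclideanSpace ℝ (Fin d), ℂ)) (hf1 : ∀ x, ‖f x‖ ≤ 1) (hg1 : ∀ x, ‖g x‖ ≤ 1)
    (hf : Function.support f ⊆ modelTube d 0 1 δ) (hg : Function.support g ⊆ modelTube d 2 3 δ) :
    ‖∫ ξ, m ξ * ((𝓕 f) ξ * (𝓕⁻ g) ξ)‖ ≤ A * volume.real (modelTube d 0 1 δ) *
      kakeyaFun d δ ^ |(p⁻¹).toReal - 1 / 2| := by
  set α := ∫ ξ, m ξ * ((𝓕 f) ξ * (𝓕⁻ g) ξ) with hα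
  set θ := |(p⁻¹).toReal - 1 / 2| with hθ
  have hL : ∀ (L : EuclideanSpace ℝ (Fin d) ≃ₗᵢ[ℝ] EuclideanSpace ℝ (Fin d)) ξ,
    m (L ξ) = m ξ := fun L ξ => hrad _ _ (L.norm_map ξ)
  have hev : ∀ ξ, m (-ξ) = m ξ := fun ξ => hrad _ _ (norm_neg ξ)
  have hpi := ENNReal.HolderConjugate.inv_add_inv_eq_one p q
  have hpq1 : (p⁻¹).toReal + (q⁻¹).toReal = 1 := by
    have := congrArg ENNReal.toReal hpi
    rwa [ENNReal.toReal_add (by simpa using ENNReal.HolderConjugate.ne_zero p q)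
      (by simpa using ENNReal.HolderConjugate.ne_zero q p), ENNReal.toReal_one] at this
  have main : ∀ (N : ℕ) (_ : 0 < N)
      (U : Fin N → (EuclideanSpace ℝ (Fin d) ≃ᵃⁱ[ℝ] EuclideanSpace ℝ (Fin d))),
      Pairwise (fun i j => Disjoint (shiftedTube δ (U i)) (shiftedTube δ (U j))) →
      ‖α‖ ≤ A * volume.real (modelTube d 0 1 δ) *
      (volume.real (⋃ j, tube δ (U j)) / ∑ j, volume.real (tube δ (U j))) ^ θ := by
    intro N hN U hU
    rcases le_total p 2 with hp2 | hp2
    · have e : θ = (p⁻¹).toReal - 1 / 2 := by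
        rw [hθ, abs_of_nonneg]
        have h1 : (2 : ℝ≥0∞)⁻¹ ≤ p⁻¹ := ENNReal.inv_le_inv.2 hp2
        have h2 := ENNReal.toReal_mono
          (by simpa using ENNReal.HolderConjugate.ne_zero p q) h1
        simp only [ENNReal.toReal_inv, ENNReal.toReal_ofNat] at h2 ⊢
        linarith
      rw [e]
      exact norm_diagonal_le_ratio hN hp2 (pairingForm m hm hb) h hδ U hU f g hf1 hg1 hf hg α
        fun j => integral_transport hL (U j) f g
    · have hq2 : (q⁻¹).toReal - 1 / 2 = θ := by
        have h1 : p⁻¹ ≤ (2 : ℝ≥0∞)⁻¹ := ENNReal.inv_le_inv.2 hp2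
        have h2 := ENNReal.toReal_mono (by simp) h1
        rw [hθ, abs_of_nonpos]
        · linarith
        · simp only [ENNReal.toReal_inv, ENNReal.toReal_ofNat] at h2 ⊢
          linarith
      have hq2' : q ≤ 2 := by
        have h0 : 0 ≤ θ := abs_nonneg _
        have h1 : (2 : ℝ≥0∞)⁻¹ ≤ q⁻¹ := by
          rw [← ENNReal.toReal_le_toReal (by simp)
            (by simpa using ENNReal.HolderConjugate.ne_zero q p)]
          simp only [ENNReal.toReal_inv, ENNReal.toReal_ofNat] at hq2 ⊢
          linarith
        exact ENNReal.inv_le_inv.1 h1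
      rw [← hq2]
      have hqp : q.HolderConjugate p := hpq.symm
      refine norm_diagonal_le_ratio (p := q) (q := p) hN hq2' (pairingForm m hm hb).flip
        (fun f g => ?_) hδ U hU f g hf1 hg1 hf hg α fun j => ?_
      · rw [mul_comm (eLpNorm f q volume)]
        exact h g f
      · refine (integral_transport hL (U j) g f).trans ?_
        simp only [hα, fourier_coe, fourierInv_coe]
        exact integral_even_symbol hev g f
  -- A single tube is an admissible family, so `sInf` is a genuine infimum.
  have hset : {ε : ℝ | 0 < ε ∧ ∃ (N : ℕ) (_ : 0 < N)
      (U : Fin N → (EuclideanSpace ℝ (Fin d) ≃ᵃⁱ[ℝ] EuclideanSpace ℝ (Fin d))),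
      Pairwise (fun i j => Disjoint (shiftedTube δ (U i)) (shiftedTube δ (U j))) ∧
      volume.real (⋃ j, tube δ (U j)) / ∑ j, volume.real (tube δ (U j)) ≤ ε}.Nonempty := by
    refine ⟨_, lt_max_of_lt_left one_pos, 1, one_pos, fun _ => AffineIsometryEquiv.refl ℝ _,
      fun i j hij => (hij (Subsingleton.elim i j)).elim, le_max_right _ _⟩
  by_contra hlt
  push Not at hlt
  -- Since `θ ≥ 0`, the power is continuous even where `kakeyaFun d δ = 0`, so the bound passes to
  -- the infimum.
  have hcont : ContinuousAt (fun ε : ℝ => A * volume.real (modelTube d 0 1 δ) * ε ^ θ)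
      (kakeyaFun d δ) :=
    continuousAt_const.mul (Real.continuousAt_rpow_const _ _ (Or.inr (abs_nonneg _)))
  obtain ⟨r, hr, hr'⟩ := Metric.eventually_nhds_iff.1 (hcont.eventually (gt_mem_nhds hlt))
  obtain ⟨ε, hε, hε'⟩ := exists_lt_of_csInf_lt hset
    (show kakeyaFun d δ < kakeyaFun d δ + r by linarith)
  have h1 : kakeyaFun d δ ≤ ε := csInf_le ⟨0, fun x hx => hx.1.le⟩ hε
  have h2 := @hr' ε (by rw [Real.dist_eq, abs_of_nonneg (by linarith)]; linarith)
  obtain ⟨_, N, hN, U, hU, hle⟩ := hε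
  have h3 := main N hN U hU
  refine absurd (h3.trans ?_) (not_le.2 h2)
  gcongr

end Tubes

/-! ### Removing the curvature of spheres from the symbol. -/

section Curvature

open Filter Topology

theorem intervalIntegrable_of_norm_le {N : ℝ → ℂ} {b : ℝ} (hNm : Measurable N)
    (hNb : ∀ v, ‖N v‖ ≤ b) (x y : ℝ) : IntervalIntegrable N volume x y := by
  rw [intervalIntegrable_iff]
  exact Measure.integrableOn_of_bounded (M := b) (by simp) hNm.aestronglyMeasurable
    (Eventually.of_forall hNb)

theorem norm_primitive_sub_le {N : ℝ → ℂ} {b : ℝ} (hNm : Measurable N)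
    (hNb : ∀ v, ‖N v‖ ≤ b) (x y : ℝ) :
    ‖(∫ v in (0 : ℝ)..x, N v) - ∫ v in (0 : ℝ)..y, N v‖ ≤ b * |x - y| := by
  rw [intervalIntegral.integral_interval_sub_left (intervalIntegrable_of_norm_le hNm hNb _ _)
    (intervalIntegrable_of_norm_le hNm hNb _ _)]
  exact intervalIntegral.norm_integral_le_of_norm_le_const fun v _ => hNb v

/-- `N` may be discontinuous at `0`, because of the logarithm. When `(1 + h x)² + a` vanishes, the
chain rule is replaced by the bound of the primitive by `b` times a square, which forces a zero
derivative. -/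
theorem hasDerivAt_primitive_sq_add {N : ℝ → ℂ} {b : ℝ} (hNm : Measurable N)
    (hNb : ∀ v, ‖N v‖ ≤ b) (hNc : ∀ v, 0 < v → ContinuousAt N v) {a : ℝ} (ha : 0 ≤ a)
    (h x : ℝ) :
    HasDerivAt (fun x : ℝ => ∫ v in (0 : ℝ)..((1 + h * x) ^ 2 + a), N v)
      ((2 * h * (1 + h * x) : ℝ) * N ((1 + h * x) ^ 2 + a)) x := by
  have hq : HasDerivAt (fun x : ℝ => (1 + h * x) ^ 2 + a) (2 * h * (1 + h * x)) x := by
    have := ((((hasDerivAt_id x).const_mul h).const_add 1).pow 2).add_const a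
    refine this.congr_deriv ?_
    simp
    ring
  rcases (add_nonneg (sq_nonneg (1 + h * x)) ha).lt_or_eq with hpos | hzero
  · have h1 := intervalIntegral.integral_hasDerivAt_right
      (intervalIntegrable_of_norm_le hNm hNb 0 ((1 + h * x) ^ 2 + a))
      (hNm.stronglyMeasurable.stronglyMeasurableAtFilter) (hNc _ hpos)
    have h2 := h1.scomp x hq
    simpa [Function.comp_def, Complex.real_smul] using! h2
  · have hX : 1 + h * x = 0 := by
      have : (1 + h * x) ^ 2 = 0 := by linarith [sq_nonneg (1 + h * x)]
      exact pow_eq_zero_iff (two_ne_zero) |>.1 this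
    have ha0 : a = 0 := by rw [hX] at hzero; linarith
    subst ha0
    rw [hX]
    simp only [mul_zero, Complex.ofReal_zero, zero_mul, add_zero]
    have hO : (fun y : ℝ => ∫ v in (0 : ℝ)..((1 + h * y) ^ 2), N v) =O[𝓝 x]
        fun y => ‖y - x‖ ^ 2 := by
      refine Asymptotics.IsBigO.of_bound (b * h ^ 2) (Eventually.of_forall fun y => ?_)
      have h1 := norm_primitive_sub_le hNm hNb ((1 + h * y) ^ 2) 0
      rw [intervalIntegral.integral_same, sub_zero, sub_zero] at h1
      refine h1.trans_eq ?_
      rw [show 1 + h * y = h * (y - x) by linear_combination hX, abs_of_nonneg (sq_nonneg _),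
        norm_pow, norm_norm, Real.norm_eq_abs, sq_abs]
      ring
    simpa using! (hO.hasFDerivAt one_lt_two).hasDerivAt

/-- A symbol seen through a function of `X² + a`, with `X = 1 + h x` and `a` small, is close to
the same symbol seen through `X²`, when it is averaged against a Schwartz function of `x`. -/
theorem norm_integral_curved_sub_le {N : ℝ → ℂ} {b : ℝ} (hNm : Measurable N)
    (hNb : ∀ v, ‖N v‖ ≤ b) (hNc : ∀ v, 0 < v → ContinuousAt N v) {h a : ℝ} (hh : 0 < h)
    (ha : 0 ≤ a) (Ψ : 𝓢(ℝ, ℂ)) :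
    ‖∫ x, (N ((1 + h * x) ^ 2 + a) - N ((1 + h * x) ^ 2)) * Ψ x‖ ≤
      b * (h * (2 * ∫ x, ‖x‖ * ‖Ψ x‖) + a / h * (1 / 2 * ∫ x, ‖deriv Ψ x‖)) := by
  set E : ℝ → ℂ := fun x => N ((1 + h * x) ^ 2 + a) - N ((1 + h * x) ^ 2) with hE
  have hEm : Measurable E := by
    exact (hNm.comp (by fun_prop)).sub (hNm.comp (by fun_prop))
  have hEb : ∀ x, ‖E x‖ ≤ 2 * b := fun x => by
    refine (norm_sub_le _ _).trans ?_
    linarith [hNb ((1 + h * x) ^ 2 + a), hNb ((1 + h * x) ^ 2)]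
  set D : ℝ → ℂ := fun x => (∫ v in (0 : ℝ)..((1 + h * x) ^ 2 + a), N v) -
    ∫ v in (0 : ℝ)..((1 + h * x) ^ 2 + 0), N v with hD
  have hDd : ∀ x, HasDerivAt D ((2 * h * (1 + h * x) : ℝ) * E x) x := fun x => by
    have := (hasDerivAt_primitive_sq_add hNm hNb hNc ha h x).sub
      (hasDerivAt_primitive_sq_add hNm hNb hNc le_rfl h x)
    refine this.congr_deriv ?_
    simp only [hE, add_zero]
    ring
  have hDb : ∀ x, ‖D x‖ ≤ b * a := fun x => by
    have := norm_primitive_sub_le hNm hNb ((1 + h * x) ^ 2 + a) ((1 + h * x) ^ 2 + 0)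
    rwa [show (1 + h * x) ^ 2 + a - ((1 + h * x) ^ 2 + 0) = a by ring, abs_of_nonneg ha] at this
  have hDc : Continuous D := continuous_iff_continuousAt.2 fun x => (hDd x).continuousAt
  have hΨ' : Integrable (deriv Ψ) := (derivCLM ℂ ℂ Ψ).integrable (μ := volume)
  have hxΨ : Integrable (fun x : ℝ => (x : ℂ) * Ψ x) := by
    refine (Ψ.integrable_pow_mul volume 1).mono' (by
      exact (Complex.continuous_ofReal.mul Ψ.continuous).aestronglyMeasurable)
      (Eventually.of_forall fun x => ?_)
    simp
  have hEΨ : Integrable (fun x => E x * Ψ x) :=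
    Ψ.integrable.bdd_mul hEm.aestronglyMeasurable (Eventually.of_forall hEb)
  have hExΨ : Integrable (fun x => E x * ((x : ℂ) * Ψ x)) :=
    hxΨ.bdd_mul hEm.aestronglyMeasurable (Eventually.of_forall hEb)
  have hparts : ∫ x, D x * deriv Ψ x = -∫ x, ((2 * h * (1 + h * x) : ℝ) * E x) * Ψ x := by
    refine integral_mul_deriv_eq_deriv_mul_of_integrable (fun x _ => hDd x)
      (fun x _ => Ψ.hasDerivAt x) ?_ ?_ ?_
    · exact hΨ'.bdd_mul hDc.aestronglyMeasurable (Eventually.of_forall hDb)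
    · refine ((hEΨ.const_mul (2 * h : ℂ)).add (hExΨ.const_mul (2 * h * h : ℂ))).congr
        (Eventually.of_forall fun x => ?_)
      simp only [Pi.add_apply, Pi.mul_apply]
      push_cast
      ring
    · exact Ψ.integrable.bdd_mul hDc.aestronglyMeasurable (Eventually.of_forall hDb)
  -- Write `E = D' / (2h) - h x E`, using `D' = 2h (1 + h x) E`. Integration by parts and `‖D‖ ≤ b
  -- a` give the `a / h` term without any smoothness of `N`; the remainder gives the `h` term.
  have hsplit : ∫ x, E x * Ψ x = -(1 / (2 * h) : ℂ) * (∫ x, D x * deriv Ψ x) -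
      h * ∫ x, E x * ((x : ℂ) * Ψ x) := by
    have hh' : (h : ℂ) ≠ 0 := by exact_mod_cast hh.ne'
    rw [hparts, mul_neg, neg_mul, neg_neg, ← integral_const_mul, ← integral_const_mul,
      ← integral_sub]
    · refine integral_congr_ae (Eventually.of_forall fun x => ?_)
      simp only
      push_cast
      field_simp
      ring
    · refine (hEΨ.add (hExΨ.const_mul (h : ℂ))).congr (Eventually.of_forall fun x => ?_)
      simp only [Pi.add_apply]
      push_cast
      field_simp
    · exact hExΨ.const_mul _
  have hn1 : ‖∫ x, D x * deriv Ψ x‖ ≤ b * a * ∫ x, ‖deriv Ψ x‖ := by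
    rw [← integral_const_mul]
    refine norm_integral_le_of_norm_le (hΨ'.norm.const_mul _) (Eventually.of_forall fun x => ?_)
    rw [norm_mul]
    gcongr
    exact hDb x
  have hn2 : ‖∫ x, E x * ((x : ℂ) * Ψ x)‖ ≤ 2 * b * ∫ x, ‖x‖ * ‖Ψ x‖ := by
    rw [← integral_const_mul]
    refine norm_integral_le_of_norm_le ?_ (Eventually.of_forall fun x => ?_)
    · simpa using (Ψ.integrable_pow_mul volume 1).const_mul (2 * b)
    · rw [norm_mul, norm_mul, Complex.norm_real]
      gcongr
      exact hEb x
  rw [hsplit]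
  refine (norm_sub_le _ _).trans ?_
  rw [norm_mul, norm_mul, norm_neg]
  have e1 : ‖(1 / (2 * h) : ℂ)‖ = 1 / (2 * h) := by
    simp [abs_of_pos hh]
  have e2 : ‖(h : ℂ)‖ = h := by simp [abs_of_pos hh]
  rw [e1, e2]
  calc _ ≤ 1 / (2 * h) * (b * a * ∫ x, ‖deriv Ψ x‖) + h * (2 * b * ∫ x, ‖x‖ * ‖Ψ x‖) := by
        gcongr
    _ = _ := by
        field_simp
        ring

end Curvature

/-! ### Fourier transforms of tensor products. -/

section TensorProduct

open Filter Topology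

variable {d : ℕ}

theorem hasCompactSupport_prod_apply {a : Fin d → ℝ → ℂ} (ha : ∀ i, HasCompactSupport (a i)) :
    HasCompactSupport (fun x : EuclideanSpace ℝ (Fin d) => ∏ i, a i (x i)) := by
  refine HasCompactSupport.intro (K := WithLp.toLp 2 '' (univ.pi fun i => tsupport (a i)))
    ((isCompact_univ_pi fun i => (ha i).isCompact).image (PiLp.continuous_toLp 2 _)) ?_
  intro x hx
  have : ∃ i, x i ∉ tsupport (a i) := by
    by_contra hn
    push Not at hn
    exact hx ⟨x.ofLp, fun i _ => hn i, rfl⟩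
  obtain ⟨i, hi⟩ := this
  exact Finset.prod_eq_zero (Finset.mem_univ i) (image_eq_zero_of_notMem_tsupport hi)

/-- The tensor product of smooth compactly supported functions of one variable. -/
noncomputable def tensorSchwartz (a : Fin d → ℝ → ℂ) (ha : ∀ i, HasCompactSupport (a i))
    (ha' : ∀ i, ContDiff ℝ ((⊤ : ℕ∞) : WithTop ℕ∞) (a i)) : 𝓢(EuclideanSpace ℝ (Fin d), ℂ) :=
  (hasCompactSupport_prod_apply ha).toSchwartzMap
    (contDiff_prod fun i _ => (ha' i).comp (by fun_prop))

theorem tensorSchwartz_apply (a : Fin d → ℝ → ℂ) (ha : ∀ i, HasCompactSupport (a i))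
    (ha' : ∀ i, ContDiff ℝ ((⊤ : ℕ∞) : WithTop ℕ∞) (a i)) (x : EuclideanSpace ℝ (Fin d)) :
    tensorSchwartz a ha ha' x = ∏ i, a i (x i) := rfl

theorem integral_euclideanSpace_eq_pi (g : EuclideanSpace ℝ (Fin d) → ℂ) :
    ∫ x, g x = ∫ y : Fin d → ℝ, g (WithLp.toLp 2 y) :=
  ((PiLp.volume_preserving_toLp (Fin d)).integral_comp
    (MeasurableEquiv.toLp 2 (Fin d → ℝ)).measurableEmbedding g).symm

theorem fourier_prod_apply (a : Fin d → ℝ → ℂ) (ξ : EuclideanSpace ℝ (Fin d)) :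
    𝓕 (fun x : EuclideanSpace ℝ (Fin d) => ∏ i, a i (x i)) ξ = ∏ i, 𝓕 (a i) (ξ i) := by
  simp_rw [Real.fourier_eq]
  rw [integral_euclideanSpace_eq_pi, ← integral_fintype_prod_volume_eq_prod]
  refine integral_congr_ae (Eventually.of_forall fun y => ?_)
  simp only [Circle.smul_def, smul_eq_mul]
  rw [Finset.prod_mul_distrib]
  congr 1
  rw [PiLp.inner_apply, ← Finset.sum_neg_distrib]
  induction (Finset.univ : Finset (Fin d)) using Finset.cons_induction with
  | empty => simp
  | cons i s hi ih =>
    rw [Finset.sum_cons, Finset.prod_cons, AddChar.map_add_eq_mul, Circle.coe_mul, ih]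

theorem fourierInv_prod_apply (a : Fin d → ℝ → ℂ) (ξ : EuclideanSpace ℝ (Fin d)) :
    𝓕⁻ (fun x : EuclideanSpace ℝ (Fin d) => ∏ i, a i (x i)) ξ = ∏ i, 𝓕⁻ (a i) (ξ i) := by
  simp_rw [Real.fourierInv_eq_fourier_neg, fourier_prod_apply]
  rfl

theorem fourier_modulate (ψ : ℝ → ℂ) (ν ξ : ℝ) :
    𝓕 (fun t => (Real.fourierChar (ν * t) : ℂ) * ψ t) ξ = 𝓕 ψ (ξ - ν) := by
  rw [Real.fourier_real_eq, Real.fourier_real_eq]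
  refine integral_congr_ae (Eventually.of_forall fun t => ?_)
  simp only [Circle.smul_def, smul_eq_mul]
  rw [← mul_assoc, ← Circle.coe_mul, ← AddChar.map_add_eq_mul]
  congr 3
  ring

theorem fourierInv_modulate (ψ : ℝ → ℂ) (ν ξ : ℝ) :
    𝓕⁻ (fun t => (Real.fourierChar (-ν * t) : ℂ) * ψ t) ξ = 𝓕⁻ ψ (ξ - ν) := by
  rw [Real.fourierInv_eq_fourier_neg, fourier_modulate, Real.fourierInv_eq_fourier_neg,
    show -(ξ - ν) = -ξ - -ν by ring]

end TensorProduct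

/-! ### Separating the axial frequency from the transverse ones. -/

section Splitting

open Filter Topology

theorem integral_radial_split {n : ℕ} {H : ℝ → ℂ} (hHm : Measurable H) {b : ℝ}
    (hHb : ∀ v, ‖H v‖ ≤ b) {k₀ k : ℝ → ℂ} (hk₀ : Integrable k₀) (hk : Integrable k) :
    ∫ ξ : EuclideanSpace ℝ (Fin (n + 1)), H (‖ξ‖ ^ 2) * (k₀ (ξ 0) * ∏ i : Fin n, k (ξ i.succ)) =
      ∫ y : Fin n → ℝ, (∏ i, k (y i)) * ∫ x, H (x ^ 2 + ∑ i, y i ^ 2) * k₀ x := by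
  have e1 : ∀ y : Fin (n + 1) → ℝ, ‖(WithLp.toLp 2 y : EuclideanSpace ℝ (Fin (n + 1)))‖ ^ 2 =
      y 0 ^ 2 + ∑ i : Fin n, y i.succ ^ 2 := by
    intro y
    rw [EuclideanSpace.real_norm_sq_eq, Fin.sum_univ_succ]
  rw [integral_euclideanSpace_eq_pi]
  simp_rw [e1]
  rw [← ((volume_preserving_piFinSuccAbove (fun _ : Fin (n + 1) => ℝ) 0).symm _).integral_comp'
    (fun y : Fin (n + 1) → ℝ => H (y 0 ^ 2 + ∑ i : Fin n, y i.succ ^ 2) *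
      (k₀ (y 0) * ∏ i : Fin n, k (y i.succ)))]
  have e2 : ∀ z : ℝ × (Fin n → ℝ),
      H ((MeasurableEquiv.piFinSuccAbove (fun _ : Fin (n + 1) => ℝ) 0).symm z 0 ^ 2 +
        ∑ i : Fin n, (MeasurableEquiv.piFinSuccAbove (fun _ : Fin (n + 1) => ℝ) 0).symm z i.succ ^ 2)
      * (k₀ ((MeasurableEquiv.piFinSuccAbove (fun _ : Fin (n + 1) => ℝ) 0).symm z 0) *
        ∏ i : Fin n, k ((MeasurableEquiv.piFinSuccAbove (fun _ : Fin (n + 1) => ℝ) 0).symm z i.succ))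
      = H (z.1 ^ 2 + ∑ i, z.2 i ^ 2) * (k₀ z.1 * ∏ i, k (z.2 i)) := fun z => by
    simp [MeasurableEquiv.piFinSuccAbove]
  simp_rw [e2]
  have hint : Integrable (fun z : ℝ × (Fin n → ℝ) =>
      H (z.1 ^ 2 + ∑ i, z.2 i ^ 2) * (k₀ z.1 * ∏ i, k (z.2 i))) (volume.prod volume) := by
    refine (hk₀.mul_prod (Integrable.fintype_prod fun i : Fin n => hk)).bdd_mul ?_
      (Eventually.of_forall fun z => hHb _)
    exact (hHm.comp (by fun_prop)).aestronglyMeasurable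
  rw [Measure.volume_eq_prod, integral_prod_symm _ hint]
  refine integral_congr_ae (Eventually.of_forall fun y => ?_)
  simp only
  rw [← integral_const_mul]
  refine integral_congr_ae (Eventually.of_forall fun x => ?_)
  simp only
  ring

theorem integrable_prod_mul_sum_sq {n : ℕ} (κ : 𝓢(ℝ, ℂ)) (c₁ c₂ : ℝ) :
    Integrable (fun y : Fin n → ℝ => ‖∏ i, κ (y i)‖ * (c₁ + c₂ * ∑ i, y i ^ 2)) := by
  have h0 : Integrable (fun y : Fin n → ℝ => ‖∏ i, κ (y i)‖) :=
    (Integrable.fintype_prod fun i : Fin n => κ.integrable).norm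
  have h1 : ∀ i : Fin n, Integrable (fun y : Fin n → ℝ => ‖∏ j, κ (y j)‖ * y i ^ 2) := by
    intro i
    have := Integrable.fintype_prod (μ := fun _ : Fin n => (volume : Measure ℝ))
      (f := fun (j : Fin n) (t : ℝ) => if j = i then t ^ 2 * ‖κ t‖ else ‖κ t‖) fun j => by
        split_ifs
        · simpa using κ.integrable_pow_mul volume 2
        · exact κ.integrable.norm
    refine this.congr (Eventually.of_forall fun y => ?_)
    simp only
    rw [norm_prod, ← Finset.mul_prod_erase _ _ (Finset.mem_univ i),
      ← Finset.mul_prod_erase Finset.univ (fun j => ‖κ (y j)‖) (Finset.mem_univ i), if_pos rfl,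
      Finset.prod_congr rfl fun j hj => if_neg (Finset.ne_of_mem_erase hj)]
    ring
  refine ((h0.mul_const c₁).add ((integrable_finsetSum Finset.univ fun i _ => h1 i).const_mul
    c₂)).congr (Eventually.of_forall fun y => ?_)
  simp only [Pi.add_apply, ← Finset.mul_sum]
  ring

theorem integral_prod_scaled {n : ℕ} {δ : ℝ} (hδ : 0 < δ) (F : (Fin n → ℝ) → ℝ) :
    ∫ y : Fin n → ℝ, F (δ • y) = (δ ^ n)⁻¹ * ∫ y, F y := by
  rw [Measure.integral_comp_smul, abs_of_pos (by positivity)]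
  simp

/-- The main term in the pairing of a radial symbol with a product kernel, localized at frequency
`1 / h` in the first variable and `1 / δ` in the other ones. -/
theorem exists_norm_integral_le_of_split (n : ℕ) (Ψ κ : 𝓢(ℝ, ℂ)) :
    ∃ C : ℝ, 0 ≤ C ∧ ∀ (N : ℝ → ℂ) (b : ℝ), Measurable N → (∀ v, ‖N v‖ ≤ b) →
      (∀ v, 0 < v → ContinuousAt N v) → ∀ h δ : ℝ, 0 < h → 0 < δ → δ ≤ 1 →
      ‖∫ x, N ((1 + h * x) ^ 2) * Ψ x‖ * ‖∫ x, κ x‖ ^ n ≤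
        (δ ^ n)⁻¹ * ‖∫ ξ : EuclideanSpace ℝ (Fin (n + 1)), N (h ^ 2 * ‖ξ‖ ^ 2) *
          (Ψ (ξ 0 - 1 / h) * ∏ i : Fin n, ((δ ^ 2 : ℝ) * κ (δ * ξ i.succ)))‖ +
        C * b * (h / δ ^ 2) := by
  set I₁ := 2 * ∫ x, ‖x‖ * ‖Ψ x‖ with hI₁
  set I₂ := 1 / 2 * ∫ x, ‖deriv Ψ x‖ with hI₂
  have hI₁0 : 0 ≤ I₁ := mul_nonneg two_pos.le (integral_nonneg fun x => by positivity)
  have hI₂0 : 0 ≤ I₂ := mul_nonneg (by norm_num) (integral_nonneg fun x => norm_nonneg _)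
  refine ⟨∫ y : Fin n → ℝ, ‖∏ i, κ (y i)‖ * (I₁ + I₂ * ∑ i, y i ^ 2),
    integral_nonneg fun y => by positivity, ?_⟩
  intro N b hNm hNb hNc h δ hh hδ hδ1
  have hb : 0 ≤ b := (norm_nonneg _).trans (hNb 0)
  set c₀ := ∫ x, N ((1 + h * x) ^ 2) * Ψ x with hc₀
  -- Each of the two dilated transverse profiles contributes a factor `δ`.
  let k : ℝ → ℂ := fun t => (δ ^ 2 : ℝ) * κ (δ * t)
  have hk : Integrable k := (κ.integrable.comp_mul_left' hδ.ne').const_mul _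
  have hΨ : Integrable (fun x => Ψ (x - 1 / h)) := Ψ.integrable.comp_sub_right _
  rw [integral_radial_split (H := fun v => N (h ^ 2 * v)) (k₀ := fun x => Ψ (x - 1 / h)) (k := k)
    (hNm.comp (by fun_prop)) (fun v => hNb _) hΨ hk]
  set J : (Fin n → ℝ) → ℂ := fun y => ∫ x, N (h ^ 2 * (x ^ 2 + ∑ i, y i ^ 2)) * Ψ (x - 1 / h)
    with hJ
  have hJ' : ∀ y, J y = ∫ x, N ((1 + h * x) ^ 2 + h ^ 2 * ∑ i, y i ^ 2) * Ψ x := by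
    intro y
    rw [hJ]
    simp only
    rw [← integral_add_right_eq_self _ (1 / h)]
    refine integral_congr_ae (Eventually.of_forall fun x => ?_)
    simp only [add_sub_cancel_right]
    congr 2
    field_simp
    ring
  have hNint : ∀ g : ℝ → ℝ, Measurable g → Integrable (fun x => N (g x) * Ψ x) := fun g hg =>
    Ψ.integrable.bdd_mul (hNm.comp hg).aestronglyMeasurable (Eventually.of_forall fun x => hNb _)
  -- The curvature estimate with `a = h² |y|²`, so that `a / h = h |y|²`.
  have hJc : ∀ y, ‖J y - c₀‖ ≤ b * h * (I₁ + I₂ * ∑ i, y i ^ 2) := by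
    intro y
    have := norm_integral_curved_sub_le hNm hNb hNc hh
      (a := h ^ 2 * ∑ i, y i ^ 2) (by positivity) Ψ
    simp_rw [sub_mul] at this
    rw [integral_sub (hNint _ (by fun_prop)) (hNint _ (by fun_prop)), ← hJ', ← hc₀] at this
    refine this.trans_eq ?_
    rw [← hI₁, ← hI₂]
    field_simp
  have hprod : ∀ y : Fin n → ℝ, ∏ i, k (y i) = ((δ ^ 2) ^ n : ℝ) * ∏ i, κ ((δ • y) i) := by
    intro y
    simp [k, Finset.prod_mul_distrib]
  have hδn : (0 : ℝ) < δ ^ n := by positivity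
  have hkint : Integrable (fun y : Fin n → ℝ => ∏ i, k (y i)) :=
    Integrable.fintype_prod fun i : Fin n => hk
  have hmain : ∫ y : Fin n → ℝ, ∏ i, k (y i) = (δ ^ n : ℝ) * (∫ x, κ x) ^ n := by
    simp_rw [hprod]
    rw [integral_const_mul, Measure.integral_comp_smul volume
      (fun z : Fin n → ℝ => ∏ i, κ (z i)), abs_of_pos (by positivity),
      integral_fintype_prod_volume_eq_prod]
    simp only [Module.finrank_fintype_fun_eq_card, Fintype.card_fin, Finset.prod_const,
      Finset.card_univ, Complex.real_smul]
    rw [← mul_assoc, ← Complex.ofReal_mul]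
    congr 2
    field_simp
    ring
  have hJm : Integrable (fun y : Fin n → ℝ => (∏ i, k (y i)) * J y) := by
    refine hkint.mul_bdd (c := b * ∫ x, ‖Ψ (x - 1 / h)‖) ?_ (Eventually.of_forall fun y => ?_)
    · have : StronglyMeasurable (Function.uncurry fun (y : Fin n → ℝ) (x : ℝ) =>
          N (h ^ 2 * (x ^ 2 + ∑ i, y i ^ 2)) * Ψ (x - 1 / h)) := by
        refine Measurable.stronglyMeasurable ?_
        refine Measurable.mul (hNm.comp ?_) (Ψ.continuous.measurable.comp ?_) <;> fun_prop
      exact this.integral_prod_right.aestronglyMeasurable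
    · rw [← integral_const_mul]
      refine norm_integral_le_of_norm_le (hΨ.norm.const_mul b) (Eventually.of_forall fun x => ?_)
      rw [norm_mul]
      gcongr
      exact hNb _
  have hdiff : ‖(∫ y : Fin n → ℝ, (∏ i, k (y i)) * J y) - c₀ * ∫ y : Fin n → ℝ, ∏ i, k (y i)‖ ≤
      δ ^ n * ((∫ y : Fin n → ℝ, ‖∏ i, κ (y i)‖ * (I₁ + I₂ * ∑ i, y i ^ 2)) * b * (h / δ ^ 2)) := by
    rw [← integral_const_mul, ← integral_sub hJm (hkint.const_mul _)]
    set W : (Fin n → ℝ) → ℝ := fun y => ‖∏ i, κ (y i)‖ * (I₁ + I₂ * ∑ i, y i ^ 2) with hW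
    have hWint : Integrable W := integrable_prod_mul_sum_sq κ I₁ I₂
    have hWδ : Integrable (fun y : Fin n → ℝ => W (δ • y)) := hWint.comp_smul hδ.ne'
    have := norm_integral_le_of_norm_le (hWδ.const_mul ((δ ^ 2) ^ n * (b * (h / δ ^ 2))))
      (f := fun y => (∏ i, k (y i)) * J y - c₀ * ∏ i, k (y i)) (Eventually.of_forall fun y => ?_)
    · refine this.trans_eq ?_
      rw [integral_const_mul, integral_prod_scaled hδ]
      field_simp
      ring
    · rw [mul_comm c₀, ← mul_sub, norm_mul, hprod, norm_mul, Complex.norm_real,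
        Real.norm_of_nonneg (by positivity)]
      simp only [hW, Pi.smul_apply, smul_eq_mul]
      -- Rescaling `y` to `δ y` costs `δ⁻²` on the quadratic term; `δ ≤ 1` lets the constant term
      -- absorb the same factor.
      have h1 : b * h * (I₁ + I₂ * ∑ i, y i ^ 2) ≤
          b * (h / δ ^ 2) * (I₁ + I₂ * ∑ i, (δ * y i) ^ 2) := by
        have h2 : ∑ i, (δ * y i) ^ 2 = δ ^ 2 * ∑ i, y i ^ 2 := by
          simp_rw [mul_pow]
          rw [Finset.mul_sum]
        rw [h2]
        have h3 : I₁ ≤ I₁ / δ ^ 2 := le_div_self hI₁0 (by positivity) (pow_le_one₀ hδ.le hδ1)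
        calc b * h * (I₁ + I₂ * ∑ i, y i ^ 2) ≤ b * h * (I₁ / δ ^ 2 + I₂ * ∑ i, y i ^ 2) := by
              gcongr
          _ = _ := by
              field_simp
      calc _ ≤ (δ ^ 2) ^ n * ‖∏ i, κ (δ * y i)‖ * (b * h * (I₁ + I₂ * ∑ i, y i ^ 2)) := by
            gcongr
            exact hJc y
        _ ≤ (δ ^ 2) ^ n * ‖∏ i, κ (δ * y i)‖ *
            (b * (h / δ ^ 2) * (I₁ + I₂ * ∑ i, (δ * y i) ^ 2)) := by gcongr
        _ = _ := by ring
  have hc : δ ^ n * (‖c₀‖ * ‖∫ x, κ x‖ ^ n) = ‖c₀ * ∫ y : Fin n → ℝ, ∏ i, k (y i)‖ := by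
    rw [hmain, norm_mul, norm_mul, norm_pow, Complex.norm_real, Real.norm_of_nonneg hδn.le]
    ring
  have hfin := norm_le_norm_add_norm_sub' (c₀ * ∫ y : Fin n → ℝ, ∏ i, k (y i))
    (∫ y : Fin n → ℝ, (∏ i, k (y i)) * J y)
  rw [← hc] at hfin
  rw [norm_sub_rev] at hdiff
  have : ‖c₀‖ * ‖∫ x, κ x‖ ^ n = (δ ^ n)⁻¹ * (δ ^ n * (‖c₀‖ * ‖∫ x, κ x‖ ^ n)) := by
    field_simp
  rw [this]
  calc _ ≤ (δ ^ n)⁻¹ * (‖∫ y : Fin n → ℝ, (∏ i, k (y i)) * J y‖ + δ ^ n *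
        ((∫ y : Fin n → ℝ, ‖∏ i, κ (y i)‖ * (I₁ + I₂ * ∑ i, y i ^ 2)) * b * (h / δ ^ 2))) := by
        gcongr
        exact hfin.trans (by gcongr)
    _ = _ := by
        rw [mul_add, inv_mul_cancel_left₀ hδn.ne']

end Splitting

/-! ### Wave packets adapted to tubes. -/

section WavePacket

open Filter Topology

/-- The factors of a wave packet of frequency `ν` in the first variable, with profile `B` in the
first variable and `Θ(· / δ)` in the other ones. -/
noncomputable def packetFactor {d : ℕ} [NeZero d] (ν δ : ℝ) (B Θ : ℝ → ℂ) (i : Fin d) : ℝ → ℂ :=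
  if i = 0 then fun t => (Real.fourierChar (ν * t) : ℂ) * B t else fun t => Θ (δ⁻¹ • t)

theorem hasCompactSupport_packetFactor {d : ℕ} [NeZero d] (ν : ℝ) {δ : ℝ} (hδ : 0 < δ)
    {B Θ : ℝ → ℂ} (hB : HasCompactSupport B) (hΘ : HasCompactSupport Θ) (i : Fin d) :
    HasCompactSupport (packetFactor ν δ B Θ i) := by
  unfold packetFactor
  split_ifs
  · exact hB.mul_left
  · exact hΘ.comp_smul (inv_ne_zero hδ.ne')

theorem contDiff_packetFactor {d : ℕ} [NeZero d] (ν δ : ℝ) (B Θ : 𝓢(ℝ, ℂ)) (i : Fin d) :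
    ContDiff ℝ ((⊤ : ℕ∞) : WithTop ℕ∞) (packetFactor ν δ B Θ i) := by
  unfold packetFactor
  split_ifs
  · refine ContDiff.mul ?_ (B.smooth _)
    simp_rw [Real.fourierChar_apply]
    exact ((Complex.ofRealCLM.contDiff.comp (by fun_prop :
      ContDiff ℝ _ fun t : ℝ => 2 * Real.pi * (ν * t))).mul contDiff_const).cexp
  · exact (Θ.smooth _).comp (by fun_prop)

/-- The wave packet, as a Schwartz function. -/
noncomputable def packet (d : ℕ) [NeZero d] (ν : ℝ) {δ : ℝ} (hδ : 0 < δ) (B Θ : 𝓢(ℝ, ℂ))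
    (hB : HasCompactSupport B) (hΘ : HasCompactSupport Θ) : 𝓢(EuclideanSpace ℝ (Fin d), ℂ) :=
  tensorSchwartz (packetFactor ν δ B Θ) (hasCompactSupport_packetFactor ν hδ hB hΘ)
    (contDiff_packetFactor ν δ B Θ)

section

variable {d : ℕ} [NeZero d] {ν δ : ℝ} {hδ : 0 < δ} {B Θ : 𝓢(ℝ, ℂ)}
  {hB : HasCompactSupport B} {hΘ : HasCompactSupport Θ}

theorem norm_packet_le_one (hB1 : ∀ t, ‖B t‖ ≤ 1) (hΘ1 : ∀ t, ‖Θ t‖ ≤ 1)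
    (x : EuclideanSpace ℝ (Fin d)) : ‖packet d ν hδ B Θ hB hΘ x‖ ≤ 1 := by
  rw [packet, tensorSchwartz_apply, norm_prod]
  refine Finset.prod_le_one (fun _ _ => norm_nonneg _) fun i _ => ?_
  unfold packetFactor
  split_ifs
  · rw [norm_mul, Circle.norm_coe, one_mul]
    exact hB1 _
  · exact hΘ1 _

/-- The radius `1 / d` places a cube inside the round cross section: `(d - 1) (δ / d)² < δ²`. -/
theorem support_packet_subset {a b : ℝ} (hBs : Function.support B ⊆ Icc a b)
    (hΘs : ∀ t, Θ t ≠ 0 → |t| < 1 / d) :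
    Function.support (packet d ν hδ B Θ hB hΘ) ⊆ modelTube d a b δ := by
  intro x hx
  rw [Function.mem_support, packet, tensorSchwartz_apply, Finset.prod_ne_zero_iff] at hx
  constructor
  · have := hx 0 (Finset.mem_univ _)
    rw [packetFactor, if_pos rfl] at this
    exact hBs (right_ne_zero_of_mul this)
  · have hd : (0 : ℝ) < d := by exact_mod_cast Nat.pos_of_ne_zero (NeZero.ne d)
    have hi : ∀ i ∈ Finset.univ.erase (0 : Fin d), (x i) ^ 2 ≤ (δ / d) ^ 2 := by
      intro i hi
      have := hx i (Finset.mem_univ _)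
      rw [packetFactor, if_neg (Finset.ne_of_mem_erase hi)] at this
      have h1 := hΘs _ this
      rw [smul_eq_mul, abs_mul, abs_of_pos (inv_pos.2 hδ), inv_mul_lt_iff₀ hδ] at h1
      rw [← sq_abs]
      have h2 : |x i| ≤ δ / d := by
        rw [div_eq_mul_one_div]
        exact h1.le
      gcongr
    rw [Real.sqrt_lt' hδ]
    refine (Finset.sum_le_card_nsmul _ _ _ hi).trans_lt ?_
    rw [Finset.card_erase_of_mem (Finset.mem_univ _), Finset.card_univ, Fintype.card_fin,
      nsmul_eq_mul, Nat.cast_sub (Nat.one_le_iff_ne_zero.2 (NeZero.ne d))]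
    have h3 : (1 : ℝ) ≤ d := by exact_mod_cast Nat.one_le_iff_ne_zero.2 (NeZero.ne d)
    have h4 : ((d : ℝ) - (1 : ℕ)) * (δ / d) ^ 2 = δ ^ 2 * (((d : ℝ) - 1) / d ^ 2) := by
      push_cast
      field_simp
    rw [h4]
    refine mul_lt_of_lt_one_right (by positivity) ?_
    rw [div_lt_one (by positivity)]
    nlinarith

end

theorem fourier_dilate_real {δ : ℝ} (hδ : 0 < δ) (Θ : ℝ → ℂ) (ξ : ℝ) :
    𝓕 (fun t => Θ (δ⁻¹ • t)) ξ = δ * 𝓕 Θ (δ * ξ) := by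
  rw [fourier_comp_smul (inv_ne_zero hδ.ne')]
  simp [abs_of_pos hδ]

theorem fourierInv_dilate_real {δ : ℝ} (hδ : 0 < δ) (Θ : ℝ → ℂ) (ξ : ℝ) :
    𝓕⁻ (fun t => Θ (δ⁻¹ • t)) ξ = δ * 𝓕⁻ Θ (δ * ξ) := by
  rw [fourierInv_comp_smul (inv_ne_zero hδ.ne')]
  simp [abs_of_pos hδ]

theorem fourier_packet {n : ℕ} [NeZero (n + 1)] {ν δ : ℝ} (hδ : 0 < δ) {B Θ : 𝓢(ℝ, ℂ)}
    (hB : HasCompactSupport B) (hΘ : HasCompactSupport Θ) (ξ : EuclideanSpace ℝ (Fin (n + 1))) :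
    𝓕 (packet (n + 1) ν hδ B Θ hB hΘ) ξ =
      𝓕 B (ξ 0 - ν) * ∏ i : Fin n, (δ * 𝓕 Θ (δ * ξ i.succ)) := by
  rw [fourier_coe]
  refine (fourier_prod_apply _ ξ).trans ?_
  rw [Fin.prod_univ_succ]
  congr 1
  · exact fourier_modulate _ _ _
  · refine Finset.prod_congr rfl fun i _ => ?_
    rw [packetFactor, if_neg (Fin.succ_ne_zero i), fourier_dilate_real hδ]
    rfl

theorem fourierInv_packet {n : ℕ} [NeZero (n + 1)] {ν δ : ℝ} (hδ : 0 < δ) {B Θ : 𝓢(ℝ, ℂ)}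
    (hB : HasCompactSupport B) (hΘ : HasCompactSupport Θ) (ξ : EuclideanSpace ℝ (Fin (n + 1))) :
    𝓕⁻ (packet (n + 1) (-ν) hδ B Θ hB hΘ) ξ =
      𝓕⁻ B (ξ 0 - ν) * ∏ i : Fin n, (δ * 𝓕⁻ Θ (δ * ξ i.succ)) := by
  rw [fourierInv_coe]
  refine (fourierInv_prod_apply _ ξ).trans ?_
  rw [Fin.prod_univ_succ]
  congr 1
  · rw [fourierInv_coe]
    exact fourierInv_modulate _ _ _
  · refine Finset.prod_congr rfl fun i _ => ?_
    rw [packetFactor, if_neg (Fin.succ_ne_zero i), fourierInv_dilate_real hδ, fourierInv_coe]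

theorem norm_pairing_le_kakeyaFun_of_or {d : ℕ} [NeZero d] {p q : ℝ≥0∞}
    [hpq : p.HolderConjugate q] {A : ℝ≥0}
    {m : EuclideanSpace ℝ (Fin d) → ℂ} (hm : AEStronglyMeasurable m volume) {b : ℝ}
    (hb : ∀ ξ, ‖m ξ‖ ≤ b) (hrad : ∀ ξ η, ‖ξ‖ = ‖η‖ → m ξ = m η) (h : PairingBound p q A m)
    {δ : ℝ} (hδ : 0 < δ)
    (f g : 𝓢(EuclideanSpace ℝ (Fin d), ℂ)) (hf1 : ∀ x, ‖f x‖ ≤ 1) (hg1 : ∀ x, ‖g x‖ ≤ 1)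
    (hfg : (Function.support f ⊆ modelTube d 0 1 δ ∧ Function.support g ⊆ modelTube d 2 3 δ) ∨
      (Function.support g ⊆ modelTube d 0 1 δ ∧ Function.support f ⊆ modelTube d 2 3 δ)) :
    ‖∫ ξ, m ξ * ((𝓕 f) ξ * (𝓕⁻ g) ξ)‖ ≤
      A * (2 * δ) ^ (d - 1) * kakeyaFun d δ ^ |(p⁻¹).toReal - 1 / 2| := by
  have hf0 : 0 ≤ kakeyaFun d δ := Real.sInf_nonneg fun x hx => hx.1.le
  have hvol : volume.real (modelTube d 0 1 δ) ≤ (2 * δ) ^ (d - 1) :=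
    ENNReal.toReal_le_of_le_ofReal (by positivity) (volume_modelTube_le hδ.le)
  have main : A * volume.real (modelTube d 0 1 δ) * kakeyaFun d δ ^ |(p⁻¹).toReal - 1 / 2| ≤
      A * (2 * δ) ^ (d - 1) * kakeyaFun d δ ^ |(p⁻¹).toReal - 1 / 2| := by
    gcongr
  rcases hfg with ⟨hf, hg⟩ | ⟨hg, hf⟩
  · exact (norm_pairing_le_kakeyaFun hm hb hrad h hδ f g hf1 hg1 hf hg).trans main
  · have e := integral_even_symbol (m := m) (fun ξ => hrad _ _ (norm_neg ξ)) f g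
    have := (norm_pairing_le_kakeyaFun hm hb hrad h hδ g f hg1 hf1 hg hf).trans main
    simp only [fourier_coe, fourierInv_coe] at this ⊢
    rwa [e]

/-- The average of a radial multiplier at scale `h` against the product of the Fourier transforms
of two bumps supported in `[0, 1]` and `[2, 3]` is controlled by the Kakeya function. -/
theorem exists_norm_average_le (d : ℕ) [NeZero d] (B₁ B₂ Θ : 𝓢(ℝ, ℂ))
    (hB₁ : HasCompactSupport B₁) (hB₂ : HasCompactSupport B₂) (hΘ : HasCompactSupport Θ)
    (hB₁1 : ∀ t, ‖B₁ t‖ ≤ 1) (hB₂1 : ∀ t, ‖B₂ t‖ ≤ 1) (hΘ1 : ∀ t, ‖Θ t‖ ≤ 1)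
    (hB : (Function.support B₁ ⊆ Icc 0 1 ∧ Function.support B₂ ⊆ Icc 2 3) ∨
      (Function.support B₂ ⊆ Icc 0 1 ∧ Function.support B₁ ⊆ Icc 2 3))
    (hΘs : ∀ t, Θ t ≠ 0 → |t| < 1 / d) (hΘ0 : ∫ t, Θ t * Θ t ≠ 0) :
    ∃ C : ℝ≥0, ∀ (p q : ℝ≥0∞), p.HolderConjugate q → ∀ (A : ℝ≥0) (φ : ℝ → ℂ) (b : ℝ),
      Continuous φ → (∀ s, ‖φ s‖ ≤ b) →
      PairingBound p q A (fun ξ : EuclideanSpace ℝ (Fin d) => φ (Real.log ‖ξ‖)) →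
      ∀ s h δ : ℝ, 0 < h → 0 < δ → δ ≤ 1 →
      ‖∫ x, φ (Real.log (Real.exp s * |1 + h * x|)) * ((𝓕 B₁) x * (𝓕⁻ B₂) x)‖ ≤
        C * (A * kakeyaFun d δ ^ |(p⁻¹).toReal - 1 / 2| + b * (h / δ ^ 2)) := by
  obtain ⟨n, rfl⟩ : ∃ n, d = n + 1 := Nat.exists_eq_succ_of_ne_zero (NeZero.ne d)
  set Ψ : 𝓢(ℝ, ℂ) := pairing (ContinuousLinearMap.mul ℂ ℂ) (𝓕 B₁) (𝓕⁻ B₂) with hΨ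
  set κ : 𝓢(ℝ, ℂ) := pairing (ContinuousLinearMap.mul ℂ ℂ) (𝓕 Θ) (𝓕⁻ Θ) with hκ
  have hΨa : ∀ x, Ψ x = (𝓕 B₁) x * (𝓕⁻ B₂) x := fun x => by simp [hΨ]
  have hκa : ∀ x, κ x = (𝓕 Θ) x * (𝓕⁻ Θ) x := fun x => by simp [hκ]
  -- By Parseval this integral is `∫ Θ²`.
  have hκ0 : 0 < ‖∫ x, κ x‖ := by
    rw [norm_pos_iff]
    simp_rw [hκa]
    rwa [integral_fourier_mul_eq, fourier_fourierInv_eq]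
  obtain ⟨C, hC0, hC⟩ := exists_norm_integral_le_of_split n Ψ κ
  refine ⟨((2 ^ n + C) / ‖∫ x, κ x‖ ^ n).toNNReal, ?_⟩
  intro p q hpq A φ b hφ hφb h s hh δ hh0 hδ hδ1
  have hb : 0 ≤ b := (norm_nonneg _).trans (hφb 0)
  rw [Real.coe_toNNReal _ (by positivity)]
  set N : ℝ → ℂ := fun v => φ (Real.log (Real.exp s * √v)) with hN
  have hNm : Measurable N := by
    refine hφ.measurable.comp (Real.measurable_log.comp ?_)
    fun_prop
  have hNc : ∀ v, 0 < v → ContinuousAt N v := by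
    intro v hv
    refine hφ.continuousAt.comp (ContinuousAt.log ?_ ?_)
    · fun_prop
    · have := Real.sqrt_pos.2 hv
      positivity
  have hNeq : ∀ x, N ((1 + hh * x) ^ 2) * Ψ x =
      φ (Real.log (Real.exp s * |1 + hh * x|)) * ((𝓕 B₁) x * (𝓕⁻ B₂) x) := by
    intro x
    simp only [hN, Real.sqrt_sq_eq_abs, hΨa]
  have key := hC N b hNm (fun v => hφb _) hNc hh δ hh0 hδ hδ1
  simp_rw [hNeq] at key
  set m : EuclideanSpace ℝ (Fin (n + 1)) → ℂ := fun ξ => N (hh ^ 2 * ‖ξ‖ ^ 2) with hm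
  -- A dilation brings frequency `1 / h` to radius `e^s` without changing the constant `A`.
  have hmeq : m = fun ξ => φ (Real.log ‖(Real.exp s * hh) • ξ‖) := by
    funext ξ
    simp only [hm, hN]
    rw [← mul_pow, Real.sqrt_sq (by positivity), norm_smul,
      Real.norm_of_nonneg (by positivity), mul_assoc]
  have hPB : PairingBound p q A m := by
    rw [hmeq]
    exact h.comp_smul (by positivity)
  have hmm : AEStronglyMeasurable m volume :=
    (hNm.comp (by fun_prop)).aestronglyMeasurable
  set f := packet (n + 1) (1 / hh) hδ B₁ Θ hB₁ hΘ with hf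
  set g := packet (n + 1) (-(1 / hh)) hδ B₂ Θ hB₂ hΘ with hg
  have hkak := norm_pairing_le_kakeyaFun_of_or hmm (fun ξ => hφb _)
    (fun ξ η hξη => by simp only [hm, hξη]) hPB hδ f g
    (norm_packet_le_one hB₁1 hΘ1) (norm_packet_le_one hB₂1 hΘ1)
    (hB.imp (fun hB => ⟨support_packet_subset hB.1 hΘs, support_packet_subset hB.2 hΘs⟩)
      (fun hB => ⟨support_packet_subset hB.1 hΘs, support_packet_subset hB.2 hΘs⟩))
  have hIeq : ∫ ξ : EuclideanSpace ℝ (Fin (n + 1)), N (hh ^ 2 * ‖ξ‖ ^ 2) *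
      (Ψ (ξ 0 - 1 / hh) * ∏ i : Fin n, ((δ ^ 2 : ℝ) * κ (δ * ξ i.succ))) =
      ∫ ξ, m ξ * ((𝓕 f) ξ * (𝓕⁻ g) ξ) := by
    refine integral_congr_ae (Eventually.of_forall fun ξ => ?_)
    simp only [hf, hg, fourier_packet, fourierInv_packet, hΨa, hκa]
    congr 1
    rw [mul_mul_mul_comm, ← Finset.prod_mul_distrib]
    congr 1
    refine Finset.prod_congr rfl fun i _ => ?_
    push_cast
    ring
  rw [hIeq] at key
  have hκn : 0 < ‖∫ x, κ x‖ ^ n := by positivity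
  rw [div_mul_eq_mul_div, le_div_iff₀ hκn]
  refine key.trans ?_
  have hf0 : 0 ≤ kakeyaFun (n + 1) δ := Real.sInf_nonneg fun x hx => hx.1.le
  set K := kakeyaFun (n + 1) δ ^ |(p⁻¹).toReal - 1 / 2| with hK
  have hK0 : 0 ≤ K := Real.rpow_nonneg hf0 _
  -- The normalization `δ⁻ⁿ` cancels the volume bound `(2δ)ⁿ` of the tube.
  have h1 : (δ ^ n)⁻¹ * ‖∫ ξ, m ξ * ((𝓕 f) ξ * (𝓕⁻ g) ξ)‖ ≤ 2 ^ n * (A * K) := by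
    rw [inv_mul_le_iff₀ (by positivity)]
    refine hkak.trans_eq ?_
    simp only [Nat.add_sub_cancel, mul_pow]
    ring
  have h2 : 0 ≤ C * (A * K) := by positivity
  have h3 : 0 ≤ 2 ^ n * (b * (hh / δ ^ 2)) := by positivity
  calc _ ≤ 2 ^ n * (A * K) + C * b * (hh / δ ^ 2) := by gcongr
    _ ≤ _ := by
      rw [add_mul, mul_add, mul_add]
      linarith

end WavePacket

/-! ### An averaging kernel whose scale derivative is controlled. -/

section AveragingKernel

open Filter Topology

/-- A bump function as a complex valued Schwartz function. -/
noncomputable def bumpSchwartz {c : ℝ} (β : ContDiffBump c) : 𝓢(ℝ, ℂ) :=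
  HasCompactSupport.toSchwartzMap (f := fun t => ((β t : ℝ) : ℂ))
    (β.hasCompactSupport.comp_left (g := Complex.ofReal) rfl)
    (Complex.ofRealCLM.contDiff.comp β.contDiff)

theorem bumpSchwartz_apply {c : ℝ} (β : ContDiffBump c) (t : ℝ) :
    bumpSchwartz β t = (β t : ℝ) := rfl

theorem bumpSchwartz_ne_zero {c : ℝ} (β : ContDiffBump c) {t : ℝ} (h : bumpSchwartz β t ≠ 0) :
    |t - c| < β.rOut := by
  have : t ∈ Function.support β := by
    rw [bumpSchwartz_apply] at h
    exact_mod_cast h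
  rw [β.support_eq] at this
  rwa [Metric.mem_ball, Real.dist_eq] at this

theorem hasCompactSupport_of_subset_Icc {B : ℝ → ℂ} {a b : ℝ}
    (h : Function.support B ⊆ Icc a b) : HasCompactSupport B :=
  HasCompactSupport.intro isCompact_Icc fun x hx => by
    by_contra h0
    exact hx (h h0)

/-- The averages of the radial multipliers on `ℝ^d` against the kernel `Ξ` are controlled by the
Kakeya function. -/
def KakeyaControlled (d : ℕ) [NeZero d] (Ξ : 𝓢(ℝ, ℂ)) : Prop :=
  ∃ C : ℝ≥0, ∀ (p q : ℝ≥0∞), p.HolderConjugate q → ∀ (A : ℝ≥0) (φ : ℝ → ℂ) (b : ℝ),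
    Continuous φ → (∀ s, ‖φ s‖ ≤ b) →
    PairingBound p q A (fun ξ : EuclideanSpace ℝ (Fin d) => φ (Real.log ‖ξ‖)) →
    ∀ s h δ : ℝ, 0 < h → 0 < δ → δ ≤ 1 →
    ‖∫ x, φ (Real.log (Real.exp s * |1 + h * x|)) * Ξ x‖ ≤
      C * (A * kakeyaFun d δ ^ |(p⁻¹).toReal - 1 / 2| + b * (h / δ ^ 2))

variable {d : ℕ} [NeZero d]

theorem kakeyaFun_nonneg (δ : ℝ) : 0 ≤ kakeyaFun d δ :=
  Real.sInf_nonneg fun _ hx => hx.1.le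

theorem integrable_average {φ : ℝ → ℂ} (hφ : Continuous φ) {b : ℝ} (hb : ∀ s, ‖φ s‖ ≤ b)
    (r h : ℝ) {Ξ : ℝ → ℂ} (hΞ : Integrable Ξ) :
    Integrable (fun x => φ (Real.log (r * |1 + h * x|)) * Ξ x) := by
  refine hΞ.bdd_mul ?_ (Eventually.of_forall fun x => hb _)
  refine (hφ.measurable.comp (Real.measurable_log.comp ?_)).aestronglyMeasurable
  fun_prop

theorem KakeyaControlled.add {Ξ Ξ' : 𝓢(ℝ, ℂ)} (h : KakeyaControlled d Ξ)
    (h' : KakeyaControlled d Ξ') : KakeyaControlled d (Ξ + Ξ') := by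
  obtain ⟨C, hC⟩ := h
  obtain ⟨C', hC'⟩ := h'
  refine ⟨C + C', fun p q hpq A φ b hφ hb hP s h δ hh hδ hδ1 => ?_⟩
  have e : ∫ x, φ (Real.log (Real.exp s * |1 + h * x|)) * (Ξ + Ξ') x =
      (∫ x, φ (Real.log (Real.exp s * |1 + h * x|)) * Ξ x) +
        ∫ x, φ (Real.log (Real.exp s * |1 + h * x|)) * Ξ' x := by
    rw [← integral_add (integrable_average hφ hb _ _ Ξ.integrable)
      (integrable_average hφ hb _ _ Ξ'.integrable)]
    refine integral_congr_ae (Eventually.of_forall fun x => ?_)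
    simp only [add_apply]
    ring
  rw [e, NNReal.coe_add, add_mul]
  exact (norm_add_le _ _).trans (add_le_add (hC p q hpq A φ b hφ hb hP s h δ hh hδ hδ1)
    (hC' p q hpq A φ b hφ hb hP s h δ hh hδ hδ1))

theorem KakeyaControlled.smul {Ξ : 𝓢(ℝ, ℂ)} (h : KakeyaControlled d Ξ) (c : ℂ) :
    KakeyaControlled d (c • Ξ) := by
  obtain ⟨C, hC⟩ := h
  refine ⟨‖c‖₊ * C, fun p q hpq A φ b hφ hb hP s h δ hh hδ hδ1 => ?_⟩
  have e : ∫ x, φ (Real.log (Real.exp s * |1 + h * x|)) * (c • Ξ) x =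
      c * ∫ x, φ (Real.log (Real.exp s * |1 + h * x|)) * Ξ x := by
    rw [← integral_const_mul]
    refine integral_congr_ae (Eventually.of_forall fun x => ?_)
    simp only [smul_apply, smul_eq_mul]
    ring
  rw [e, norm_mul, NNReal.coe_mul, mul_assoc, coe_nnnorm]
  exact mul_le_mul_of_nonneg_left (hC p q hpq A φ b hφ hb hP s h δ hh hδ hδ1) (norm_nonneg _)

theorem exists_pos_norm_smul_le_one (B : 𝓢(ℝ, ℂ)) :
    ∃ c : ℝ, 0 < c ∧ ∀ t, ‖((c : ℂ) • B) t‖ ≤ 1 := by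
  set M := SchwartzMap.seminorm ℝ 0 0 B with hM
  have hM0 : 0 ≤ M := apply_nonneg _ _
  refine ⟨(M + 1)⁻¹, by positivity, fun t => ?_⟩
  rw [smul_apply, norm_smul, Complex.norm_real, Real.norm_of_nonneg (by positivity),
    inv_mul_le_iff₀ (by positivity)]
  linarith [B.norm_le_seminorm ℝ t]

/-- Packets must be bounded by `1`, so the profiles are normalized first; bilinearity restores the
scalars. -/
theorem kakeyaControlled_fourier_mul_fourierInv (B₁ B₂ : 𝓢(ℝ, ℂ))
    (hB : (Function.support B₁ ⊆ Icc 0 1 ∧ Function.support B₂ ⊆ Icc 2 3) ∨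
      (Function.support B₂ ⊆ Icc 0 1 ∧ Function.support B₁ ⊆ Icc 2 3)) :
    KakeyaControlled d (pairing (ContinuousLinearMap.mul ℂ ℂ) (𝓕 B₁) (𝓕⁻ B₂)) := by
  obtain ⟨c₁, hc₁, hn₁⟩ := exists_pos_norm_smul_le_one B₁
  obtain ⟨c₂, hc₂, hn₂⟩ := exists_pos_norm_smul_le_one B₂
  have hs : ∀ (c : ℝ) (B : 𝓢(ℝ, ℂ)), Function.support ((c : ℂ) • B : 𝓢(ℝ, ℂ)) ⊆
      Function.support B := by
    intro c B t ht h0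
    apply ht
    rw [smul_apply, h0, smul_zero]
  have hB' : (Function.support ((c₁ : ℂ) • B₁ : 𝓢(ℝ, ℂ)) ⊆ Icc 0 1 ∧
      Function.support ((c₂ : ℂ) • B₂ : 𝓢(ℝ, ℂ)) ⊆ Icc 2 3) ∨
      (Function.support ((c₂ : ℂ) • B₂ : 𝓢(ℝ, ℂ)) ⊆ Icc 0 1 ∧
      Function.support ((c₁ : ℂ) • B₁ : 𝓢(ℝ, ℂ)) ⊆ Icc 2 3) :=
    hB.imp (fun h => ⟨(hs _ _).trans h.1, (hs _ _).trans h.2⟩)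
      (fun h => ⟨(hs _ _).trans h.1, (hs _ _).trans h.2⟩)
  have hd : (0 : ℝ) < d := by exact_mod_cast Nat.pos_of_ne_zero (NeZero.ne d)
  let θ : ContDiffBump (0 : ℝ) := ⟨1 / (2 * d), 1 / d, by positivity, by
    rw [div_lt_div_iff₀ (by positivity) hd]; linarith⟩
  have hθ : ∀ t, bumpSchwartz θ t ≠ 0 → |t| < 1 / d := fun t ht => by
    simpa [θ] using bumpSchwartz_ne_zero θ ht
  have hθ1 : ∀ t, ‖bumpSchwartz θ t‖ ≤ 1 := fun t => by
    rw [bumpSchwartz_apply, Complex.norm_real, Real.norm_of_nonneg θ.nonneg]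
    exact θ.le_one
  have hθ0 : ∫ t, bumpSchwartz θ t * bumpSchwartz θ t ≠ 0 := by
    simp_rw [bumpSchwartz_apply, ← Complex.ofReal_mul]
    rw [integral_complex_ofReal]
    refine Complex.ofReal_ne_zero.2 (ne_of_gt ?_)
    refine Continuous.integral_pos_of_hasCompactSupport_nonneg_nonzero (x := 0)
      (θ.continuous.mul θ.continuous) θ.hasCompactSupport.mul_left
      (fun t => mul_self_nonneg _) ?_
    have : θ 0 = 1 := θ.one_of_mem_closedBall (Metric.mem_closedBall_self θ.rIn_pos.le)
    simp [this]
  have hcs : HasCompactSupport ((c₁ : ℂ) • B₁ : 𝓢(ℝ, ℂ)) ∧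
      HasCompactSupport ((c₂ : ℂ) • B₂ : 𝓢(ℝ, ℂ)) := by
    rcases hB' with h | h
    · exact ⟨hasCompactSupport_of_subset_Icc h.1, hasCompactSupport_of_subset_Icc h.2⟩
    · exact ⟨hasCompactSupport_of_subset_Icc h.2, hasCompactSupport_of_subset_Icc h.1⟩
  have key : KakeyaControlled d (pairing (ContinuousLinearMap.mul ℂ ℂ)
      (𝓕 ((c₁ : ℂ) • B₁)) (𝓕⁻ ((c₂ : ℂ) • B₂))) := by
    obtain ⟨C, hC⟩ := exists_norm_average_le d ((c₁ : ℂ) • B₁) ((c₂ : ℂ) • B₂) (bumpSchwartz θ)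
      hcs.1 hcs.2 (θ.hasCompactSupport.comp_left (g := Complex.ofReal) rfl) hn₁ hn₂ hθ1 hB' hθ hθ0
    refine ⟨C, fun p q hpq A φ b hφ hb hP s h δ hh hδ hδ1 => ?_⟩
    simpa only [pairing_apply_apply, ContinuousLinearMap.mul_apply'] using
      hC p q hpq A φ b hφ hb hP s h δ hh hδ hδ1
  have e := key.smul ((c₁ : ℂ)⁻¹ * (c₂ : ℂ)⁻¹)
  convert e using 1
  ext x
  have h1 : (c₁ : ℂ) ≠ 0 := by exact_mod_cast hc₁.ne'
  have h2 : (c₂ : ℂ) ≠ 0 := by exact_mod_cast hc₂.ne'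
  simp only [pairing_apply_apply, ContinuousLinearMap.mul_apply', smul_apply, smul_eq_mul,
    FourierTransform.fourier_smul, FourierTransform.fourierInv_smul]
  field_simp

/-- The reflection of a Schwartz function. -/
noncomputable def reflectSchwartz (W : 𝓢(ℝ, ℂ)) : 𝓢(ℝ, ℂ) :=
  compCLMOfContinuousLinearEquiv ℂ (ContinuousLinearEquiv.neg ℝ) W

theorem reflectSchwartz_apply (W : 𝓢(ℝ, ℂ)) (t : ℝ) : reflectSchwartz W t = W (-t) := by
  simp [reflectSchwartz]

/-- Opposite translations produce cancelling modulations, so only the relative position of the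
supports matters; the reflection turns `𝓕` into `𝓕⁻`. -/
theorem fourier_translate_mul (U W : 𝓢(ℝ, ℂ)) (τ x : ℝ) :
    (𝓕 (compSubConstCLM ℂ τ U)) x * (𝓕⁻ (reflectSchwartz (compSubConstCLM ℂ (-τ) W))) x =
      (𝓕 U) x * (𝓕 W) x := by
  have e1 : (compSubConstCLM ℂ τ U : ℝ → ℂ) = fun t => U (t - τ) := by ext; simp
  have e2 : (fun t => reflectSchwartz (compSubConstCLM ℂ (-τ) W) (-t)) = fun t => W (t - -τ) := by
    ext; simp [reflectSchwartz_apply]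
  rw [fourierInv_coe, Real.fourierInv_eq_fourier_comp_neg, e2, fourier_coe, e1, fourier_comp_sub,
    fourier_comp_sub, smul_mul_smul_comm, ← AddChar.map_add_eq_mul, fourier_coe, fourier_coe]
  simp

/-- Cut `W` into its parts near `2` and `-2`. For each part, a translation by `1/2` and a reflection
bring the supports to `[0, 1]` and `[2, 3]`, in one order or the other. -/
theorem kakeyaControlled_fourier_mul_fourier (U W : 𝓢(ℝ, ℂ))
    (hU : ∀ t, U t ≠ 0 → |t| ≤ 1 / 2) (hW : ∀ t, W t ≠ 0 → 3 / 2 ≤ |t| ∧ |t| ≤ 5 / 2) :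
    KakeyaControlled d (pairing (ContinuousLinearMap.mul ℂ ℂ) (𝓕 U) (𝓕 W)) := by
  let cp : ContDiffBump (2 : ℝ) := ⟨1 / 2, 1, by norm_num, by norm_num⟩
  let cm : ContDiffBump (-2 : ℝ) := ⟨1 / 2, 1, by norm_num, by norm_num⟩
  set Wp := pairing (ContinuousLinearMap.mul ℂ ℂ) (bumpSchwartz cp) W with hWp
  set Wm := pairing (ContinuousLinearMap.mul ℂ ℂ) (bumpSchwartz cm) W with hWm
  have hWp' : ∀ t, Wp t ≠ 0 → 3 / 2 ≤ t ∧ t ≤ 5 / 2 := by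
    intro t ht
    simp only [hWp, pairing_apply_apply, ContinuousLinearMap.mul_apply'] at ht
    have h1 := abs_lt.1 (bumpSchwartz_ne_zero cp (left_ne_zero_of_mul ht))
    have h2 := hW t (right_ne_zero_of_mul ht)
    simp only [cp] at h1
    rw [abs_of_pos (by linarith)] at h2
    exact h2
  have hWm' : ∀ t, Wm t ≠ 0 → -(5 / 2) ≤ t ∧ t ≤ -(3 / 2) := by
    intro t ht
    simp only [hWm, pairing_apply_apply, ContinuousLinearMap.mul_apply'] at ht
    have h1 := abs_lt.1 (bumpSchwartz_ne_zero cm (left_ne_zero_of_mul ht))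
    have h2 := hW t (right_ne_zero_of_mul ht)
    simp only [cm] at h1
    rw [abs_of_neg (by linarith)] at h2
    exact ⟨by linarith, by linarith⟩
  have hsum : W = Wm + Wp := by
    ext t
    simp only [hWp, hWm, add_apply, pairing_apply_apply, ContinuousLinearMap.mul_apply']
    by_cases ht : W t = 0
    · simp [ht]
    · obtain ⟨h1, h2⟩ := hW t ht
      rcases le_total 0 t with h0 | h0
      · rw [abs_of_nonneg h0] at h1 h2
        have e1 : bumpSchwartz cp t = 1 := by
          rw [bumpSchwartz_apply, cp.one_of_mem_closedBall]
          · simp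
          · rw [Metric.mem_closedBall, Real.dist_eq, abs_le]
            constructor <;> simp only [cp] <;> linarith
        have e2 : bumpSchwartz cm t = 0 := by
          by_contra h
          have := abs_lt.1 (bumpSchwartz_ne_zero cm h)
          simp only [cm] at this
          linarith
        rw [e1, e2]
        ring
      · rw [abs_of_nonpos h0] at h1 h2
        have e1 : bumpSchwartz cm t = 1 := by
          rw [bumpSchwartz_apply, cm.one_of_mem_closedBall]
          · simp
          · rw [Metric.mem_closedBall, Real.dist_eq, abs_le]
            constructor <;> simp only [cm] <;> linarith
        have e2 : bumpSchwartz cp t = 0 := by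
          by_contra h
          have := abs_lt.1 (bumpSchwartz_ne_zero cp h)
          simp only [cp] at this
          linarith
        rw [e1, e2]
        ring
  have km : KakeyaControlled d (pairing (ContinuousLinearMap.mul ℂ ℂ)
      (𝓕 (compSubConstCLM ℂ (1 / 2) U))
      (𝓕⁻ (reflectSchwartz (compSubConstCLM ℂ (-(1 / 2)) Wm)))) := by
    refine kakeyaControlled_fourier_mul_fourierInv _ _ (Or.inl ⟨fun t ht => ?_, fun t ht => ?_⟩)
    · rw [Function.mem_support, compSubConstCLM_apply] at ht
      have := abs_le.1 (hU _ ht)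
      constructor <;> linarith
    · rw [Function.mem_support, reflectSchwartz_apply, compSubConstCLM_apply] at ht
      have := hWm' _ ht
      constructor <;> linarith
  have kp : KakeyaControlled d (pairing (ContinuousLinearMap.mul ℂ ℂ)
      (𝓕 (compSubConstCLM ℂ (1 / 2) Wp))
      (𝓕⁻ (reflectSchwartz (compSubConstCLM ℂ (-(1 / 2)) U)))) := by
    refine kakeyaControlled_fourier_mul_fourierInv _ _ (Or.inr ⟨fun t ht => ?_, fun t ht => ?_⟩)
    · rw [Function.mem_support, reflectSchwartz_apply, compSubConstCLM_apply] at ht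
      have := abs_le.1 (hU _ ht)
      constructor <;> linarith
    · rw [Function.mem_support, compSubConstCLM_apply] at ht
      have := hWp' _ ht
      constructor <;> linarith
  convert km.add kp using 1
  ext x
  simp only [pairing_apply_apply, ContinuousLinearMap.mul_apply', add_apply,
    fourier_translate_mul]
  rw [hsum, FourierTransform.fourier_add, add_apply]
  ring

/-- A kernel `Φ` of nonzero integral, such that the derivative of `x Φ(x)` is controlled by the
Kakeya function. -/
theorem exists_averaging_kernel (d : ℕ) [NeZero d] :
    ∃ Φ Ξ : 𝓢(ℝ, ℂ), ∫ x, Φ x ≠ 0 ∧ (∀ x : ℝ, HasDerivAt (fun x : ℝ => (x : ℂ) * Φ x) (Ξ x) x) ∧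
      KakeyaControlled d Ξ := by
  let u : ContDiffBump (0 : ℝ) := ⟨1 / 4, 1 / 2, by norm_num, by norm_num⟩
  -- `v` equals `1` around the support of `u`, so `∫ 𝓕U 𝓕V = ∫ u > 0`, while its derivative lives on
  -- `3/2 ≤ |t| ≤ 5/2`, away from that support.
  let v : ContDiffBump (0 : ℝ) := ⟨3 / 2, 5 / 2, by norm_num, by norm_num⟩
  set U := bumpSchwartz u with hUd
  set V := bumpSchwartz v with hVd
  have hU : ∀ t, U t ≠ 0 → |t| ≤ 1 / 2 := fun t ht => by
    have := bumpSchwartz_ne_zero u ht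
    rw [sub_zero] at this
    exact this.le
  set V' := derivCLM ℂ ℂ V with hV'd
  have hV' : ∀ t, V' t ≠ 0 → 3 / 2 ≤ |t| ∧ |t| ≤ 5 / 2 := by
    intro t ht
    rw [hV'd, derivCLM_apply] at ht
    constructor
    · by_contra hlt
      push Not at hlt
      apply ht
      have : (V : ℝ → ℂ) =ᶠ[𝓝 t] fun _ => 1 := by
        filter_upwards [(isOpen_lt continuous_abs continuous_const).mem_nhds hlt] with y hy
        rw [hVd, bumpSchwartz_apply, v.one_of_mem_closedBall]
        · simp
        · rw [Metric.mem_closedBall, Real.dist_eq, sub_zero]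
          exact (show |y| < 3 / 2 from hy).le
      rw [this.deriv_eq, deriv_const]
    · by_contra hlt
      push Not at hlt
      apply ht
      have : (V : ℝ → ℂ) =ᶠ[𝓝 t] fun _ => 0 := by
        filter_upwards [(isOpen_lt continuous_const continuous_abs).mem_nhds hlt] with y hy
        by_contra h0
        have h1 := bumpSchwartz_ne_zero v h0
        rw [sub_zero] at h1
        exact absurd (show 5 / 2 < |y| from hy) (not_lt.2 h1.le)
      rw [this.deriv_eq, deriv_const]
  let X : ℝ → ℂ := fun t => -2 * Real.pi * Complex.I * t
  have hX : X.HasTemperateGrowth := by fun_prop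
  set XU := smulLeftCLM ℂ X U with hXU
  set XV := smulLeftCLM ℂ X V' with hXV
  have hXUa : ∀ t, XU t = X t • U t := fun t => smulLeftCLM_apply_apply hX U t
  have hXVa : ∀ t, XV t = X t • V' t := fun t => smulLeftCLM_apply_apply hX V' t
  have hxint : ∀ W : 𝓢(ℝ, ℂ), Integrable (fun x : ℝ => x • W x) := by
    intro W
    refine (W.integrable_pow_mul volume 1).mono'
      (continuous_id.smul W.continuous).aestronglyMeasurable (Eventually.of_forall fun x => ?_)
    simp
  have dU : ∀ x, HasDerivAt (𝓕 (U : ℝ → ℂ)) ((𝓕 XU) x) x := by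
    intro x
    have := Real.hasDerivAt_fourier U.integrable (hxint U) x
    rw [fourier_coe, show (XU : ℝ → ℂ) = fun t => X t • U t from funext hXUa]
    exact this
  have dV : ∀ x, HasDerivAt (𝓕 (V' : ℝ → ℂ)) ((𝓕 XV) x) x := by
    intro x
    have := Real.hasDerivAt_fourier V'.integrable (hxint V') x
    rw [fourier_coe, show (XV : ℝ → ℂ) = fun t => X t • V' t from funext hXVa]
    exact this
  have hc : (2 * Real.pi * Complex.I : ℂ) ≠ 0 := by simp [Real.pi_ne_zero]
  -- Multiplication by `x` replaces `V` by `V'`. Differentiating `𝓕U 𝓕V'` only multiplies `U` or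
  -- `V'` by a linear function, so the supports stay separated.
  have hxV : ∀ x : ℝ, (x : ℂ) * 𝓕 (V : ℝ → ℂ) x =
      (2 * Real.pi * Complex.I)⁻¹ * 𝓕 (V' : ℝ → ℂ) x := by
    intro x
    have h1 : (V' : ℝ → ℂ) = deriv V := by
      ext t
      rw [hV'd, derivCLM_apply]
    have := congrFun (Real.fourier_deriv V.integrable V.differentiable (h1 ▸ V'.integrable)) x
    rw [h1, this, smul_eq_mul, mul_assoc (2 * Real.pi * Complex.I : ℂ), inv_mul_cancel_left₀ hc]
  refine ⟨pairing (ContinuousLinearMap.mul ℂ ℂ) (𝓕 U) (𝓕 V),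
    (2 * Real.pi * Complex.I : ℂ)⁻¹ • (pairing (ContinuousLinearMap.mul ℂ ℂ) (𝓕 XU) (𝓕 V') +
      pairing (ContinuousLinearMap.mul ℂ ℂ) (𝓕 U) (𝓕 XV)), ?_, ?_, ?_⟩
  · simp only [pairing_apply_apply, ContinuousLinearMap.mul_apply']
    rw [integral_fourier_mul_eq]
    have e : ∀ t, U t * (𝓕 (𝓕 V)) t = (u t : ℝ) := by
      intro t
      have h1 : (𝓕 (𝓕 V)) t = V (-t) := by
        have := congrArg (fun W : 𝓢(ℝ, ℂ) => W (-t)) (fourierInv_fourier_eq (F := 𝓢(ℝ, ℂ)) V)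
        rwa [fourierInv_coe, Real.fourierInv_eq_fourier_neg, neg_neg] at this
      rw [h1, hUd, hVd, bumpSchwartz_apply, bumpSchwartz_apply]
      by_cases h0 : u t = 0
      · simp [h0]
      · have h2 : |t| < 1 / 2 := by
          have := bumpSchwartz_ne_zero u (t := t) (by
            rw [bumpSchwartz_apply]; exact_mod_cast h0)
          rwa [sub_zero] at this
        rw [v.one_of_mem_closedBall]
        · simp
        · rw [Metric.mem_closedBall, Real.dist_eq, sub_zero, abs_neg]
          exact h2.le.trans (by norm_num [v])
    simp_rw [e]
    rw [integral_complex_ofReal]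
    exact Complex.ofReal_ne_zero.2 (u.integral_pos (μ := volume)).ne'
  · intro x
    have e : (fun x : ℝ => (x : ℂ) * (pairing (ContinuousLinearMap.mul ℂ ℂ) (𝓕 U) (𝓕 V)) x) =
        fun x : ℝ => (2 * Real.pi * Complex.I)⁻¹ * (𝓕 (U : ℝ → ℂ) x * 𝓕 (V' : ℝ → ℂ) x) := by
      ext x
      simp only [pairing_apply_apply, ContinuousLinearMap.mul_apply', fourier_coe]
      rw [mul_left_comm, hxV]
      ring
    rw [e]
    refine (((dU x).mul (dV x)).const_mul _).congr_deriv ?_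
    simp only [smul_apply, add_apply, pairing_apply_apply, ContinuousLinearMap.mul_apply',
      smul_eq_mul, fourier_coe]
  · refine KakeyaControlled.smul (KakeyaControlled.add ?_ ?_) _
    · refine kakeyaControlled_fourier_mul_fourier _ _ (fun t ht => hU t ?_) hV'
      rw [hXUa] at ht
      exact right_ne_zero_of_mul ht
    · refine kakeyaControlled_fourier_mul_fourier _ _ hU (fun t ht => hV' t ?_)
      rw [hXVa] at ht
      exact right_ne_zero_of_mul ht

end AveragingKernel

/-! ### Comparing averages at different scales. -/

section Telescoping

open Filter Topology

variable {Φ Ξ : 𝓢(ℝ, ℂ)}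

/-- With `x = u / δ³`, the dilated kernel is `u⁻¹ · xΦ(x)`, hence its derivative in `δ` only
involves `(xΦ)' = Ξ`. -/
theorem hasDerivAt_dilated_kernel (hΦ : ∀ x : ℝ, HasDerivAt (fun x : ℝ => (x : ℂ) * Φ x) (Ξ x) x)
    {u : ℝ} (hu : u ≠ 0) {δ : ℝ} (hδ : 0 < δ) :
    HasDerivAt (fun δ : ℝ => ((δ ^ 3)⁻¹ : ℝ) • Φ ((δ ^ 3)⁻¹ * u))
      ((-3 * δ⁻¹ * (δ ^ 3)⁻¹ : ℝ) • Ξ ((δ ^ 3)⁻¹ * u)) δ := by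
  have h1 : HasDerivAt (fun δ : ℝ => (δ ^ 3)⁻¹ * u) (-3 * δ⁻¹ * (δ ^ 3)⁻¹ * u) δ := by
    refine (((hasDerivAt_pow 3 δ).fun_inv (pow_ne_zero 3 hδ.ne')).mul_const u).congr_deriv ?_
    norm_num
    field_simp
  have h2 := (hΦ ((δ ^ 3)⁻¹ * u)).scomp δ h1
  have h3 := h2.const_smul (u⁻¹ : ℝ)
  refine (h3.congr_deriv ?_).congr_of_eventuallyEq (Eventually.of_forall fun y => ?_)
  · rw [smul_smul]
    congr 1
    field_simp
  · have hu' : (u : ℂ) ≠ 0 := by exact_mod_cast hu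
    simp only [Function.comp_apply, Complex.real_smul, Pi.smul_apply]
    push_cast
    field_simp

theorem integral_dilated_kernel (hΦ : ∀ x : ℝ, HasDerivAt (fun x : ℝ => (x : ℂ) * Φ x) (Ξ x) x)
    {u : ℝ} (hu : u ≠ 0) {δ₀ δ₁ : ℝ} (h0 : 0 < δ₀) (h01 : δ₀ ≤ δ₁) :
    ∫ δ in Ioc δ₀ δ₁, (-3 * δ⁻¹ * (δ ^ 3)⁻¹ : ℝ) • Ξ ((δ ^ 3)⁻¹ * u) =
      ((δ₁ ^ 3)⁻¹ : ℝ) • Φ ((δ₁ ^ 3)⁻¹ * u) - ((δ₀ ^ 3)⁻¹ : ℝ) • Φ ((δ₀ ^ 3)⁻¹ * u) := by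
  rw [← intervalIntegral.integral_of_le h01]
  have hpos : ∀ δ ∈ uIcc δ₀ δ₁, 0 < δ := fun δ hδ => by
    rw [uIcc_of_le h01] at hδ
    exact h0.trans_le hδ.1
  refine intervalIntegral.integral_eq_sub_of_hasDerivAt
    (fun δ hδ => hasDerivAt_dilated_kernel hΦ hu (hpos δ hδ)) ?_
  refine ContinuousOn.intervalIntegrable fun δ hδ => ContinuousAt.continuousWithinAt ?_
  have h1 : ContinuousAt (fun δ : ℝ => (δ ^ 3)⁻¹) δ :=
    (continuousAt_id.pow 3).inv₀ (pow_ne_zero 3 (hpos δ hδ).ne')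
  have h2 : ContinuousAt (fun δ : ℝ => -3 * δ⁻¹ * (δ ^ 3)⁻¹) δ :=
    (continuousAt_const.mul (continuousAt_id.inv₀ (hpos δ hδ).ne')).mul h1
  have h3 : ContinuousAt (fun δ : ℝ => Ξ ((δ ^ 3)⁻¹ * u)) δ :=
    Ξ.continuous.continuousAt.comp (h1.mul continuousAt_const)
  exact h2.smul h3

/-- The `L_1` norm in the first variable is `3 δ⁻¹ ∫ ‖Ξ‖`, bounded away from `δ = 0`; this licenses
Fubini in `scaleAverage_sub`. -/
theorem integrable_dilated_kernel_prod (Ξ : 𝓢(ℝ, ℂ)) {δ₀ δ₁ : ℝ} (h0 : 0 < δ₀) :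
    Integrable (fun z : ℝ × ℝ => (-3 * z.2⁻¹ * (z.2 ^ 3)⁻¹ : ℝ) • Ξ ((z.2 ^ 3)⁻¹ * z.1))
      ((volume : Measure ℝ).prod (volume.restrict (Ioc δ₀ δ₁))) := by
  have hm : AEStronglyMeasurable
      (fun z : ℝ × ℝ => (-3 * z.2⁻¹ * (z.2 ^ 3)⁻¹ : ℝ) • Ξ ((z.2 ^ 3)⁻¹ * z.1))
      ((volume : Measure ℝ).prod (volume.restrict (Ioc δ₀ δ₁))) := by
    refine Measurable.aestronglyMeasurable ?_
    have := Ξ.continuous.measurable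
    fun_prop
  rw [integrable_prod_iff' hm]
  have hpos : ∀ᵐ δ ∂(volume.restrict (Ioc δ₀ δ₁)), 0 < δ := by
    filter_upwards [ae_restrict_mem measurableSet_Ioc] with δ hδ using h0.trans hδ.1
  constructor
  · filter_upwards [hpos] with δ hδ
    exact (Ξ.integrable.comp_mul_left' (by positivity)).smul (-3 * δ⁻¹ * (δ ^ 3)⁻¹ : ℝ)
  · have e : ∀ᵐ δ ∂(volume.restrict (Ioc δ₀ δ₁)), 3 * δ⁻¹ * ∫ x, ‖Ξ x‖ =
        ∫ x, ‖(-3 * δ⁻¹ * (δ ^ 3)⁻¹ : ℝ) • Ξ ((δ ^ 3)⁻¹ * x)‖ := by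
      filter_upwards [hpos] with δ hδ
      simp_rw [norm_smul]
      rw [integral_const_mul, Measure.integral_comp_mul_left (fun y => ‖Ξ y‖)]
      rw [Real.norm_eq_abs, abs_mul, abs_mul, abs_of_pos (inv_pos.2 hδ),
        abs_of_pos (by positivity : 0 < (δ ^ 3)⁻¹), inv_inv, abs_of_pos (by positivity : 0 < δ ^ 3),
        smul_eq_mul]
      norm_num
      field_simp
    refine Integrable.congr ?_ e
    refine Integrable.mul_const ?_ _
    refine Measure.integrableOn_of_bounded (M := 3 * δ₀⁻¹) (by simp)
      (by fun_prop : Measurable fun δ : ℝ => 3 * δ⁻¹).aestronglyMeasurable ?_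
    filter_upwards [ae_restrict_mem measurableSet_Ioc] with δ hδ
    have hδ0 := h0.trans hδ.1
    rw [Real.norm_of_nonneg (by positivity)]
    have := hδ.1.le
    gcongr

/-- The average of `φ` at scale `w` around `s`, in the linear frequency variable. -/
noncomputable def scaleAverage (φ : ℝ → ℂ) (Φ : ℝ → ℂ) (s w : ℝ) : ℂ :=
  ∫ x, φ (Real.log (Real.exp s * |1 + w * x|)) * Φ x

theorem scaleAverage_eq_integral_dilated (φ : ℝ → ℂ) (Φ : ℝ → ℂ) (s : ℝ) {w : ℝ} (hw : 0 < w) :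
    scaleAverage φ Φ s w =
      ∫ u, φ (Real.log (Real.exp s * |1 + u|)) * ((w⁻¹ : ℝ) • Φ (w⁻¹ * u)) := by
  have h := Measure.integral_comp_mul_left
    (fun x => φ (Real.log (Real.exp s * |1 + w * x|)) * Φ x) w⁻¹
  rw [inv_inv, abs_of_pos hw] at h
  have h2 : scaleAverage φ Φ s w = (w⁻¹ : ℝ) • ∫ u, φ (Real.log (Real.exp s *
      |1 + w * (w⁻¹ * u)|)) * Φ (w⁻¹ * u) := by
    rw [h, smul_smul, inv_mul_cancel₀ hw.ne', one_smul]
    rfl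
  rw [h2, ← integral_smul]
  refine integral_congr_ae (Eventually.of_forall fun u => ?_)
  simp only
  rw [mul_inv_cancel_left₀ hw.ne', mul_smul_comm]

theorem scaleAverage_sub (hΦ : ∀ x : ℝ, HasDerivAt (fun x : ℝ => (x : ℂ) * Φ x) (Ξ x) x)
    {φ : ℝ → ℂ} (hφ : Continuous φ) {b : ℝ} (hb : ∀ s, ‖φ s‖ ≤ b) (s : ℝ)
    {δ₀ δ₁ : ℝ} (h0 : 0 < δ₀) (h01 : δ₀ ≤ δ₁) :
    scaleAverage φ Φ s (δ₁ ^ 3) - scaleAverage φ Φ s (δ₀ ^ 3) =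
      ∫ δ in Ioc δ₀ δ₁, (-3 * δ⁻¹ : ℝ) • scaleAverage φ Ξ s (δ ^ 3) := by
  have h1 : 0 < δ₁ := h0.trans_le h01
  set M : ℝ → ℂ := fun u => φ (Real.log (Real.exp s * |1 + u|)) with hM
  have hMm : Measurable M := by
    refine hφ.measurable.comp (Real.measurable_log.comp ?_)
    fun_prop
  have hk : ∀ w : ℝ, 0 < w → Integrable (fun u => M u * ((w⁻¹ : ℝ) • Φ (w⁻¹ * u))) := by
    intro w hw
    exact ((Φ.integrable.comp_mul_left' (inv_pos.2 hw).ne').smul (w⁻¹ : ℝ)).bdd_mul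
      hMm.aestronglyMeasurable (Eventually.of_forall fun u => hb _)
  rw [scaleAverage_eq_integral_dilated _ _ _ (by positivity),
    scaleAverage_eq_integral_dilated _ _ _ (by positivity),
    ← integral_sub (hk _ (by positivity)) (hk _ (by positivity))]
  have e1 : ∫ u, (M u * (((δ₁ ^ 3)⁻¹ : ℝ) • Φ ((δ₁ ^ 3)⁻¹ * u)) -
      M u * (((δ₀ ^ 3)⁻¹ : ℝ) • Φ ((δ₀ ^ 3)⁻¹ * u))) =
      ∫ u, ∫ δ in Ioc δ₀ δ₁, M u * ((-3 * δ⁻¹ * (δ ^ 3)⁻¹ : ℝ) • Ξ ((δ ^ 3)⁻¹ * u)) := by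
    refine integral_congr_ae ?_
    have hne : ∀ᵐ u : ℝ, u ≠ 0 := Measure.ae_ne volume 0
    filter_upwards [hne] with u hu
    rw [integral_const_mul, integral_dilated_kernel hΦ hu h0 h01, mul_sub]
  rw [e1, integral_integral_swap]
  · refine setIntegral_congr_fun measurableSet_Ioc fun δ hδ => ?_
    have hδ0 : 0 < δ := h0.trans hδ.1
    rw [scaleAverage_eq_integral_dilated _ _ _ (by positivity), ← integral_smul]
    refine integral_congr_ae (Eventually.of_forall fun u => ?_)
    simp only [mul_smul, mul_smul_comm]
    rfl
  · exact (integrable_dilated_kernel_prod Ξ h0).bdd_mul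
      (hMm.comp measurable_fst).aestronglyMeasurable (Eventually.of_forall fun z => hb _)

theorem tendsto_scaleAverage {φ : ℝ → ℂ} (hφ : Continuous φ) {b : ℝ} (hb : ∀ s, ‖φ s‖ ≤ b)
    (Φ : 𝓢(ℝ, ℂ)) (s : ℝ) :
    Tendsto (fun δ : ℝ => scaleAverage φ Φ s (δ ^ 3)) (𝓝 0) (𝓝 (φ s * ∫ x, Φ x)) := by
  rw [← integral_const_mul]
  refine tendsto_integral_filter_of_dominated_convergence (fun x => b * ‖Φ x‖)
    (Eventually.of_forall fun δ => (integrable_average hφ hb _ _ Φ.integrable).1)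
    (Eventually.of_forall fun δ => Eventually.of_forall fun x => ?_) (Φ.integrable.norm.const_mul b)
    (Eventually.of_forall fun x => Tendsto.mul_const _ ?_)
  · rw [norm_mul]
    gcongr
    exact hb _
  · have h1 : ContinuousAt (fun δ : ℝ => φ (Real.log (Real.exp s * |1 + δ ^ 3 * x|))) 0 := by
      refine hφ.continuousAt.comp (ContinuousAt.log (by fun_prop) ?_)
      simp
    have := h1.tendsto
    simpa using this

variable {d : ℕ} [NeZero d]

/-- With `h = δ³`, the curvature error `h / δ² = δ` is integrable against `dδ / δ` and contributes
the term `δ₁`. Letting the lower scale tend to `0` recovers `φ s`. -/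
theorem enorm_scaleAverage_sub_le (hΦ : ∀ x : ℝ, HasDerivAt (fun x : ℝ => (x : ℂ) * Φ x) (Ξ x) x)
    (hΞ : KakeyaControlled d Ξ) (C₂ : ℝ≥0) :
    ∃ C : ℝ≥0, ∀ (p q : ℝ≥0∞), p.HolderConjugate q → ∀ (A : ℝ≥0) (φ : ℝ → ℂ),
      Continuous φ → (∀ s, ‖φ s‖ ≤ C₂ * A) →
      PairingBound p q A (fun ξ : EuclideanSpace ℝ (Fin d) => φ (Real.log ‖ξ‖)) →
      ∀ s δ₁ : ℝ, 0 < δ₁ → δ₁ ≤ 1 →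
      ‖scaleAverage φ Φ s (δ₁ ^ 3) - φ s * ∫ x, Φ x‖ₑ ≤
        C * A * ((∫⁻ δ in Ioo 0 δ₁, ENNReal.ofReal (kakeyaDensity d p δ)) +
          ENNReal.ofReal δ₁) := by
  obtain ⟨C, hC⟩ := hΞ
  refine ⟨3 * C * (1 + C₂), fun p q hpq A φ hφ hb hP s δ₁ h1 h1' => ?_⟩
  have step : ∀ δ₀, 0 < δ₀ → δ₀ ≤ δ₁ →
      ‖scaleAverage φ Φ s (δ₁ ^ 3) - scaleAverage φ Φ s (δ₀ ^ 3)‖ₑ ≤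
      (3 * C * (1 + C₂) : ℝ≥0) * A * ((∫⁻ δ in Ioo 0 δ₁, ENNReal.ofReal (kakeyaDensity d p δ)) +
          ENNReal.ofReal δ₁) := by
    intro δ₀ h0 h01
    rw [scaleAverage_sub hΦ hφ hb s h0 h01]
    refine (enorm_integral_le_lintegral_enorm _).trans ?_
    have hpt : ∀ δ ∈ Ioc δ₀ δ₁, ‖(-3 * δ⁻¹ : ℝ) • scaleAverage φ Ξ s (δ ^ 3)‖ₑ ≤
        ((3 * C * (1 + C₂) * A : ℝ≥0) : ℝ≥0∞) * (ENNReal.ofReal (kakeyaDensity d p δ) + 1) := by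
      intro δ hδ
      have hδ0 : 0 < δ := h0.trans hδ.1
      have hk := Real.rpow_nonneg (kakeyaFun_nonneg (d := d) δ) |(p⁻¹).toReal - 1 / 2|
      have hc := hC p q hpq A φ _ hφ hb hP s (δ ^ 3) δ (by positivity) hδ0 (hδ.2.trans h1')
      have hd : 0 ≤ kakeyaDensity d p δ := div_nonneg hk hδ0.le
      rw [← ENNReal.ofReal_one, ← ENNReal.ofReal_add hd zero_le_one, ← ofReal_norm,
        ← ENNReal.ofReal_coe_nnreal, ← ENNReal.ofReal_mul (NNReal.coe_nonneg _)]
      refine ENNReal.ofReal_le_ofReal ?_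
      rw [norm_smul, norm_mul, norm_inv, norm_neg, Real.norm_of_nonneg hδ0.le,
        Real.norm_of_nonneg (by norm_num : (0 : ℝ) ≤ 3)]
      calc 3 * δ⁻¹ * ‖scaleAverage φ Ξ s (δ ^ 3)‖
          ≤ 3 * δ⁻¹ * (C * (A * kakeyaFun d δ ^ |(p⁻¹).toReal - 1 / 2| +
              C₂ * A * (δ ^ 3 / δ ^ 2))) := by gcongr; exact hc
        _ = 3 * C * A * (kakeyaDensity d p δ + C₂) := by
          unfold kakeyaDensity
          field_simp
        _ ≤ 3 * C * A * ((1 + C₂) * (kakeyaDensity d p δ + 1)) := by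
          gcongr
          nlinarith [mul_nonneg C₂.coe_nonneg hd]
        _ = _ := by push_cast; ring
    calc ∫⁻ δ in Ioc δ₀ δ₁, ‖(-3 * δ⁻¹ : ℝ) • scaleAverage φ Ξ s (δ ^ 3)‖ₑ
        ≤ ∫⁻ δ in Ioc δ₀ δ₁, ((3 * C * (1 + C₂) * A : ℝ≥0) : ℝ≥0∞) *
            (ENNReal.ofReal (kakeyaDensity d p δ) + 1) :=
          setLIntegral_mono' measurableSet_Ioc hpt
      _ ≤ ∫⁻ δ in Ioc 0 δ₁, ((3 * C * (1 + C₂) * A : ℝ≥0) : ℝ≥0∞) *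
            (ENNReal.ofReal (kakeyaDensity d p δ) + 1) :=
          lintegral_mono_set (Ioc_subset_Ioc_left h0.le)
      _ = _ := by
        -- These forms of linearity do not ask for measurability of `kakeyaDensity` in `δ`, which is
        -- never established.
        rw [← restrict_Ioo_eq_restrict_Ioc, lintegral_const_mul' _ _ ENNReal.coe_ne_top,
          lintegral_add_right _ measurable_const, setLIntegral_const, Real.volume_Ioo, sub_zero,
          one_mul]
        push_cast
        rfl
  have ht : Tendsto (fun δ₀ : ℝ => ‖scaleAverage φ Φ s (δ₁ ^ 3) - scaleAverage φ Φ s (δ₀ ^ 3)‖ₑ)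
      (𝓝[>] 0) (𝓝 ‖scaleAverage φ Φ s (δ₁ ^ 3) - φ s * ∫ x, Φ x‖ₑ) :=
    (tendsto_const_nhds.sub ((tendsto_scaleAverage hφ hb Φ s).mono_left nhdsWithin_le_nhds)).enorm
  refine le_of_tendsto ht ?_
  filter_upwards [Ioo_mem_nhdsGT h1] with δ₀ hδ₀ using step δ₀ hδ₀.1 hδ₀.2.le

end Telescoping

/-! ### The modulus of continuity for continuous symbols. -/

section Modulus

open Filter Topology

theorem lintegral_enorm_sub_translate_le (Φ : 𝓢(ℝ, ℂ)) {η : ℝ} (hη : 0 ≤ η) :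
    ∫⁻ y, ‖Φ y - Φ (y - η)‖ₑ ≤ ENNReal.ofReal η * ∫⁻ x, ‖deriv Φ x‖ₑ := by
  have hc : Continuous (deriv Φ) := (Φ.smooth 1).continuous_deriv le_rfl
  have hp : ∀ y, ‖Φ y - Φ (y - η)‖ₑ ≤ ∫⁻ θ in Ioc 0 η, ‖deriv Φ (y - θ)‖ₑ := by
    intro y
    have h1 : Φ y - Φ (y - η) = ∫ θ in Ioc 0 η, deriv Φ (y - θ) := by
      rw [← intervalIntegral.integral_of_le hη, intervalIntegral.integral_comp_sub_left, sub_zero,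
        intervalIntegral.integral_deriv_eq_sub (fun x _ => Φ.differentiableAt)
          (hc.intervalIntegrable _ _)]
    rw [h1]
    exact enorm_integral_le_lintegral_enorm _
  calc ∫⁻ y, ‖Φ y - Φ (y - η)‖ₑ
      ≤ ∫⁻ y, ∫⁻ θ in Ioc 0 η, ‖deriv Φ (y - θ)‖ₑ := lintegral_mono hp
    _ = ∫⁻ θ in Ioc 0 η, ∫⁻ y, ‖deriv Φ (y - θ)‖ₑ := by
      refine lintegral_lintegral_swap (Continuous.aemeasurable ?_)
      exact (hc.comp (continuous_fst.sub continuous_snd)).enorm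
    _ = ENNReal.ofReal η * ∫⁻ x, ‖deriv Φ x‖ₑ := by
      simp_rw [lintegral_sub_right_eq_self (fun x => ‖deriv Φ x‖ₑ)]
      rw [setLIntegral_const, Real.volume_Ioc, sub_zero, mul_comm]

/-- Averages around two different points are compared by translating the kernel. -/
theorem enorm_scaleAverage_sub_scaleAverage_le {φ : ℝ → ℂ} (hφ : Continuous φ) {b : ℝ≥0}
    (hb : ∀ s, ‖φ s‖ ≤ b) (Φ : 𝓢(ℝ, ℂ)) (s : ℝ) {r w : ℝ} (hr : 0 ≤ r) (hr1 : r ≤ 1)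
    (hw : 0 < w) :
    ‖scaleAverage φ Φ (s + r) (w * Real.exp (-r)) - scaleAverage φ Φ s w‖ₑ ≤
      b * (ENNReal.ofReal (2 * r / w) * ∫⁻ x, ‖deriv Φ x‖ₑ) := by
  -- Chosen so that `e^s (1 + w (x + η)) = e^(s+r) (1 + w e^(-r) x)`: both averages see the same
  -- frequencies at the same absolute width.
  set η : ℝ := (Real.exp r - 1) / w with hη
  have hη0 : 0 ≤ η := div_nonneg (sub_nonneg.2 (Real.one_le_exp hr)) hw.le
  have hηr : η ≤ 2 * r / w := by
    rw [hη]
    gcongr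
    have := Real.abs_exp_sub_one_le (x := r) (by rwa [abs_of_nonneg hr])
    rw [abs_of_nonneg hr] at this
    exact (le_abs_self _).trans this
  have e : scaleAverage φ Φ (s + r) (w * Real.exp (-r)) =
      ∫ y, φ (Real.log (Real.exp s * |1 + w * y|)) * Φ (y - η) := by
    rw [← integral_add_right_eq_self _ η]
    unfold scaleAverage
    refine integral_congr_ae (Eventually.of_forall fun x => ?_)
    have h1 : Real.exp s * |1 + w * (x + η)| =
        Real.exp (s + r) * |1 + w * Real.exp (-r) * x| := by
      rw [Real.exp_add, mul_assoc, ← abs_of_pos (Real.exp_pos r), ← abs_mul]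
      congr 2
      rw [hη, Real.exp_neg]
      field_simp
      ring
    simp only [h1, add_sub_cancel_right]
  rw [e, scaleAverage, ← integral_sub (integrable_average hφ hb _ _ (Φ.integrable.comp_sub_right η))
    (integrable_average hφ hb _ _ Φ.integrable)]
  calc _ ≤ ∫⁻ y, ‖φ (Real.log (Real.exp s * |1 + w * y|)) * Φ (y - η) -
          φ (Real.log (Real.exp s * |1 + w * y|)) * Φ y‖ₑ := enorm_integral_le_lintegral_enorm _
    _ ≤ ∫⁻ y, b * ‖Φ y - Φ (y - η)‖ₑ := by
      refine lintegral_mono fun y => ?_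
      rw [← mul_sub, enorm_mul, ← enorm_neg (Φ (y - η) - Φ y), neg_sub]
      gcongr
      exact enorm_le_coe.2 (hb _)
    _ = b * ∫⁻ y, ‖Φ y - Φ (y - η)‖ₑ := lintegral_const_mul' _ _ ENNReal.coe_ne_top
    _ ≤ _ := by
      gcongr
      refine (lintegral_enorm_sub_translate_le Φ hη0).trans ?_
      gcongr

/-- The modulus of continuity of the radial multipliers given by the Kakeya function. -/
noncomputable def kakeyaModulus (d : ℕ) [NeZero d] (p : ℝ≥0∞) (r : ℝ) : ℝ≥0∞ :=
  (∫⁻ δ in Ioo (0 : ℝ) (min 1 (r ^ (1 / 4 : ℝ))), ENNReal.ofReal (kakeyaDensity d p δ)) +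
    ENNReal.ofReal (r ^ (1 / 4 : ℝ))

/-- Triangle inequality through averages at scale `δ³` around `s` and `δ³ e^(-r)` around `s + r`.
The choice `δ = r^(1/4)` makes the translation cost `2 r / δ³` equal to `2 δ`. -/
theorem exists_enorm_sub_le_kakeyaModulus (d : ℕ) [NeZero d] (C₂ : ℝ≥0) :
    ∃ C : ℝ≥0, ∀ (p q : ℝ≥0∞), p.HolderConjugate q → ∀ (A : ℝ≥0) (φ : ℝ → ℂ),
      Continuous φ → (∀ s, ‖φ s‖ ≤ C₂ * A) →
      PairingBound p q A (fun ξ : EuclideanSpace ℝ (Fin d) => φ (Real.log ‖ξ‖)) →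
      ∀ s t : ℝ, ‖φ s - φ t‖ₑ ≤ C * A * kakeyaModulus d p |s - t| := by
  obtain ⟨Φ, Ξ, hΦ0, hΦ, hΞ⟩ := exists_averaging_kernel d
  obtain ⟨C, hC⟩ := enorm_scaleAverage_sub_le hΦ hΞ C₂
  have hfin : ∫⁻ x, ‖deriv Φ x‖ₑ ≠ ∞ := by
    have := ((derivCLM ℂ ℂ Φ).integrable (μ := volume)).hasFiniteIntegral.ne
    simpa [derivCLM_apply] using! this
  set I : ℂ := ∫ x, Φ x
  set D : ℝ≥0 := (∫⁻ x, ‖deriv Φ x‖ₑ).toNNReal with hD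
  have hDe : ∫⁻ x, ‖deriv Φ x‖ₑ = D := (ENNReal.coe_toNNReal hfin).symm
  have hI : 0 < ‖I‖₊ := by simpa using hΦ0
  refine ⟨‖I‖₊⁻¹ * (2 * C + 2 * C₂ * D) + 2 * C₂, fun p q hpq A φ hφ hb hP => ?_⟩
  suffices H : ∀ s r : ℝ, 0 ≤ r → ‖φ s - φ (s + r)‖ₑ ≤
      (‖I‖₊⁻¹ * (2 * C + 2 * C₂ * D) + 2 * C₂ : ℝ≥0) * A * kakeyaModulus d p r by
    intro s t
    rcases le_total s t with h | h
    · have := H s (t - s) (sub_nonneg.2 h)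
      rwa [add_sub_cancel, ← abs_of_nonneg (sub_nonneg.2 h), abs_sub_comm] at this
    · have := H t (s - t) (sub_nonneg.2 h)
      rw [add_sub_cancel, ← abs_of_nonneg (sub_nonneg.2 h)] at this
      rwa [← enorm_neg, neg_sub] 
  intro s r hr
  have hbe : ∀ s, ‖φ s‖ₑ ≤ ((C₂ * A : ℝ≥0) : ℝ≥0∞) := fun s => enorm_le_coe.2 (by
    have := hb s
    exact_mod_cast this)
  -- At distance at least `1` the modulus is at least `1`, and the sup bound on `φ` suffices.
  rcases le_or_gt 1 r with hr1 | hr1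
  · have h1 : (1 : ℝ≥0∞) ≤ kakeyaModulus d p r := by
      refine le_add_left ?_
      rw [← ENNReal.ofReal_one]
      exact ENNReal.ofReal_le_ofReal (Real.one_le_rpow hr1 (by norm_num))
    calc ‖φ s - φ (s + r)‖ₑ ≤ ‖φ s‖ₑ + ‖φ (s + r)‖ₑ := enorm_sub_le
      _ ≤ ((C₂ * A : ℝ≥0) : ℝ≥0∞) + ((C₂ * A : ℝ≥0) : ℝ≥0∞) := add_le_add (hbe _) (hbe _)
      _ = ((2 * C₂ : ℝ≥0) : ℝ≥0∞) * A * 1 := by push_cast; ring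
      _ ≤ _ := by
        gcongr
        exact le_add_self
  rcases hr.eq_or_lt with rfl | hr0
  · simp
  set δ : ℝ := r ^ (1 / 4 : ℝ) with hδ
  have hδ0 : 0 < δ := Real.rpow_pos_of_pos hr0 _
  have hδ1 : δ ≤ 1 := Real.rpow_le_one hr0.le hr1.le (by norm_num)
  have hδ4 : δ ^ 4 = r := by
    rw [hδ, ← Real.rpow_natCast, ← Real.rpow_mul hr0.le]
    norm_num
  set K : ℝ≥0∞ := kakeyaModulus d p r with hK
  have hKe : K = (∫⁻ δ in Ioo 0 δ, ENNReal.ofReal (kakeyaDensity d p δ)) + ENNReal.ofReal δ := by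
    rw [hK, kakeyaModulus, ← hδ, min_eq_right hδ1]
  -- The cube root of the scale `δ³ e^(-r)` needed at `s + r`.
  set δ' : ℝ := δ * Real.exp (-r / 3) with hδ'
  have hδ'0 : 0 < δ' := by positivity
  have hδ'1 : δ' ≤ δ := by
    refine mul_le_of_le_one_right hδ0.le (Real.exp_le_one_iff.2 ?_)
    linarith
  have hδ'3 : δ' ^ 3 = δ ^ 3 * Real.exp (-r) := by
    rw [hδ', mul_pow, ← Real.exp_nat_mul]
    congr 2
    push_cast
    ring
  have b1 := hC p q hpq A φ hφ hb hP s δ hδ0 hδ1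
  have b2 := hC p q hpq A φ hφ hb hP (s + r) δ' hδ'0 (hδ'1.trans hδ1)
  have b3 := enorm_scaleAverage_sub_scaleAverage_le hφ (b := C₂ * A) hb Φ s hr hr1.le
    (pow_pos hδ0 3)
  rw [← hδ'3, hDe, show 2 * r / δ ^ 3 = 2 * δ by rw [← hδ4]; field_simp] at b3
  rw [← hKe] at b1
  replace b2 : ‖scaleAverage φ Φ (s + r) (δ' ^ 3) - φ (s + r) * I‖ₑ ≤ C * A * K := by
    refine b2.trans ?_
    rw [hKe]
    gcongr
  replace b3 : ‖scaleAverage φ Φ (s + r) (δ' ^ 3) - scaleAverage φ Φ s (δ ^ 3)‖ₑ ≤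
      2 * C₂ * D * A * K := by
    refine b3.trans ?_
    have : ENNReal.ofReal δ ≤ K := hKe ▸ le_add_self
    rw [ENNReal.ofReal_mul zero_le_two, ENNReal.ofReal_ofNat, ENNReal.coe_mul]
    calc (C₂ * A * (2 * ENNReal.ofReal δ * D) : ℝ≥0∞) = 2 * C₂ * D * A * ENNReal.ofReal δ := by ring
      _ ≤ _ := by gcongr
  have key : ‖φ s - φ (s + r)‖ₑ * ‖I‖₊ ≤ ((2 * C + 2 * C₂ * D : ℝ≥0) : ℝ≥0∞) * A * K := by
    calc ‖φ s - φ (s + r)‖ₑ * ‖I‖₊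
        = ‖-(scaleAverage φ Φ s (δ ^ 3) - φ s * I) +
            (scaleAverage φ Φ (s + r) (δ' ^ 3) - φ (s + r) * I) -
            (scaleAverage φ Φ (s + r) (δ' ^ 3) - scaleAverage φ Φ s (δ ^ 3))‖ₑ := by
          rw [← enorm_eq_nnnorm, ← enorm_mul]
          congr 1
          ring
      _ ≤ C * A * K + C * A * K + 2 * C₂ * D * A * K := by
          refine enorm_sub_le.trans (add_le_add ((enorm_add_le _ _).trans (add_le_add ?_ b2)) b3)
          rwa [enorm_neg]
      _ = _ := by push_cast; ring
  have hI' : (‖I‖₊ : ℝ≥0∞) ≠ 0 := by exact_mod_cast hI.ne'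
  calc ‖φ s - φ (s + r)‖ₑ = (‖I‖₊ : ℝ≥0∞)⁻¹ * (‖φ s - φ (s + r)‖ₑ * ‖I‖₊) := by
        rw [mul_comm, mul_assoc, ENNReal.mul_inv_cancel hI' ENNReal.coe_ne_top, mul_one]
    _ ≤ (‖I‖₊ : ℝ≥0∞)⁻¹ * (((2 * C + 2 * C₂ * D : ℝ≥0) : ℝ≥0∞) * A * K) := by gcongr
    _ = ((‖I‖₊⁻¹ * (2 * C + 2 * C₂ * D) : ℝ≥0) : ℝ≥0∞) * A * K := by
      rw [ENNReal.coe_mul, ENNReal.coe_inv hI.ne']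
      ring
    _ ≤ _ := by
      gcongr
      exact le_self_add

end Modulus

/-! ### From measurable radial symbols to continuous ones. -/

section RadialSymbols

open Filter Topology

/-- Polar coordinates applied to the indicator of the failure of `P`. No measurability of `P` is
needed: each direction starts from a function vanishing almost everywhere, hence integrable. -/
theorem ae_comp_norm_iff {V : Type*} [NormedAddCommGroup V] [NormedSpace ℝ V]
    [FiniteDimensional ℝ V] [Nontrivial V] [MeasurableSpace V] [BorelSpace V] (μ : Measure V)
    [μ.IsAddHaarMeasure] {P : ℝ → Prop} :
    (∀ᵐ x ∂μ, P ‖x‖) ↔ ∀ᵐ y : ℝ ∂(volume.restrict (Ioi 0)), P y := by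
  classical
  set f : ℝ → ℝ := fun y => if P y then 0 else 1 with hf
  have hf0 : ∀ y, 0 ≤ f y := fun y => by
    simp only [hf]
    split_ifs <;> norm_num
  have hfP : ∀ y, f y = 0 ↔ P y := fun y => by simp [hf]
  have hint := integrable_fun_norm_addHaar μ (f := f)
  have heq := integral_fun_norm_addHaar μ f
  have hpos : 0 < μ.real (Metric.ball 0 1) :=
    ENNReal.toReal_pos (Metric.measure_ball_pos μ _ one_pos).ne' measure_ball_lt_top.ne
  have hdim : Module.finrank ℝ V ≠ 0 := Module.finrank_pos.ne'
  have hnn : ∀ᵐ y : ℝ ∂(volume.restrict (Ioi 0)), 0 ≤ y ^ (Module.finrank ℝ V - 1) • f y := by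
    filter_upwards [ae_restrict_mem measurableSet_Ioi] with y hy
    exact mul_nonneg (pow_nonneg (le_of_lt hy) _) (hf0 y)
  have hz : (fun y : ℝ => y ^ (Module.finrank ℝ V - 1) • f y) =ᵐ[volume.restrict (Ioi 0)] 0 ↔
      ∀ᵐ y : ℝ ∂(volume.restrict (Ioi 0)), P y := by
    refine eventually_congr ?_
    filter_upwards [ae_restrict_mem measurableSet_Ioi] with y hy
    rw [Pi.zero_apply, smul_eq_zero, or_iff_right (pow_ne_zero _ (ne_of_gt hy)), hfP]
  have hz' : (fun x : V => f ‖x‖) =ᵐ[μ] 0 ↔ ∀ᵐ x ∂μ, P ‖x‖ :=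
    eventually_congr (Eventually.of_forall fun x => hfP _)
  rw [← hz, ← hz']
  constructor
  · intro h
    have hi : Integrable (fun x : V => f ‖x‖) μ := (integrable_zero V ℝ μ).congr h.symm
    rw [integral_eq_zero_of_ae h, eq_comm, nsmul_eq_mul, smul_eq_mul] at heq
    have h0 := (mul_eq_zero.1 ((mul_eq_zero.1 heq).resolve_left
      (by exact_mod_cast hdim))).resolve_left hpos.ne'
    exact (integral_eq_zero_iff_of_nonneg_ae hnn (hint.1 hi)).1 h0
  · intro h
    have hi : Integrable (fun x : V => f ‖x‖) μ := hint.2 ((integrable_zero ℝ ℝ _).congr h.symm)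
    rw [integral_eq_zero_of_ae h, smul_zero, smul_zero] at heq
    exact (integral_eq_zero_iff_of_nonneg (fun x => hf0 _) hi).1 heq

/-- `log` and `exp` are differentiable, so they map null sets to null sets. -/
theorem ae_comp_log_iff {P : ℝ → Prop} :
    (∀ᵐ y : ℝ ∂(volume.restrict (Ioi 0)), P (Real.log y)) ↔ ∀ᵐ s : ℝ, P s := by
  rw [ae_restrict_iff' measurableSet_Ioi, ae_iff, ae_iff]
  constructor
  · intro h
    refine measure_mono_null (t := Real.log '' {y | ¬(y ∈ Ioi 0 → P (Real.log y))}) ?_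
      (addHaar_image_eq_zero_of_differentiableOn_of_addHaar_eq_zero _ ?_ h)
    · intro s hs
      exact ⟨Real.exp s, by simpa [Real.exp_pos] using hs, Real.log_exp s⟩
    · intro y hy
      have hy0 : 0 < y := by
        by_contra h0
        exact hy fun h1 => absurd h1 h0
      exact (Real.differentiableAt_log hy0.ne').differentiableWithinAt
  · intro h
    refine measure_mono_null (t := Real.exp '' {s | ¬P s}) ?_
      (addHaar_image_eq_zero_of_differentiableOn_of_addHaar_eq_zero _
        Real.differentiable_exp.differentiableOn h)
    intro y hy
    simp only [mem_Ioi, Classical.not_imp, mem_ofPred_eq] at hy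
    exact ⟨Real.log y, hy.2, Real.exp_log hy.1⟩

variable {d : ℕ}

theorem ae_comp_log_norm_iff [NeZero d] {P : ℝ → Prop} :
    (∀ᵐ ξ : EuclideanSpace ℝ (Fin d), P (Real.log ‖ξ‖)) ↔ ∀ᵐ s : ℝ, P s :=
  (ae_comp_norm_iff volume (P := fun y => P (Real.log y))).trans ae_comp_log_iff

/-- Test on a Schwartz function whose Fourier transform is `1` on the given compact set. -/
theorem IsLpBoundedMultiplier.locallyIntegrable {p : ℝ≥0∞} {m : EuclideanSpace ℝ (Fin d) → ℂ}
    (hm : IsLpBoundedMultiplier p m) : LocallyIntegrable m := by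
  rw [locallyIntegrable_iff]
  intro K hK
  obtain ⟨R, hR0, hR⟩ := hK.isBounded.exists_pos_norm_le
  let β := scaledBump (EuclideanSpace ℝ (Fin d)) R hR0
  let B : 𝓢(EuclideanSpace ℝ (Fin d), ℂ) := HasCompactSupport.toSchwartzMap
    (f := fun x => ((β x : ℝ) : ℂ)) (β.hasCompactSupport.comp_left (g := Complex.ofReal) rfl)
    (Complex.ofRealCLM.contDiff.comp β.contDiff)
  have h := hm.1 (𝓕⁻ B)
  rw [← fourier_coe, fourier_fourierInv_eq] at h
  refine h.integrableOn.congr_fun (fun ξ hξ => ?_) hK.measurableSet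
  have : β ξ = 1 := β.one_of_mem_closedBall (mem_closedBall_zero_iff.2 (hR ξ hξ))
  change m ξ * ((β ξ : ℝ) : ℂ) = m ξ
  rw [this, Complex.ofReal_one, mul_one]

theorem PairingBound.congr_ae {V : Type*} [NormedAddCommGroup V] [InnerProductSpace ℝ V]
    [FiniteDimensional ℝ V] [MeasurableSpace V] [BorelSpace V] {p q A : ℝ≥0∞} {m m' : V → ℂ}
    (h : PairingBound p q A m) (hm : m =ᵐ[volume] m') : PairingBound p q A m' := by
  intro f g
  rw [← integral_congr_ae (f := fun ξ => m ξ * ((𝓕 f) ξ * (𝓕⁻ g) ξ))]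
  · exact h f g
  · filter_upwards [hm] with ξ hξ
    rw [hξ]

/-- Averaging the symbol over dilations preserves the boundedness of the bilinear form. -/
theorem PairingBound.convolution [NeZero d] {p q A : ℝ≥0∞} [p.HolderConjugate q] {φ : ℝ → ℂ}
    (hφm : Measurable φ) {b : ℝ} (hφb : ∀ s, ‖φ s‖ ≤ b)
    (h : PairingBound p q A (fun ξ : EuclideanSpace ℝ (Fin d) => φ (Real.log ‖ξ‖)))
    (β : ContDiffBump (0 : ℝ)) :
    PairingBound p q A (fun ξ : EuclideanSpace ℝ (Fin d) =>
      ∫ t, β.normed volume t • φ (Real.log ‖ξ‖ - t)) := by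
  intro f g
  set F : EuclideanSpace ℝ (Fin d) → ℂ := fun ξ => (𝓕 f) ξ * (𝓕⁻ g) ξ with hF
  have hFi : Integrable F :=
    (𝓕 f).integrable.mul_bdd (c := (SchwartzMap.seminorm ℝ 0 0) (𝓕⁻ g))
      (𝓕⁻ g).continuous.aestronglyMeasurable
      (Eventually.of_forall fun ξ => norm_le_seminorm ℝ _ ξ)
  have hβi : Integrable (β.normed volume) := β.integrable_normed
  have hsw : ∫ ξ, (∫ t, β.normed volume t • φ (Real.log ‖ξ‖ - t)) * F ξ =
      ∫ t, β.normed volume t • ∫ ξ, φ (Real.log ‖ξ‖ - t) * F ξ := by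
    have hi : Integrable (fun z : EuclideanSpace ℝ (Fin d) × ℝ =>
        φ (Real.log ‖z.1‖ - z.2) * (F z.1 * (β.normed volume z.2 : ℂ)))
        (volume.prod volume) := by
      refine (hFi.mul_prod hβi.ofReal).bdd_mul (c := b)
        (Measurable.aestronglyMeasurable ?_) (Eventually.of_forall fun z => hφb _)
      fun_prop
    have e1 : ∫ ξ, (∫ t, β.normed volume t • φ (Real.log ‖ξ‖ - t)) * F ξ =
        ∫ ξ, ∫ t, φ (Real.log ‖ξ‖ - t) * (F ξ * (β.normed volume t : ℂ)) := by
      refine integral_congr_ae (Eventually.of_forall fun ξ => ?_)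
      simp only
      rw [← integral_mul_const]
      refine integral_congr_ae (Eventually.of_forall fun t => ?_)
      simp only [Complex.real_smul]
      ring
    rw [e1, integral_integral_swap hi]
    refine integral_congr_ae (Eventually.of_forall fun t => ?_)
    simp only
    rw [← integral_smul]
    refine integral_congr_ae (Eventually.of_forall fun ξ => ?_)
    simp only [Complex.real_smul]
    ring
  -- Translation by `t` in `log ‖ξ‖` is dilation by `e^(-t)`, except at `ξ = 0`.
  have ht : ∀ t, ‖∫ ξ, φ (Real.log ‖ξ‖ - t) * F ξ‖ₑ ≤
      A * (eLpNorm f p volume * eLpNorm g q volume) := by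
    intro t
    refine le_of_eq_of_le ?_ (h.comp_smul (Real.exp_pos (-t)).ne' f g)
    congr 1
    refine integral_congr_ae ?_
    filter_upwards [Measure.ae_ne volume (0 : EuclideanSpace ℝ (Fin d))] with ξ hξ
    rw [norm_smul, Real.norm_of_nonneg (Real.exp_pos _).le,
      Real.log_mul (Real.exp_pos _).ne' (norm_ne_zero_iff.2 hξ), Real.log_exp, neg_add_eq_sub]
  rw [hsw]
  calc _ ≤ ∫⁻ t, ‖β.normed volume t • ∫ ξ, φ (Real.log ‖ξ‖ - t) * F ξ‖ₑ :=
        enorm_integral_le_lintegral_enorm _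
    _ ≤ ∫⁻ t, ‖β.normed volume t‖ₑ * (A * (eLpNorm f p volume * eLpNorm g q volume)) := by
      refine lintegral_mono fun t => ?_
      rw [enorm_smul]
      gcongr
      exact ht t
    _ = (∫⁻ t, ‖β.normed volume t‖ₑ) * (A * (eLpNorm f p volume * eLpNorm g q volume)) :=
      lintegral_mul_const _ (β.continuous_normed.enorm.measurable)
    _ = _ := by
      have : ∫⁻ t, ‖β.normed volume t‖ₑ = 1 := by
        rw [← ofReal_integral_norm_eq_lintegral_enorm hβi]
        simp_rw [Real.norm_of_nonneg (β.nonneg_normed _)]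
        rw [β.integral_normed, ENNReal.ofReal_one]
      rw [this, one_mul]

/-- An `L_p`-bounded radial multiplier has the modulus of continuity given by the Kakeya function
on a set of full measure. -/
theorem exists_ae_enorm_sub_le_kakeyaModulus (d : ℕ) [NeZero d] :
    ∃ C : ℝ≥0, ∀ p : ℝ≥0∞, 1 ≤ p → ∀ φ : ℝ → ℂ, AEStronglyMeasurable φ volume →
      IsLpBoundedMultiplier p (fun ξ : EuclideanSpace ℝ (Fin d) => φ (Real.log ‖ξ‖)) →
      ∃ G : Set ℝ, (∀ᵐ s, s ∈ G) ∧ ∀ s ∈ G, ∀ t ∈ G, ‖φ s - φ t‖ₑ ≤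
        C * multiplierNorm p (fun ξ : EuclideanSpace ℝ (Fin d) => φ (Real.log ‖ξ‖)) *
          kakeyaModulus d p |s - t| := by
  obtain ⟨C₂, hC₂⟩ := exists_ae_enorm_le_of_pairingBound (EuclideanSpace ℝ (Fin d))
  obtain ⟨C, hC⟩ := exists_enorm_sub_le_kakeyaModulus d C₂
  refine ⟨C, fun p hp φ hφ hm => ?_⟩
  have hpq : p.HolderConjugate p.conjExponent := .conjExponent hp
  obtain ⟨A, hA⟩ : ∃ A : ℝ≥0, A = multiplierNorm p _ := ⟨_, ENNReal.coe_toNNReal hm.2.ne⟩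
  have hPB := pairingBound_multiplierNorm (q := p.conjExponent) hm
  rw [← hA] at hPB ⊢
  have hb := (ae_comp_log_norm_iff (d := d) (P := fun s => ‖φ s‖ₑ ≤ C₂ * A)).1
    (hC₂ _ _ _ hpq _ hm.locallyIntegrable hPB)
  -- A version that is measurable and bounded everywhere, obtained by putting `0` where the sup
  -- bound fails.
  obtain ⟨φ₀, hφ₀m, hφ₀b, hφ₀⟩ : ∃ φ₀ : ℝ → ℂ, Measurable φ₀ ∧ (∀ s, ‖φ₀ s‖ ≤ C₂ * A) ∧
      φ =ᵐ[volume] φ₀ := by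
    refine ⟨{s | ‖hφ.mk φ s‖ ≤ C₂ * A}.indicator (hφ.mk φ),
      hφ.stronglyMeasurable_mk.measurable.indicator
        (measurableSet_le hφ.stronglyMeasurable_mk.measurable.norm measurable_const),
      fun s => ?_, ?_⟩
    · by_cases hs : ‖hφ.mk φ s‖ ≤ C₂ * A
      · rwa [indicator_of_mem (by exact hs)]
      · rw [indicator_of_notMem (by exact hs), norm_zero]
        positivity
    · filter_upwards [hφ.ae_eq_mk, hb] with s hs hsb
      rw [indicator_of_mem, hs]
      rw [mem_ofPred_eq, ← hs]
      exact_mod_cast enorm_le_coe.1 (hsb.trans_eq (ENNReal.coe_mul C₂ A).symm)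
  have hPB₀ : PairingBound p p.conjExponent A
      (fun ξ : EuclideanSpace ℝ (Fin d) => φ₀ (Real.log ‖ξ‖)) :=
    hPB.congr_ae (ae_comp_log_norm_iff.2 hφ₀)
  have hli : LocallyIntegrable φ₀ := by
    refine (locallyIntegrable_const (C₂ * A : ℝ)).mono hφ₀m.aestronglyMeasurable
      (Eventually.of_forall fun s => (hφ₀b s).trans (le_abs_self _))
  let β : ℕ → ContDiffBump (0 : ℝ) := fun n =>
    scaledBump ℝ (1 / ((n : ℝ) + 1)) Nat.one_div_pos_of_nat
  let ψ : ℕ → ℝ → ℂ := fun n s => ∫ t, (β n).normed volume t • φ₀ (s - t)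
  have hψc : ∀ n, Continuous (ψ n) := fun n =>
    (β n).hasCompactSupport_normed.continuous_convolution_left (ContinuousLinearMap.lsmul ℝ ℝ)
      (β n).continuous_normed hli
  have hψb : ∀ n s, ‖ψ n s‖ ≤ C₂ * A := by
    intro n s
    refine (norm_integral_le_of_norm_le ((β n).integrable_normed.mul_const (C₂ * A : ℝ))
      (Eventually.of_forall fun t => ?_)).trans_eq ?_
    · rw [norm_smul, Real.norm_of_nonneg ((β n).nonneg_normed _)]
      exact mul_le_mul_of_nonneg_left (hφ₀b _) ((β n).nonneg_normed _)
    · rw [integral_mul_const, (β n).integral_normed, one_mul]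
  have hlim : ∀ᵐ s, Tendsto (fun n => ψ n s) atTop (𝓝 (φ₀ s)) := by
    refine ContDiffBump.ae_convolution_tendsto_right_of_locallyIntegrable (φ := β) (K := 2) ?_
      (Eventually.of_forall fun n => le_rfl) hli
    have : Tendsto (fun n : ℕ => 2 * (1 / ((n : ℝ) + 1))) atTop (𝓝 (2 * 0)) :=
      tendsto_one_div_add_atTop_nhds_zero_nat.const_mul 2
    rwa [mul_zero] at this
  -- The estimate for the mollified symbols is uniform in `n`, so it passes to the limit at any two
  -- points where they converge.
  refine ⟨{s | φ s = φ₀ s ∧ Tendsto (fun n => ψ n s) atTop (𝓝 (φ₀ s))}, hφ₀.and hlim, ?_⟩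
  rintro s ⟨hs, hs'⟩ t ⟨ht, ht'⟩
  rw [hs, ht]
  refine le_of_tendsto (hs'.sub ht').enorm (Eventually.of_forall fun n => ?_)
  exact hC p _ hpq A (ψ n) (hψc n) (hψb n) (hPB₀.convolution hφ₀m hφ₀b (β n)) s t

end RadialSymbols

/-! ### Continuous versions when the Kakeya integral converges. -/

section Continuity

open Filter Topology

/-- Absolute continuity of a finite integral over intervals shrinking to `0`. -/
theorem tendsto_kakeyaModulus {d : ℕ} [NeZero d] {p : ℝ≥0∞}
    (h : ∫⁻ δ in Ioo (0 : ℝ) 1, ENNReal.ofReal (kakeyaDensity d p δ) ≠ ∞) :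
    Tendsto (kakeyaModulus d p) (𝓝 0) (𝓝 0) := by
  have hr : Tendsto (fun r : ℝ => r ^ (1 / 4 : ℝ)) (𝓝 0) (𝓝 0) := by
    have := (Real.continuousAt_rpow_const 0 (1 / 4 : ℝ) (Or.inr (by norm_num))).tendsto
    rwa [Real.zero_rpow (by norm_num)] at this
  have h2 := (ENNReal.continuous_ofReal.tendsto 0).comp hr
  rw [ENNReal.ofReal_zero] at h2
  have hs : Tendsto ((volume.restrict (Ioo (0 : ℝ) 1)) ∘
      fun r : ℝ => Ioo (0 : ℝ) (min 1 (r ^ (1 / 4 : ℝ)))) (𝓝 0) (𝓝 0) := by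
    refine tendsto_of_tendsto_of_tendsto_of_le_of_le tendsto_const_nhds h2 (fun _ => zero_le)
      fun r => ?_
    refine (Measure.restrict_apply_le _ _).trans ?_
    rw [Real.volume_Ioo, sub_zero]
    exact ENNReal.ofReal_le_ofReal (min_le_right _ _)
  have h1 := tendsto_setLIntegral_zero h hs
  have := h1.add h2
  rw [add_zero] at this
  refine this.congr fun r => ?_
  rw [kakeyaModulus, Measure.restrict_restrict measurableSet_Ioo,
    inter_eq_left.2 (Ioo_subset_Ioo_right (min_le_left _ _))]
  rfl

/-- A function with a modulus of continuity on a set of full measure has a continuous version. -/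
theorem exists_continuous_ae_eq {φ : ℝ → ℂ} {G : Set ℝ} (hG : ∀ᵐ s, s ∈ G) {K : ℝ≥0}
    {ω : ℝ → ℝ≥0∞} (hω : Tendsto ω (𝓝 0) (𝓝 0))
    (h : ∀ s ∈ G, ∀ t ∈ G, ‖φ s - φ t‖ₑ ≤ K * ω |s - t|) :
    ∃ g : ℝ → ℂ, Continuous g ∧ φ =ᵐ[volume] g := by
  have hd : DenseRange ((↑) : G → ℝ) := (Measure.dense_of_ae hG).denseRange_val
  have hu : UniformContinuous (fun s : G => φ s) := by
    have hω' : Tendsto (fun r => (K : ℝ≥0∞) * ω r) (𝓝 0) (𝓝 0) := by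
      simpa using ENNReal.Tendsto.const_mul hω (Or.inr ENNReal.coe_ne_top) (a := (K : ℝ≥0∞))
    rw [EMetric.uniformContinuous_iff]
    intro ε hε
    obtain ⟨r, hr, hr'⟩ := Metric.eventually_nhds_iff.1 (hω'.eventually_lt_const hε)
    refine ⟨ENNReal.ofReal r, ENNReal.ofReal_pos.2 hr, fun {s t} hst => ?_⟩
    rw [edist_eq_enorm_sub]
    refine (h s s.2 t t.2).trans_lt (hr' ?_)
    rw [edist_lt_ofReal, Subtype.dist_eq, Real.dist_eq] at hst
    simpa using hst
  refine ⟨_, (uniformContinuous_uniformly_extend (isUniformInducing_val G) hd hu).continuous, ?_⟩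
  filter_upwards [hG] with s hs
  exact (uniformly_extend_of_ind (isUniformInducing_val G) hd hu ⟨s, hs⟩).symm

theorem IsLpBoundedMultiplier.congr_ae {d : ℕ} {p : ℝ≥0∞} {m m' : EuclideanSpace ℝ (Fin d) → ℂ}
    (hm : IsLpBoundedMultiplier p m) (h : m =ᵐ[volume] m') : IsLpBoundedMultiplier p m' := by
  have hf : ∀ f : 𝓢(EuclideanSpace ℝ (Fin d), ℂ),
      (fun ξ => m ξ * 𝓕 (f : EuclideanSpace ℝ (Fin d) → ℂ) ξ) =ᵐ[volume]
        fun ξ => m' ξ * 𝓕 (f : EuclideanSpace ℝ (Fin d) → ℂ) ξ := fun f => by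
    filter_upwards [h] with ξ hξ
    rw [hξ]
  have hT : fourierMultiplier m = fourierMultiplier m' := by
    funext f x
    rw [fourierMultiplier, fourierMultiplier, Real.fourierInv_eq, Real.fourierInv_eq]
    refine integral_congr_ae ?_
    filter_upwards [hf f] with ξ hξ
    rw [hξ]
  refine ⟨fun f => (hm.1 f).congr (hf f), ?_⟩
  have := hm.2
  rwa [multiplierNorm, hT] at this

end Continuity

theorem corollary1p5 (d : ℕ) [NeZero d] :
    (∃ C : ℝ≥0, ∀ (p : ℝ≥0∞), 1 ≤ p → ∀ φ : ℝ → ℂ, AEStronglyMeasurable φ volume →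
      IsLpBoundedMultiplier p
        (fun ξ : EuclideanSpace ℝ (Fin d) => φ (Real.log ‖ξ‖)) →
      ∀ᵐ z : ℝ × ℝ ∂volume,
        ENNReal.ofReal ‖φ z.1 - φ z.2‖ ≤
          C * multiplierNorm p (fun ξ : EuclideanSpace ℝ (Fin d) => φ (Real.log ‖ξ‖)) *
            ((∫⁻ δ in Ioo (0 : ℝ) (min 1 (|z.1 - z.2| ^ (1 / 4 : ℝ))),
                ENNReal.ofReal (kakeyaDensity d p δ)) +
              ENNReal.ofReal (|z.1 - z.2| ^ (1 / 4 : ℝ)))) ∧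
    (∀ (p : ℝ≥0∞), 1 ≤ p →
      (∃ m : ℝ → ℂ, AEStronglyMeasurable m (volume.restrict (Ioi 0)) ∧
        IsLpBoundedMultiplier p (fun ξ : EuclideanSpace ℝ (Fin d) => m ‖ξ‖) ∧
        ¬ ∃ g : ℝ → ℂ, ContinuousOn g (Ioi 0) ∧ m =ᵐ[volume.restrict (Ioi 0)] g) →
      ∫⁻ δ in Ioo (0 : ℝ) 1, ENNReal.ofReal (kakeyaDensity d p δ) = ∞) := by
  obtain ⟨C, hC⟩ := exists_ae_enorm_sub_le_kakeyaModulus d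
  refine ⟨⟨C, fun p hp φ hφ hm => ?_⟩, fun p hp ⟨m, hmm, hm, hmc⟩ => ?_⟩
  · obtain ⟨G, hG, h⟩ := hC p hp φ hφ hm
    filter_upwards [Measure.quasiMeasurePreserving_fst.ae hG,
      Measure.quasiMeasurePreserving_snd.ae hG] with z h1 h2
    rw [ofReal_norm]
    exact h _ h1 _ h2
  · by_contra hfin
    refine hmc ?_
    -- Needed for `m ∘ exp` to be almost everywhere strongly measurable.
    have hexp : Measure.QuasiMeasurePreserving Real.exp volume (volume.restrict (Ioi 0)) := by
      refine ⟨Real.measurable_exp, Measure.AbsolutelyContinuous.mk fun s hs h0 => ?_⟩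
      rw [Measure.map_apply Real.measurable_exp hs]
      have h1 : ∀ᵐ y ∂(volume.restrict (Ioi (0 : ℝ))), Real.exp (Real.log y) ∉ s := by
        filter_upwards [measure_eq_zero_iff_ae_notMem.1 h0, ae_restrict_mem measurableSet_Ioi]
          with y hy hy0
        rwa [Real.exp_log hy0]
      exact measure_eq_zero_iff_ae_notMem.2 (ae_comp_log_iff.1 h1)
    -- The two symbols differ at most at `ξ = 0`, where `exp (log 0) = 1`.
    have hm' : IsLpBoundedMultiplier p
        (fun ξ : EuclideanSpace ℝ (Fin d) => m (Real.exp (Real.log ‖ξ‖))) := by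
      refine hm.congr_ae ?_
      filter_upwards [Measure.ae_ne volume (0 : EuclideanSpace ℝ (Fin d))] with ξ hξ
      rw [Real.exp_log (norm_pos_iff.2 hξ)]
    obtain ⟨G, hG, h⟩ := hC p hp (fun s => m (Real.exp s))
      (hmm.comp_quasiMeasurePreserving hexp) hm'
    obtain ⟨A, hA⟩ : ∃ A : ℝ≥0, A = multiplierNorm p _ := ⟨_, ENNReal.coe_toNNReal hm'.2.ne⟩
    rw [← hA, ← ENNReal.coe_mul] at h
    obtain ⟨g, hg, hmg⟩ := exists_continuous_ae_eq hG (tendsto_kakeyaModulus hfin) h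
    refine ⟨fun y => g (Real.log y), hg.comp_continuousOn
      (Real.continuousOn_log.mono fun y hy => ne_of_gt hy), ?_⟩
    filter_upwards [ae_comp_log_iff.2 hmg, ae_restrict_mem measurableSet_Ioi] with y hy hy0
    rwa [Real.exp_log hy0] at hy
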